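/- Let $d\ge 0$, $\Theta=\mathbb R^d$, and let $\mathcal F$ be a real Hilbert space. For $\alpha=\Theta$ or $\alpha=\Theta\times\Theta$ let $\mathcal P(\alpha)$ be the set of probability densities on $\alpha$ with respect to Lebesgue measure. Let $R:\mathcal F\to[0,\infty)$ be convex and Fréchet differentiable, let $\Psi:\Theta\to\mathcal F$ be Fréchet differentiable and such that $\langle\Psi,\rho\rangle:=\int_\Theta\Psi(\theta)\rho(\theta)\,d\theta$ exists (as a Bochner integral) for every $\rho\in L^1(\Theta)$, and let $g:\Theta\to[0,\infty)$ be differentiable with $g(\theta)\to\infty$ as $|\theta|\to\infty$ and $\int_\Theta e^{-\beta g}<\infty$ for all $\beta>0$. For $\lambda\in[0,1]$ put $$F_\lambda(\rho)=R(\langle\Psi,\rho\rangle)+\lambda\int_\Theta g\rho\,d\theta\in[0,\infty],\qquad F=F_1,$$ $$F_0'(\rho)(\theta)=\langle R'(\langle\Psi,\rho\rangle),\Psi(\theta)\rangle_{\mathcal F},\qquad F'(\rho)(\theta)=F_0'(\rho)(\theta)+g(\theta).$$ Assume that $\sup_{\rho\in\mathcal P(\Theta)}\|\nabla F'(\rho)\|_{L^\infty(\Theta)}<\infty$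 and that the family $\{F_0'(\rho):\rho\in L^1(\Theta),\ \|\rho\|_{1}\le1\}$ is uniformly equicontinuous and uniformly bounded. For $\beta,\gamma>0$, a density $\rho^\star\in\mathcal P(\Theta\times\Theta)$ with position marginal $[\rho^\star]^\theta(\theta)=\int\rho^\star(\theta,r)\,dr$ is called a stationary solution if the constant trajectory $\rho_t\equiv\rho^\star$, $t\ge0$, is a weak (distributional) solution of the nonlinear kinetic Fokker–Planck equation $$\partial_t\rho_t=-\nabla_{(\theta,r)}\cdot\left[\rho_t\begin{pmatrix} r\\ -\nabla F'([\rho_t]^\theta)(\theta)-\gamma r\end{pmatrix}\right]+\gamma\beta^{-1}\Delta_r\rho_t .$$ Then there is a constant $C\ge0$, depending only on $F$ (that is, on $R,\Psi,g$) and $d$, such that for all $\beta\ge1$, all $\gamma>0$ and every stationary solution $\rho^\star$ for $(\beta,\gamma)$, $$F_{1-1/\beta}([\rho^\star]^\theta)\le\inf_{\rho\in\mathcal P(\Theta)}F(\rho)+\frac{C+d\log\beta}{\beta}.$$ Consequently, for every $\varepsilon>0$ there is $\beta_0\ge1$ such that for all $\beta\ge\beta_0$, all $\gamma>0$ and every stationary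 solution $\rho^\star$ for $(\beta,\gamma)$, $F([\rho^\star]^\theta)\le\inf_{\rho\in\mathcal P(\Theta)}F(\rho)+\varepsilon$. -/

import Mathlib

open MeasureTheory Filter Topology
open scoped ENNReal ContDiff

noncomputable section

namespace HeavyBall

/-- The parameter space `Θ = ℝ^d` with its Euclidean norm. -/
abbrev Param (d : ℕ) : Type := EuclideanSpace ℝ (Fin d)

/-- The tangent bundle `ℝ^d × ℝ^d` of position-velocity pairs `(θ, r)`, with Lebesgue measure. -/
abbrev Phase (d : ℕ) : Type := Param d × Param d

/-- `ρ` is a probability density with respect to the reference (Lebesgue) measure. -/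
structure IsDensity {α : Type*} [MeasureSpace α] (ρ : α → ℝ) : Prop where
  integrable : Integrable ρ
  nonneg : ∀ᵐ x, 0 ≤ ρ x
  integral_eq_one : ∫ x, ρ x = 1

/-- The position marginal `[ρ]^θ` of a density on phase space. -/
def marginal {d : ℕ} (ρ : Phase d → ℝ) : Param d → ℝ :=
  fun θ => ∫ r, ρ (θ, r)

section Functional

variable {d : ℕ} {H : Type*} [NormedAddCommGroup H] [InnerProductSpace ℝ H]

/-- The model output `⟨Ψ, ρ⟩ = ∫ Ψ(θ) ρ(θ) dθ`. -/
def output (Ψ : Param d → H) (ρ : Param d → ℝ) : H :=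
  ∫ θ, ρ θ • Ψ θ

/-- The functional `F_lam(ρ) = R(⟨Ψ, ρ⟩) + lam ⟨g, ρ⟩` for nonnegative `R`, `g`, `lam`, with values
in `[0, ∞]`: it is infinite when `lam > 0` and `⟨g, ρ⟩ = ∞`. -/
def objective (R : H → ℝ) (Ψ : Param d → H) (g : Param d → ℝ) (lam : ℝ)
    (ρ : Param d → ℝ) : ℝ≥0∞ :=
  ENNReal.ofReal (R (output Ψ ρ)) + ENNReal.ofReal lam * ∫⁻ θ, ENNReal.ofReal (g θ * ρ θ)

/-- The differential `F₀'(ρ)(θ) = ⟨R'(⟨Ψ, ρ⟩), Ψ(θ)⟩` of `F₀(ρ) = R(⟨Ψ, ρ⟩)`. -/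
def dRisk (R : H → ℝ) (Ψ : Param d → H) (ρ : Param d → ℝ) (θ : Param d) : ℝ :=
  fderiv ℝ R (output Ψ ρ) (Ψ θ)

/-- The differential `F'(ρ)(θ) = F₀'(ρ)(θ) + g(θ)` of `F = F₁`. -/
def dObjective (R : H → ℝ) (Ψ : Param d → H) (g : Param d → ℝ) (ρ : Param d → ℝ)
    (θ : Param d) : ℝ :=
  dRisk R Ψ ρ θ + g θ

/-- The standing assumptions on the risk `R`, the features `Ψ` and the regularizer `g`. -/
structure Assumptions (R : H → ℝ) (Ψ : Param d → H) (g : Param d → ℝ) : Prop where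
  /-- The risk is nonnegative, convex and Fréchet differentiable. -/
  risk_nonneg : ∀ ψ, 0 ≤ R ψ
  risk_convex : ConvexOn ℝ Set.univ R
  risk_differentiable : Differentiable ℝ R
  /-- The feature map is Fréchet differentiable. -/
  feature_differentiable : Differentiable ℝ Ψ
  /-- The integral `⟨Ψ, ρ⟩` makes sense for every `ρ ∈ L¹`. -/
  feature_integrable : ∀ ρ : Param d → ℝ, Integrable ρ → Integrable (fun θ => ρ θ • Ψ θ)
  /-- `∇F'(ρ) ∈ L^∞`, with a bound that is uniform over probability densities `ρ`. -/
  gradient_bounded : ∃ L : ℝ, ∀ ρ : Param d → ℝ, IsDensity ρ →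
    ∀ᵐ θ, ‖gradient (dObjective R Ψ g ρ) θ‖ ≤ L
  /-- The functions `F₀'(ρ)`, `‖ρ‖₁ ≤ 1`, are uniformly equicontinuous and uniformly bounded. -/
  dRisk_equicontinuous : UniformEquicontinuous
    (fun ρ : {ρ : Param d → ℝ // Integrable ρ ∧ ∫ θ, |ρ θ| ≤ 1} => dRisk R Ψ ρ.1)
  dRisk_bounded : ∃ M : ℝ, ∀ ρ : Param d → ℝ, Integrable ρ → ∫ θ, |ρ θ| ≤ 1 →
    ∀ θ, |dRisk R Ψ ρ θ| ≤ M
  /-- The regularizer is nonnegative, differentiable and confining. -/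
  reg_nonneg : ∀ θ, 0 ≤ g θ
  reg_differentiable : Differentiable ℝ g
  reg_tendsto : Tendsto g (cocompact (Param d)) atTop
  reg_integrable : ∀ β : ℝ, 0 < β → Integrable (fun θ => Real.exp (-(β * g θ)))

/-- The generator of the mean field underdamped Langevin dynamics, for the interaction potential
`F'(η)`, applied to a test function `φ`:
`⟨r, ∇_θ φ⟩ + ⟨-∇F'(η)(θ) - γ r, ∇_r φ⟩ + γ β⁻¹ Δ_r φ`. -/
def generator (R : H → ℝ) (Ψ : Param d → H) (g : Param d → ℝ) (β γ : ℝ) (η : Param d → ℝ)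
    (φ : Phase d → ℝ) (x : Phase d) : ℝ :=
  inner ℝ x.2 (gradient (fun θ => φ (θ, x.2)) x.1)
    + inner ℝ (-gradient (dObjective R Ψ g η) x.1 - γ • x.2) (gradient (fun r => φ (x.1, r)) x.2)
    + γ * β⁻¹ * Laplacian.laplacian (fun r => φ (x.1, r)) x.2

/-- A trajectory `t ↦ ρ_t`, `t ≥ 0`, of probability densities on phase space, continuous for the
weak topology of measures, is a weak (distributional) solution of the nonlinear kinetic
Fokker-Planck equation
`∂_t ρ = -∇ · [ρ (r, -∇F'([ρ]^θ) - γ r)] + γ β⁻¹ Δ_r ρ`. -/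
structure IsWeakSolution (R : H → ℝ) (Ψ : Param d → H) (g : Param d → ℝ) (β γ : ℝ)
    (ρ : ℝ → Phase d → ℝ) : Prop where
  density : ∀ t, 0 ≤ t → IsDensity (ρ t)
  continuous : ∀ φ : BoundedContinuousFunction (Phase d) ℝ,
    ContinuousOn (fun t => ∫ x, φ x * ρ t x) (Set.Ici 0)
  evolution : ∀ φ : Phase d → ℝ, ContDiff ℝ ∞ φ → HasCompactSupport φ → ∀ t, 0 ≤ t →
    IntervalIntegrable
      (fun s => ∫ x, generator R Ψ g β γ (marginal (ρ s)) φ x * ρ s x) volume 0 t ∧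
    (∫ x, φ x * ρ t x) - (∫ x, φ x * ρ 0 x)
      = ∫ s in (0 : ℝ)..t, ∫ x, generator R Ψ g β γ (marginal (ρ s)) φ x * ρ s x

/-- `ρ` is a stationary solution: the trajectory that starts at `ρ` and stays there solves the
Fokker-Planck equation. -/
def IsStationary (R : H → ℝ) (Ψ : Param d → H) (g : Param d → ℝ) (β γ : ℝ)
    (ρ : Phase d → ℝ) : Prop :=
  IsWeakSolution R Ψ g β γ (fun _ => ρ)

end Functional

end HeavyBall

end

/-! Freezing the potential `V = F'([ρ⋆]^θ)` turns stationarity into a linear kinetic Fokker-Planck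
equation with diffusion coefficient `σ = γ / β`, for which `e^{-βH}`, with `H = V + |r|²/2`, is an
equilibrium. The heart of the proof is that every stationary density is a multiple of `e^{-βH}`,
although no moments, entropy bound or smoothness of `ρ⋆` are available and `∇V` is only bounded.

Put `h = ρ⋆ e^{βH}`. Testing the equation with `χ / (1 + h)`, `χ` a cutoff, formally gives `σ ∫ χ
e^{-βH} |∇_r log(1 + h)|² = -∫ e^{-βH} log(1 + h) Lχ`, where `L` is the generator. Since `e^{-βH}
log(1 + h) ≤ ρ⋆`, the right side vanishes as the cutoff spreads out, and no entropy has to be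
finite. So `h` does not depend on `r` (`exists_ae_eq_comp_fst`). What remains of the equation is `r
· ∇_θ h = 0`; tested with a velocity derivative it yields `∇_θ h = 0`, because the commutator of
`∂_r` with `r · ∇_θ` is `∂_θ` (`exists_ae_density_eq_const`).

The formal computation is done on smooth approximations (`exists_isRegularization`). A kernel much
thinner in velocity than in position makes the transport commutator small in `L¹`. The drift error
`E` is small in `L¹` and pointwise at most a multiple of the density, so that its quadratic
contribution is small as well (`drift_error_le`).

Integrating out `r`, the position marginal `m` is proportional to `e^{-βV}`. By convexity of `R`,
`F(m) - F(η) ≤ ∫ V m - ∫ V η ≤ ∫ V m - min V` for any competitor `η`. Nonnegativity of the entropy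
of `m` relative to the normalized `e^{-g}` gives `β ∫ V m ≤ ∫ g m - log ∫ e^{-βV} + log ∫ e^{-g}`,
and the Lipschitz bound on `V` gives `-log ∫ e^{-βV} ≤ β min V + d log β + const`. Moving `∫ g m /
β` to the left turns `F` into `F_{1-1/β}` (`Assumptions.objective_gibbs_le`). The second claim
follows from `(1 - 1/β) F ≤ F_{1-1/β}`. -/

noncomputable section

namespace HeavyBall

/-! ### Mollification in `L¹` and functions with vanishing weak derivatives -/

section Mollification

set_option linter.unusedSectionVars false

variable {G : Type*} [NormedAddCommGroup G] [NormedSpace ℝ G] [FiniteDimensional ℝ G]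
  [MeasureSpace G] [BorelSpace G] [(volume : Measure G).IsAddHaarMeasure]

/-- A function that is integrable together with a directional derivative has a directional
derivative of integral zero. -/
theorem integral_lineDeriv_eq_zero {f f' : G → ℝ} {v : G} (hf : Integrable f)
    (hf' : Integrable f') (h : ∀ x, HasLineDerivAt ℝ f (f' x) x v) : ∫ x, f' x = 0 := by
  have := integral_bilinear_hasLineDerivAt_right_eq_neg_left_of_integrable (μ := volume)
    (f := fun _ : G => (1 : ℝ)) (f' := fun _ => 0) (g := f) (g' := f') (v := v)
    (B := ContinuousLinearMap.mul ℝ ℝ) (by simp) (by simpa using hf') (by simpa using hf)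
    (fun x _ => (by simpa [HasLineDerivAt] using hasDerivAt_const (0 : ℝ) (1 : ℝ))) (fun x _ => h x)
  simpa using this

/-- The convolution of a kernel `k` with `f`. -/
def mollify (k f : G → ℝ) (x : G) : ℝ := ∫ y, k (x - y) * f y

theorem mollify_eq_convolution (k f : G → ℝ) :
    mollify k f = convolution k f (ContinuousLinearMap.lsmul ℝ ℝ) volume := by
  ext x
  rw [convolution_lsmul_swap]
  rfl

theorem contDiff_mollify {k f : G → ℝ} (hk : ContDiff ℝ ∞ k) (hc : HasCompactSupport k)
    (hf : LocallyIntegrable f) : ContDiff ℝ ∞ (mollify k f) := by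
  rw [mollify_eq_convolution]
  exact hc.contDiff_convolution_left _ hk hf

theorem fderiv_mollify {k f : G → ℝ} (hk : ContDiff ℝ ∞ k) (hc : HasCompactSupport k)
    (hf : LocallyIntegrable f) (x v : G) :
    fderiv ℝ (mollify k f) x v = mollify (fun y => fderiv ℝ k y v) f x := by
  have hk1 : ContDiff ℝ 1 k := hk.of_le (by simp)
  have h := hc.hasFDerivAt_convolution_left (ContinuousLinearMap.lsmul ℝ ℝ) hk1 hf x
  rw [← mollify_eq_convolution] at h
  rw [h.fderiv, mollify_eq_convolution]
  have hex : ConvolutionExistsAt (fderiv ℝ k) f x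
      ((ContinuousLinearMap.lsmul ℝ ℝ).precompL G) volume :=
    (hc.fderiv ℝ).convolutionExists_left _ (hk1.continuous_fderiv (by simp)) hf x
  rw [convolution_def, ContinuousLinearMap.integral_apply hex, convolution_def]
  rfl

theorem integrable_mollify_integrand {k f : G → ℝ} (hk : Continuous k) (hc : HasCompactSupport k)
    (hf : LocallyIntegrable f) (x : G) : Integrable (fun y => k (x - y) * f y) := by
  have h1 : Continuous fun y => k (x - y) := by fun_prop
  have h2 : HasCompactSupport fun y => k (x - y) :=
    hc.comp_homeomorph (Homeomorph.subLeft x)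
  exact hf.integrable_smul_left_of_hasCompactSupport h1 h2

theorem integrable_mollify {k f : G → ℝ} (hk : Integrable k) (hf : Integrable f) :
    Integrable (mollify k f) := by
  rw [mollify_eq_convolution]
  exact hk.integrable_convolution _ hf

theorem integrable_mollify_prod {k f : G → ℝ} (hk : Integrable k) (hf : Integrable f) :
    Integrable (fun p : G × G => k (p.1 - p.2) * f p.2) (volume.prod volume) := by
  have h := (hf.convolution_integrand (ContinuousLinearMap.lsmul ℝ ℝ) hk)
  refine h.congr (ae_of_all _ fun p => ?_)
  simp [mul_comm]

theorem integral_abs_mollify_le {k f : G → ℝ} (hk : Integrable k) (hf : Integrable f) :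
    ∫ x, |mollify k f x| ≤ (∫ x, |k x|) * ∫ x, |f x| := by
  have hp := (integrable_mollify_prod hk.abs hf.abs)
  calc ∫ x, |mollify k f x| ≤ ∫ x, mollify (fun y => |k y|) (fun y => |f y|) x := by
        refine integral_mono (integrable_mollify hk hf).abs
          (integrable_mollify hk.abs hf.abs) fun x => ?_
        refine (abs_integral_le_integral_abs).trans (le_of_eq ?_)
        simp [mollify, abs_mul]
    _ = ∫ y, ∫ x, |k (x - y)| * |f y| := by
        exact integral_integral_swap hp
    _ = _ := by
        simp_rw [integral_mul_const]
        have : ∀ y : G, ∫ x, |k (x - y)| = ∫ x, |k x| := fun y =>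
          integral_sub_right_eq_self (fun x => |k x|) y
        simp_rw [this, integral_const_mul]

/-- Translations act continuously on `L¹`. -/
theorem exists_integral_abs_translate_sub_le {f : G → ℝ} (hf : Integrable f) {κ : ℝ} (hκ : 0 < κ) :
    ∃ δ > 0, ∀ z : G, ‖z‖ < δ → ∫ x, |f (x - z) - f x| ≤ κ := by
  let F : Lp ℝ 1 (volume : Measure G) := hf.toL1 f
  have : Fact ((1 : ℝ≥0∞) ≠ ⊤) := ⟨by simp⟩
  have hc : Continuous fun z : G => (DomAddAct.mk z) +ᵥ F :=
    (DomAddAct.continuous_mk).vadd continuous_const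
  have h0 := Metric.tendsto_nhds.1 (hc.tendsto 0) κ hκ
  obtain ⟨δ, hδ, h⟩ := Metric.eventually_nhds_iff.1 h0
  refine ⟨δ, hδ, fun z hz => ?_⟩
  -- The action of `DomAddAct.mk c` precomposes with translation by `c`, so `x ↦ f (x - z)`
  -- corresponds to `c = -z`.
  have hd := h (y := -z) (by simpa using hz)
  simp only [DomAddAct.mk_zero, zero_vadd] at hd
  rw [dist_eq_norm, L1.norm_eq_integral_norm] at hd
  refine le_trans (le_of_eq (integral_congr_ae ?_)) hd.le
  have e1 := Lp.coeFn_sub ((DomAddAct.mk (-z)) +ᵥ F) F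
  have e2 := DomAddAct.vadd_Lp_ae_eq (DomAddAct.mk (-z)) F
  have e3 : F =ᵐ[volume] f := hf.coeFn_toL1
  have e4 : (fun x => F (-z +ᵥ x)) =ᵐ[volume] fun x => f (-z +ᵥ x) :=
    (measurePreserving_vadd (-z) (volume : Measure G)).quasiMeasurePreserving.ae_eq_comp e3
  filter_upwards [e1, e2, e3, e4] with x h1 h2 h3 h4
  rw [h1, Pi.sub_apply, h2, h3, Real.norm_eq_abs]
  have h5 : F (-z +ᵥ x) = f (x - z) := by rw [h4, vadd_eq_add, neg_add_eq_sub]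
  rw [← h5]
  rfl

/-- Smooth approximations of the identity converge in `L¹`. -/
theorem exists_integral_abs_mollify_sub_le {f : G → ℝ} (hf : Integrable f) {κ : ℝ} (hκ : 0 < κ) :
    ∃ δ > 0, ∀ k : G → ℝ, Continuous k → HasCompactSupport k → (∀ z, 0 ≤ k z) → ∫ z, k z = 1 →
      (∀ z, δ ≤ ‖z‖ → k z = 0) → ∫ x, |mollify k f x - f x| ≤ κ := by
  obtain ⟨δ, hδ, h⟩ := exists_integral_abs_translate_sub_le hf hκ
  refine ⟨δ, hδ, fun k hk hc hk0 hk1 hks => ?_⟩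
  have hki : Integrable k := hk.integrable_of_hasCompactSupport hc
  have hrep : ∀ x, mollify k f x - f x = ∫ z, k z * (f (x - z) - f x) := by
    intro x
    have i1 : Integrable fun z => k z * f (x - z) := by
      have := (integrable_mollify_integrand hk hc hf.locallyIntegrable x).comp_sub_left x
      simpa using this
    have e1 : mollify k f x = ∫ z, k z * f (x - z) := by
      rw [mollify, ← integral_sub_left_eq_self _ _ x]
      simp
    simp_rw [mul_sub]
    rw [integral_sub i1 (hki.mul_const _), integral_mul_const, hk1, one_mul, e1]
  have hp1 : Integrable (fun p : G × G => k p.2 * f (p.1 - p.2)) (volume.prod volume) :=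
    hki.convolution_integrand (ContinuousLinearMap.lsmul ℝ ℝ) hf
  have hp2 : Integrable (fun p : G × G => k p.2 * f p.1) (volume.prod volume) := by
    simpa [mul_comm] using hf.mul_prod hki
  have hp : Integrable (fun p : G × G => |k p.2 * (f (p.1 - p.2) - f p.1)|)
      (volume.prod volume) := by
    refine (hp1.sub hp2).abs.congr (ae_of_all _ fun p => ?_)
    simp [mul_sub]
  calc ∫ x, |mollify k f x - f x| ≤ ∫ x, ∫ z, |k z * (f (x - z) - f x)| := by
        refine integral_mono ((integrable_mollify hki hf).sub hf).abs hp.integral_prod_left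
          fun x => ?_
        simp only [hrep]
        exact abs_integral_le_integral_abs
    _ = ∫ z, ∫ x, |k z * (f (x - z) - f x)| := integral_integral_swap hp
    _ ≤ ∫ z, k z * κ := by
        refine integral_mono hp.integral_prod_right (hki.mul_const _) fun z => ?_
        simp only [abs_mul, abs_of_nonneg (hk0 z), integral_const_mul]
        rcases lt_or_ge ‖z‖ δ with hz | hz
        · exact mul_le_mul_of_nonneg_left (h z hz) (hk0 z)
        · simp [hks z hz]
    _ = κ := by rw [integral_mul_const, hk1, one_mul]

/-- A function whose distributional derivative vanishes in the directions of a submodule is almost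
everywhere the limit of continuous functions that are invariant under that submodule. -/
theorem exists_tendsto_invariant_of_weak_deriv_eq_zero {f : G → ℝ} (hf : LocallyIntegrable f)
    (S : Submodule ℝ G)
    (h : ∀ v ∈ S, ∀ φ : G → ℝ, ContDiff ℝ ∞ φ → HasCompactSupport φ →
      ∫ x, f x * fderiv ℝ φ x v = 0) :
    ∃ F : ℕ → G → ℝ, (∀ n x, ∀ v ∈ S, F n (x + v) = F n x) ∧
      ∀ᵐ x, Tendsto (fun n => F n x) atTop (𝓝 (f x)) := by
  -- The ratio of outer to inner radius stays equal to 2; almost everywhere convergence of the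
  -- mollifications requires a uniform bound on it.
  let b : ℕ → ContDiffBump (0 : G) := fun n =>
    ⟨1 / (n + 1 : ℝ), 2 / (n + 1 : ℝ), by positivity, by gcongr; norm_num⟩
  have hb : Tendsto (fun n => (b n).rOut) atTop (𝓝 0) := by
    have := (tendsto_one_div_add_atTop_nhds_zero_nat (𝕜 := ℝ)).const_mul 2
    simpa [b, div_eq_mul_inv] using this
  refine ⟨fun n => mollify ((b n).normed volume) f, fun n x v hv => ?_, ?_⟩
  · have hk : ContDiff ℝ ∞ ((b n).normed volume) := (b n).contDiff_normed
    have hc := (b n).hasCompactSupport_normed (μ := volume)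
    have hsm := contDiff_mollify hk hc hf
    have hz : ∀ y, fderiv ℝ (mollify ((b n).normed volume) f) y v = 0 := by
      intro y
      rw [fderiv_mollify hk hc hf, mollify]
      have h1 := h v hv (fun z => (b n).normed volume (y - z)) (by fun_prop)
        (hc.comp_homeomorph (Homeomorph.subLeft y))
      have h2 : ∀ z, fderiv ℝ (fun z => (b n).normed volume (y - z)) z v
          = - fderiv ℝ ((b n).normed volume) (y - z) v := by
        intro z
        have hd : DifferentiableAt ℝ ((b n).normed volume) (y - z) :=
          (hk.differentiable (by simp)).differentiableAt
        have := hd.hasFDerivAt.comp z ((hasFDerivAt_id z).const_sub y)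
        have h3 := this.fderiv
        simp only [Function.comp_def] at h3
        rw [h3]
        simp
      simp_rw [h2, mul_neg, integral_neg, neg_eq_zero] at h1
      simpa [mul_comm] using h1
    have hl : ∀ t : ℝ, HasDerivAt (fun t : ℝ => mollify ((b n).normed volume) f (x + t • v)) 0 t := by
      intro t
      have hd := (hsm.differentiable (by simp) (x + t • v)).hasFDerivAt
      have hg : HasDerivAt (fun t : ℝ => x + t • v) v t := by
        simpa using ((hasDerivAt_id t).smul_const v).const_add x
      have := hd.comp_hasDerivAt t hg
      rwa [hz] at this
    have := is_const_of_deriv_eq_zero (fun t => (hl t).differentiableAt) (fun t => (hl t).deriv) 1 0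
    simpa using this
  · have := ContDiffBump.ae_convolution_tendsto_right_of_locallyIntegrable (μ := volume)
      (φ := b) (l := atTop) (K := 2) hb (Eventually.of_forall fun n => by
        simp [b]; apply le_of_eq; ring) hf
    filter_upwards [this] with x hx
    simpa only [mollify_eq_convolution] using hx

end Mollification

/-! ### From almost everywhere to everywhere gradient bounds -/

section Lipschitz

variable {G : Type*} [NormedAddCommGroup G] [NormedSpace ℝ G] [FiniteDimensional ℝ G]
  [MeasureSpace G] [BorelSpace G] [(volume : Measure G).IsAddHaarMeasure]

/-- Differentiability at every point is essential: with an integrable derivative it gives the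
fundamental theorem of calculus, and the almost everywhere bound supplies the integrability. -/
theorem abs_sub_le_of_ae_abs_deriv_le {f f' : ℝ → ℝ} (h : ∀ t, HasDerivAt f (f' t) t) {C : ℝ}
    (hC : ∀ᵐ t, |f' t| ≤ C) : |f 1 - f 0| ≤ C := by
  have hm : Measurable f' := by
    have : f' = deriv f := funext fun t => ((h t).deriv).symm
    rw [this]
    exact measurable_deriv f
  have hi : IntervalIntegrable f' volume 0 1 := by
    rw [intervalIntegrable_iff]
    exact Measure.integrableOn_of_bounded (by simp) hm.aestronglyMeasurable
      (M := C) (ae_restrict_of_ae hC)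
  rw [← intervalIntegral.integral_eq_sub_of_hasDerivAt (fun t _ => h t) hi]
  have := intervalIntegral.norm_integral_le_of_norm_le_const_ae (a := 0) (b := 1) (f := f')
    (C := C) (hC.mono fun t ht _ => ht)
  simpa using this

/-- An everywhere differentiable function whose derivative is bounded almost everywhere is
Lipschitz, hence its derivative is bounded everywhere. -/
theorem norm_fderiv_le_of_ae_norm_fderiv_le {V : G → ℝ} (hV : Differentiable ℝ V) {L : ℝ}
    (h : ∀ᵐ x, ‖fderiv ℝ V x‖ ≤ L) (x : G) : ‖fderiv ℝ V x‖ ≤ L := by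
  obtain ⟨x₀, hx₀⟩ := h.exists
  have hL : 0 ≤ L := (norm_nonneg _).trans hx₀
  have hS : MeasurableSet {y : G | ‖fderiv ℝ V y‖ ≤ L} :=
    measurableSet_le (measurable_fderiv ℝ V).norm measurable_const
  have key : ∀ v y : G, |V (y + v) - V y| ≤ L * ‖v‖ := by
    intro v
    -- The exceptional null set might contain a whole segment. By Fubini in `(t, y)` almost every
    -- segment in direction `v` avoids it for almost all times; continuity and density then cover
    -- the remaining base points.
    have h1 : ∀ᵐ t : ℝ, ∀ᵐ y : G, ‖fderiv ℝ V (y + t • v)‖ ≤ L := ae_of_all _ fun t =>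
      (measurePreserving_add_right (volume : Measure G) (t • v)).quasiMeasurePreserving.ae h
    have h2 : ∀ᵐ y : G, ∀ᵐ t : ℝ, ‖fderiv ℝ V (y + t • v)‖ ≤ L := by
      refine (Measure.ae_ae_comm ?_).1 h1
      have : Measurable fun p : ℝ × G => p.2 + p.1 • v := by fun_prop
      exact this hS
    have h3 : ∀ᵐ y : G, |V (y + v) - V y| ≤ L * ‖v‖ := by
      filter_upwards [h2] with y hy
      have hd : ∀ t : ℝ, HasDerivAt (fun t : ℝ => V (y + t • v)) (fderiv ℝ V (y + t • v) v) t := by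
        intro t
        have hg : HasDerivAt (fun t : ℝ => y + t • v) v t := by
          simpa using ((hasDerivAt_id t).smul_const v).const_add y
        exact (hV (y + t • v)).hasFDerivAt.comp_hasDerivAt t hg
      have := abs_sub_le_of_ae_abs_deriv_le hd (C := L * ‖v‖) (hy.mono fun t ht =>
        ((fderiv ℝ V (y + t • v)).le_opNorm v).trans (by gcongr))
      simpa using this
    have hcl : IsClosed {y : G | |V (y + v) - V y| ≤ L * ‖v‖} := by
      have := hV.continuous
      exact isClosed_le (by fun_prop) continuous_const
    have hd : Dense {y : G | |V (y + v) - V y| ≤ L * ‖v‖} := Measure.dense_of_ae h3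
    intro y
    have := hd.closure_eq ▸ hcl.closure_eq
    exact (this ▸ Set.mem_univ y : y ∈ {y : G | |V (y + v) - V y| ≤ L * ‖v‖})
  have hlip : LipschitzWith L.toNNReal V := by
    refine LipschitzWith.of_dist_le_mul fun a b => ?_
    have := key (a - b) b
    rw [add_sub_cancel] at this
    rwa [Real.dist_eq, dist_eq_norm, Real.coe_toNNReal _ hL]
  simpa [hL] using norm_fderiv_le_of_lipschitz ℝ hlip (x₀ := x)

end Lipschitz

/-! ### The generator in coordinates -/

section Coordinates

variable {d : ℕ}

/-- The `j`-th coordinate direction of the position space. -/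
def posDir (j : Fin d) : Phase d := (EuclideanSpace.single j 1, 0)

/-- The `j`-th coordinate direction of the velocity space. -/
def velDir (j : Fin d) : Phase d := (0, EuclideanSpace.single j 1)

/-- The partial derivative with respect to the `j`-th position coordinate. -/
def dpos (j : Fin d) (φ : Phase d → ℝ) (x : Phase d) : ℝ := fderiv ℝ φ x (posDir j)

/-- The partial derivative with respect to the `j`-th velocity coordinate. -/
def dvel (j : Fin d) (φ : Phase d → ℝ) (x : Phase d) : ℝ := fderiv ℝ φ x (velDir j)

/-- The `j`-th partial derivative of a potential. -/
def force (V : Param d → ℝ) (j : Fin d) (θ : Param d) : ℝ := fderiv ℝ V θ (EuclideanSpace.single j 1)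

theorem inner_gradient_eq_sum (a : Param d) (f : Param d → ℝ) (x : Param d) :
    inner ℝ a (gradient f x) = ∑ j, a j * fderiv ℝ f x (EuclideanSpace.single j 1) := by
  rw [real_inner_comm, gradient, InnerProductSpace.toDual_symm_apply]
  conv_lhs => rw [← (EuclideanSpace.basisFun (Fin d) ℝ).sum_repr a]
  simp

theorem gradient_apply_eq_force (V : Param d → ℝ) (θ : Param d) (j : Fin d) :
    gradient V θ j = force V j θ := by
  have := inner_gradient_eq_sum (EuclideanSpace.single j 1) V θ
  rw [EuclideanSpace.inner_single_left] at this
  simpa [force] using this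

theorem norm_gradient_eq_norm_fderiv (V : Param d → ℝ) (θ : Param d) :
    ‖gradient V θ‖ = ‖fderiv ℝ V θ‖ := by
  rw [gradient, LinearIsometryEquiv.norm_map]

theorem fderiv_comp_pos {φ : Phase d → ℝ} {x : Phase d} (h : DifferentiableAt ℝ φ x)
    (v : Param d) : fderiv ℝ (fun θ => φ (θ, x.2)) x.1 v = fderiv ℝ φ x (v, 0) := by
  have h1 : HasFDerivAt (fun θ : Param d => (θ, x.2))
    (ContinuousLinearMap.inl ℝ (Param d) (Param d)) x.1 := hasFDerivAt_prodMk_left x.1 x.2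
  have h2 := HasFDerivAt.comp (f := fun θ : Param d => (θ, x.2)) x.1 (g := φ) h.hasFDerivAt h1
  have h3 := h2.fderiv
  simp only [Function.comp_def] at h3
  rw [h3]
  simp

theorem fderiv_comp_vel {φ : Phase d → ℝ} {x : Phase d} (h : DifferentiableAt ℝ φ x)
    (v : Param d) : fderiv ℝ (fun r => φ (x.1, r)) x.2 v = fderiv ℝ φ x (0, v) := by
  have h1 : HasFDerivAt (fun r : Param d => (x.1, r))
    (ContinuousLinearMap.inr ℝ (Param d) (Param d)) x.2 := hasFDerivAt_prodMk_right x.1 x.2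
  have h2 := HasFDerivAt.comp (f := fun r : Param d => (x.1, r)) x.2 (g := φ) h.hasFDerivAt h1
  have h3 := h2.fderiv
  simp only [Function.comp_def] at h3
  rw [h3]
  simp

theorem contDiff_dpos {φ : Phase d → ℝ} (h : ContDiff ℝ ∞ φ) (j : Fin d) :
    ContDiff ℝ ∞ (dpos j φ) :=
  (h.fderiv_right (m := ∞) (by simp)).clm_apply contDiff_const

theorem contDiff_dvel {φ : Phase d → ℝ} (h : ContDiff ℝ ∞ φ) (j : Fin d) :
    ContDiff ℝ ∞ (dvel j φ) :=
  (h.fderiv_right (m := ∞) (by simp)).clm_apply contDiff_const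

theorem hasCompactSupport_dpos {φ : Phase d → ℝ} (h : HasCompactSupport φ) (j : Fin d) :
    HasCompactSupport (dpos j φ) := h.fderiv_apply ℝ _

theorem hasCompactSupport_dvel {φ : Phase d → ℝ} (h : HasCompactSupport φ) (j : Fin d) :
    HasCompactSupport (dvel j φ) := h.fderiv_apply ℝ _

theorem dpos_comm_dvel {φ : Phase d → ℝ} (h : ContDiff ℝ ∞ φ) (i j : Fin d) (x : Phase d) :
    dpos i (dvel j φ) x = dvel j (dpos i φ) x := by
  have hs : IsSymmSndFDerivAt ℝ φ x := h.contDiffAt.isSymmSndFDerivAt (by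
    simp only [minSmoothness_of_isRCLikeNormedField]; exact WithTop.coe_le_coe.2 (le_top : (2 : ℕ∞) ≤ ⊤))
  have hd : DifferentiableAt ℝ (fderiv ℝ φ) x :=
    (h.fderiv_right (m := ∞) (by simp)).differentiable (by simp) x
  have e : ∀ v w : Phase d, fderiv ℝ (fun y => fderiv ℝ φ y v) x w
      = fderiv ℝ (fderiv ℝ φ) x w v := by
    intro v w
    rw [fderiv_clm_apply hd (by fun_prop)]
    simp
  change fderiv ℝ (fun y => fderiv ℝ φ y _) x _ = fderiv ℝ (fun y => fderiv ℝ φ y _) x _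
  rw [e, e, hs.eq]

theorem laplacian_vel_eq_sum {φ : Phase d → ℝ} (h : ContDiff ℝ ∞ φ) (x : Phase d) :
    Laplacian.laplacian (fun r => φ (x.1, r)) x.2 = ∑ j, dvel j (dvel j φ) x := by
  rw [InnerProductSpace.laplacian_eq_iteratedFDeriv_orthonormalBasis _
    (EuclideanSpace.basisFun (Fin d) ℝ)]
  refine Finset.sum_congr rfl fun j _ => ?_
  rw [iteratedFDeriv_two_apply]
  simp only [EuclideanSpace.basisFun_apply, Matrix.cons_val_zero, Matrix.cons_val_one]
  set e : Param d := EuclideanSpace.single j 1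
  have hr : ContDiff ℝ ∞ (fun r => φ (x.1, r)) := h.comp (by fun_prop)
  have hd : DifferentiableAt ℝ (fderiv ℝ (fun r => φ (x.1, r))) x.2 :=
    (hr.fderiv_right (m := ∞) (by simp)).differentiable (by simp) x.2
  have e1 : fderiv ℝ (fderiv ℝ (fun r => φ (x.1, r))) x.2 e e
      = fderiv ℝ (fun r => fderiv ℝ (fun r => φ (x.1, r)) r e) x.2 e := by
    rw [fderiv_clm_apply hd (by fun_prop)]
    simp
  have e2 : (fun r => fderiv ℝ (fun r => φ (x.1, r)) r e) = fun r => dvel j φ (x.1, r) := by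
    funext r
    exact fderiv_comp_vel (x := (x.1, r)) (h.differentiable (by simp) _) e
  rw [e1, e2]
  exact fderiv_comp_vel ((contDiff_dvel h j).differentiable (by simp) _) e

/-- The kinetic Fokker-Planck generator for the potential `V`, in coordinates. -/
def kineticGenerator (V : Param d → ℝ) (γ σ : ℝ) (φ : Phase d → ℝ) (x : Phase d) : ℝ :=
  ∑ j, (x.2 j * dpos j φ x - (force V j x.1 + γ * x.2 j) * dvel j φ x + σ * dvel j (dvel j φ) x)

variable {H : Type*} [NormedAddCommGroup H] [InnerProductSpace ℝ H]

theorem generator_eq_kineticGenerator (R : H → ℝ) (Ψ : Param d → H) (g : Param d → ℝ) (β γ : ℝ)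
    (η : Param d → ℝ) {φ : Phase d → ℝ} (h : ContDiff ℝ ∞ φ) (x : Phase d) :
    generator R Ψ g β γ η φ x = kineticGenerator (dObjective R Ψ g η) γ (γ * β⁻¹) φ x := by
  have hd : DifferentiableAt ℝ φ x := h.differentiable (by simp) x
  rw [generator, kineticGenerator, laplacian_vel_eq_sum h, inner_gradient_eq_sum,
    inner_gradient_eq_sum, Finset.mul_sum, ← Finset.sum_add_distrib, ← Finset.sum_add_distrib]
  refine Finset.sum_congr rfl fun j _ => ?_
  rw [fderiv_comp_pos hd, fderiv_comp_vel hd]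
  simp only [PiLp.sub_apply, PiLp.neg_apply, PiLp.smul_apply, gradient_apply_eq_force, smul_eq_mul]
  change _ = x.2 j * fderiv ℝ φ x (EuclideanSpace.single j 1, 0) - (_ + _) *
    fderiv ℝ φ x (0, EuclideanSpace.single j 1) + _
  ring

/-- Along a constant trajectory the weak formulation on `[0, 1]` has zero increment, and its time
integral has a constant integrand. -/
theorem IsStationary.integral_kineticGenerator_eq_zero {R : H → ℝ} {Ψ : Param d → H}
    {g : Param d → ℝ} {β γ : ℝ} {ρ : Phase d → ℝ} (h : IsStationary R Ψ g β γ ρ)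
    {φ : Phase d → ℝ} (hφ : ContDiff ℝ ∞ φ) (hc : HasCompactSupport φ) :
    ∫ x, kineticGenerator (dObjective R Ψ g (marginal ρ)) γ (γ * β⁻¹) φ x * ρ x = 0 := by
  have := (h.evolution φ hφ hc 1 zero_le_one).2
  simp_rw [generator_eq_kineticGenerator R Ψ g β γ _ hφ] at this
  simpa using this.symm

end Coordinates

/-! ### Partial derivatives on phase space -/

section Calculus

variable {d : ℕ}

instance : (volume : Measure (Phase d)).IsAddHaarMeasure :=
  inferInstanceAs ((volume : Measure (Param d)).prod (volume : Measure (Param d))).IsAddHaarMeasure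

theorem contDiff_vel (j : Fin d) : ContDiff ℝ ∞ (fun x : Phase d => x.2 j) := by fun_prop

theorem dpos_mul {f g : Phase d → ℝ} {x : Phase d} (hf : DifferentiableAt ℝ f x)
    (hg : DifferentiableAt ℝ g x) (j : Fin d) :
    dpos j (fun y => f y * g y) x = f x * dpos j g x + dpos j f x * g x := by
  simp only [dpos]
  rw [fderiv_fun_mul hf hg]
  simp [mul_comm]

theorem dvel_mul {f g : Phase d → ℝ} {x : Phase d} (hf : DifferentiableAt ℝ f x)
    (hg : DifferentiableAt ℝ g x) (j : Fin d) :
    dvel j (fun y => f y * g y) x = f x * dvel j g x + dvel j f x * g x := by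
  simp only [dvel]
  rw [fderiv_fun_mul hf hg]
  simp [mul_comm]

theorem hasFDerivAt_vel (j : Fin d) (x : Phase d) :
    HasFDerivAt (fun x : Phase d => x.2 j)
      ((EuclideanSpace.proj j).comp (ContinuousLinearMap.snd ℝ (Param d) (Param d))) x :=
  ((EuclideanSpace.proj (𝕜 := ℝ) j).comp
    (ContinuousLinearMap.snd ℝ (Param d) (Param d))).hasFDerivAt

theorem dvel_vel (i j : Fin d) (x : Phase d) :
    dvel i (fun x : Phase d => x.2 j) x = if j = i then 1 else 0 := by
  rw [dvel, (hasFDerivAt_vel j x).fderiv]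
  simp [velDir]

theorem dpos_vel (i j : Fin d) (x : Phase d) : dpos i (fun x : Phase d => x.2 j) x = 0 := by
  rw [dpos, (hasFDerivAt_vel j x).fderiv]
  simp [posDir]

theorem fderiv_comp_const_sub {φ : Phase d → ℝ} (h : Differentiable ℝ φ) (x y v : Phase d) :
    fderiv ℝ (fun z => φ (x - z)) y v = - fderiv ℝ φ (x - y) v := by
  have h3 := ((h (x - y)).hasFDerivAt.comp y ((hasFDerivAt_id y).const_sub x)).fderiv
  simp only [Function.comp_def] at h3
  rw [h3]
  simp

theorem dpos_mollify {k f : Phase d → ℝ} (hk : ContDiff ℝ ∞ k) (hc : HasCompactSupport k)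
    (hf : LocallyIntegrable f) (j : Fin d) (x : Phase d) :
    dpos j (mollify k f) x = mollify (dpos j k) f x := fderiv_mollify hk hc hf x _

theorem dvel_mollify {k f : Phase d → ℝ} (hk : ContDiff ℝ ∞ k) (hc : HasCompactSupport k)
    (hf : LocallyIntegrable f) (j : Fin d) (x : Phase d) :
    dvel j (mollify k f) x = mollify (dvel j k) f x := fderiv_mollify hk hc hf x _

theorem measurable_force {V : Param d → ℝ} (j : Fin d) : Measurable (force V j) :=
  measurable_fderiv_apply_const ℝ V _

theorem abs_force_le {V : Param d → ℝ} {L : ℝ} (hL : ∀ θ, ‖fderiv ℝ V θ‖ ≤ L) (j : Fin d)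
    (θ : Param d) : |force V j θ| ≤ L := by
  refine ((fderiv ℝ V θ).le_opNorm _).trans ?_
  simpa using hL θ

theorem integrable_force_mul {V : Param d → ℝ} {L : ℝ} (hL : ∀ θ, ‖fderiv ℝ V θ‖ ≤ L) (j : Fin d)
    {f : Phase d → ℝ} (hf : Integrable f) : Integrable (fun x => force V j x.1 * f x) :=
  hf.bdd_mul ((measurable_force j).comp measurable_fst).aestronglyMeasurable (c := L)
    (ae_of_all _ fun x => abs_force_le hL j x.1)

end Calculus

/-! ### The mollified stationary equation -/

section Regularization

variable {d : ℕ}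

/-- `u` is a smooth approximation of the density `ρ`, which solves the stationary kinetic equation
up to errors of size `κ` in `L¹`: the drift error `Q j - force V j * u`, in divergence form, and the
transport error `A`. -/
structure IsRegularization (V : Param d → ℝ) (γ σ K κ : ℝ) (ρ u : Phase d → ℝ)
    (Q : Fin d → Phase d → ℝ) (A : Phase d → ℝ) : Prop where
  contDiff : ContDiff ℝ ∞ u
  nonneg : ∀ x, 0 ≤ u x
  integrable : Integrable u
  contDiff_flux : ∀ j, ContDiff ℝ ∞ (Q j)
  continuous_err : Continuous A
  integrable_err : Integrable A
  equation : ∀ x, ∑ j, (x.2 j * dpos j u x - dvel j (Q j) x - γ * (u x + x.2 j * dvel j u x)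
    - σ * dvel j (dvel j u) x) + A x = 0
  abs_flux_le : ∀ j x, |Q j x - force V j x.1 * u x| ≤ K * u x
  integrable_flux : ∀ j, Integrable (fun x => Q j x - force V j x.1 * u x)
  integral_sub_le : ∫ x, |u x - ρ x| ≤ κ
  integral_flux_le : ∀ j, ∫ x, |Q j x - force V j x.1 * u x| ≤ κ
  integral_err_le : ∫ x, |A x| ≤ κ

variable {V : Param d → ℝ} {L γ σ : ℝ} {ρ : Phase d → ℝ}

/-- The test function is `y ↦ η (x - y)`. Transport and friction have the unbounded coefficient `y.2
j`, which is split as `x.2 j - (x - y).2 j`: the first part gives the equation for the mollified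
density, the second a convolution with a kernel weighted by velocity. The friction remainder is kept
in divergence form inside the flux; the transport remainder is the error term. -/
theorem mollified_equation (hL : ∀ θ, ‖fderiv ℝ V θ‖ ≤ L) (hρ : Integrable ρ)
    (hw : ∀ φ : Phase d → ℝ, ContDiff ℝ ∞ φ → HasCompactSupport φ →
      ∫ x, kineticGenerator V γ σ φ x * ρ x = 0)
    {η : Phase d → ℝ} (hη : ContDiff ℝ ∞ η) (hc : HasCompactSupport η) (x : Phase d) :
    ∑ j, (x.2 j * dpos j (mollify η ρ) x
      - dvel j (fun y => mollify η (fun y => force V j y.1 * ρ y) y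
          - γ * mollify (fun z => z.2 j * η z) ρ y) x
      - γ * (mollify η ρ x + x.2 j * dvel j (mollify η ρ) x)
      - σ * dvel j (dvel j (mollify η ρ)) x)
      + -∑ j, mollify (fun z => z.2 j * dpos j η z) ρ x = 0 := by
  have hloc := hρ.locallyIntegrable
  have hlocV : ∀ j, LocallyIntegrable (fun y : Phase d => force V j y.1 * ρ y) := fun j =>
    (integrable_force_mul hL j hρ).locallyIntegrable
  have hη1 : Differentiable ℝ η := hη.differentiable (by simp)
  have hwη : ∀ j, ContDiff ℝ ∞ (fun z : Phase d => z.2 j * η z) := fun j => (contDiff_vel j).mul hη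
  have hwc : ∀ j, HasCompactSupport (fun z : Phase d => z.2 j * η z) := fun j => hc.mul_left
  have hφ : ContDiff ℝ ∞ (fun y => η (x - y)) := by fun_prop
  have hφc : HasCompactSupport (fun y => η (x - y)) := hc.comp_homeomorph (Homeomorph.subLeft x)
  have e1 : ∀ j, dpos j (fun y => η (x - y)) = fun y => - dpos j η (x - y) := fun j =>
    funext fun y => fderiv_comp_const_sub hη1 x y _
  have e2 : ∀ j, dvel j (fun y => η (x - y)) = fun y => - dvel j η (x - y) := fun j =>
    funext fun y => fderiv_comp_const_sub hη1 x y _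
  have e3 : ∀ j, dvel j (dvel j (fun y => η (x - y))) = fun y => dvel j (dvel j η) (x - y) := by
    intro j
    funext y
    have hd := (contDiff_dvel hη j).differentiable (by simp)
    have hd' : Differentiable ℝ fun y => dvel j η (x - y) := by fun_prop
    rw [e2, dvel, fderiv_fun_neg, _root_.neg_apply, fderiv_comp_const_sub hd, neg_neg]
    rfl
  have i1 := fun j => integrable_mollify_integrand (contDiff_dpos hη j).continuous
    (hasCompactSupport_dpos hc j) hloc x
  have i2 := fun j => integrable_mollify_integrand
    (((contDiff_vel j).mul (contDiff_dpos hη j)).continuous)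
    (hasCompactSupport_dpos hc j).mul_left hloc x
  have i3 := fun j => integrable_mollify_integrand (contDiff_dvel hη j).continuous
    (hasCompactSupport_dvel hc j) (hlocV j) x
  have i4 := fun j => integrable_mollify_integrand (contDiff_dvel hη j).continuous
    (hasCompactSupport_dvel hc j) hloc x
  have i5 := fun j => integrable_mollify_integrand
    (((contDiff_vel j).mul (contDiff_dvel hη j)).continuous)
    (hasCompactSupport_dvel hc j).mul_left hloc x
  have i6 := fun j => integrable_mollify_integrand
    (contDiff_dvel (contDiff_dvel hη j) j).continuous
    (hasCompactSupport_dvel (hasCompactSupport_dvel hc j) j) hloc x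
  have h0 := hw _ hφ hφc
  have hint : ∀ y, kineticGenerator V γ σ (fun y => η (x - y)) y * ρ y
      = ∑ j, (-x.2 j * (dpos j η (x - y) * ρ y)
        + ((x - y).2 j * dpos j η (x - y)) * ρ y
        + dvel j η (x - y) * (force V j y.1 * ρ y)
        + γ * x.2 j * (dvel j η (x - y) * ρ y)
        - γ * (((x - y).2 j * dvel j η (x - y)) * ρ y)
        + σ * (dvel j (dvel j η) (x - y) * ρ y)) := by
    intro y
    rw [kineticGenerator, Finset.sum_mul]
    refine Finset.sum_congr rfl fun j _ => ?_
    rw [e1, e3, e2]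
    simp only [Prod.snd_sub, PiLp.sub_apply]
    ring
  have hJ : ∀ j, Integrable fun y => (-x.2 j * (dpos j η (x - y) * ρ y)
        + ((x - y).2 j * dpos j η (x - y)) * ρ y
        + dvel j η (x - y) * (force V j y.1 * ρ y)
        + γ * x.2 j * (dvel j η (x - y) * ρ y)
        - γ * (((x - y).2 j * dvel j η (x - y)) * ρ y)
        + σ * (dvel j (dvel j η) (x - y) * ρ y)) := fun j =>
    ((((((i1 j).const_mul _).add (i2 j)).add (i3 j)).add ((i4 j).const_mul _)).sub
      ((i5 j).const_mul _)).add ((i6 j).const_mul _)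
  simp_rw [hint] at h0
  rw [integral_finsetSum _ fun j _ => hJ j] at h0
  rw [← Finset.sum_neg_distrib, ← Finset.sum_add_distrib, ← neg_eq_zero, ← h0,
    ← Finset.sum_neg_distrib]
  refine Finset.sum_congr rfl fun j _ => ?_
  have := i1 j
  have := i2 j
  have := i3 j
  have := i4 j
  have := i5 j
  have := i6 j
  simp (disch := fun_prop) only [integral_add, integral_sub, integral_const_mul]
  have q1 : dvel j (fun y => mollify η (fun y => force V j y.1 * ρ y) y
          - γ * mollify (fun z => z.2 j * η z) ρ y) x
      = mollify (dvel j η) (fun y => force V j y.1 * ρ y) x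
        - γ * mollify (dvel j (fun z => z.2 j * η z)) ρ x := by
    have d1 := (contDiff_mollify hη hc (hlocV j)).differentiable (by simp) x
    have d2 := (contDiff_mollify (hwη j) (hwc j) hloc).differentiable (by simp) x
    rw [← dvel_mollify hη hc (hlocV j), ← dvel_mollify (hwη j) (hwc j) hloc, dvel,
      fderiv_fun_sub d1 (d2.const_mul _), fderiv_const_mul d2]
    rfl
  have q2 : mollify (dvel j (fun z => z.2 j * η z)) ρ x
      = mollify η ρ x + mollify (fun z => z.2 j * dvel j η z) ρ x := by
    rw [mollify, mollify, mollify,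
      ← integral_add (integrable_mollify_integrand hη.continuous hc hloc x) (i5 j)]
    refine integral_congr_ae (ae_of_all _ fun y => ?_)
    dsimp only
    rw [dvel_mul ((contDiff_vel j).differentiable (by simp) _) (hη1 _), dvel_vel, if_pos rfl]
    ring
  have q3 : dvel j (dvel j (mollify η ρ)) x = mollify (dvel j (dvel j η)) ρ x := by
    have : dvel j (mollify η ρ) = mollify (dvel j η) ρ :=
      funext fun y => dvel_mollify hη hc hloc j y
    rw [this, dvel_mollify (contDiff_dvel hη j) (hasCompactSupport_dvel hc j) hloc]
  rw [q1, q2, q3, dpos_mollify hη hc hloc, dvel_mollify hη hc hloc]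
  simp only [mollify]
  ring

end Regularization

/-! ### Kernels concentrated in velocity -/

section Kernel

variable {d : ℕ}

/-- Anisotropic smooth kernels, which are much more concentrated in the velocity variable than in
the position variable. -/
theorem exists_anisotropic_kernel (d : ℕ) {δ κ : ℝ} (hδ : 0 < δ) (hκ : 0 < κ) :
    ∃ η : Phase d → ℝ, ContDiff ℝ ∞ η ∧ HasCompactSupport η ∧ (∀ z, 0 ≤ η z) ∧ ∫ z, η z = 1 ∧
      (∀ z, δ ≤ ‖z‖ → η z = 0) ∧ (∀ j z, |z.2 j * η z| ≤ κ * η z) ∧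
      ∀ j, ∫ z, |z.2 j * dpos j η z| ≤ κ := by
  let a : ContDiffBump (0 : Param d) := ⟨δ / 4, δ / 2, by positivity, by linarith⟩
  let f : Param d → ℝ := a.normed volume
  have hf : ContDiff ℝ ∞ f := a.contDiff_normed
  have hfc : HasCompactSupport f := a.hasCompactSupport_normed
  -- Here `force f j` is just the `j`-th partial derivative of the position profile `f`.
  have hfd : ∀ j : Fin d, Integrable fun θ => |force f j θ| := fun j =>
    (((hf.fderiv_right (m := ∞) (by simp)).continuous.clm_apply
      continuous_const).integrable_of_hasCompactSupport (hfc.fderiv_apply ℝ _)).abs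
  obtain ⟨C, hC0, hC⟩ : ∃ C : ℝ, 0 ≤ C ∧ ∀ j : Fin d, ∫ θ, |force f j θ| ≤ C := by
    have h0 : ∀ j : Fin d, 0 ≤ ∫ θ, |force f j θ| := fun j =>
      integral_nonneg fun θ => abs_nonneg _
    exact ⟨∑ j : Fin d, ∫ θ, |force f j θ|, Finset.sum_nonneg fun j _ => h0 j,
      fun j => Finset.single_le_sum (f := fun j : Fin d => ∫ θ, |force f j θ|)
        (fun j _ => h0 j) (Finset.mem_univ j)⟩
  -- The velocity width `τ` is chosen after the position profile, hence after the bound `C` on its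
  -- derivatives. The transport commutator has size at most `C * τ`; a single common width would
  -- leave it of order one.
  obtain ⟨τ, hτ, hτδ, hτκ, hτC⟩ : ∃ τ > 0, τ ≤ δ / 2 ∧ τ ≤ κ ∧ C * τ ≤ κ := by
    refine ⟨min (δ / 2) (min κ (κ / (C + 1))), by positivity, min_le_left _ _,
      (min_le_right _ _).trans (min_le_left _ _), ?_⟩
    calc C * min (δ / 2) (min κ (κ / (C + 1))) ≤ (C + 1) * (κ / (C + 1)) := by
          gcongr
          · linarith
          · exact (min_le_right _ _).trans (min_le_right _ _)
      _ = κ := by field_simp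
  let b : ContDiffBump (0 : Param d) := ⟨τ / 2, τ, by positivity, by linarith⟩
  let k : Param d → ℝ := b.normed volume
  have hk : ContDiff ℝ ∞ k := b.contDiff_normed
  have hk0 : ∀ r, 0 ≤ k r := b.nonneg_normed
  have hf0 : ∀ r, 0 ≤ f r := a.nonneg_normed
  have hkz : ∀ r, τ ≤ ‖r‖ → k r = 0 := by
    intro r hr
    have : r ∉ Function.support k := by
      rw [b.support_normed_eq]
      simpa [b] using hr
    simpa using this
  have hfz : ∀ r, δ / 2 ≤ ‖r‖ → f r = 0 := by
    intro r hr
    have : r ∉ Function.support f := by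
      rw [a.support_normed_eq]
      simpa [a] using hr
    simpa using this
  have hvel : ∀ (j : Fin d) (r : Param d), |r j| * k r ≤ τ * k r := by
    intro j r
    rcases lt_or_ge ‖r‖ τ with h | h
    · have : |r j| ≤ ‖r‖ := PiLp.norm_apply_le r j
      exact mul_le_mul_of_nonneg_right (this.trans h.le) (hk0 r)
    · simp [hkz r h]
  have hη : ContDiff ℝ ∞ fun z : Phase d => f z.1 * k z.2 := by fun_prop
  have hdpos : ∀ (j : Fin d) (z : Phase d),
      dpos j (fun z : Phase d => f z.1 * k z.2) z = force f j z.1 * k z.2 := by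
    intro j z
    rw [dpos, posDir, ← fderiv_comp_pos (hη.differentiable (by simp) z)]
    dsimp only
    rw [fderiv_mul_const (hf.differentiable (by simp) _)]
    simp [force, mul_comm]
  refine ⟨fun z => f z.1 * k z.2, hη, ?_, fun z => mul_nonneg (hf0 _) (hk0 _), ?_, ?_, ?_, ?_⟩
  · refine HasCompactSupport.of_support_subset_isCompact
      ((isCompact_closedBall (0 : Param d) (δ / 2)).prod (isCompact_closedBall (0 : Param d) τ))
      fun z hz => ?_
    simp only [Function.mem_support, mul_ne_zero_iff] at hz
    simp only [Set.mem_prod, mem_closedBall_zero_iff]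
    refine ⟨?_, ?_⟩
    · by_contra h
      exact hz.1 (hfz _ (not_le.1 h).le)
    · by_contra h
      exact hz.2 (hkz _ (not_le.1 h).le)
  · have := integral_prod_mul (μ := (volume : Measure (Param d))) (ν := volume) f k
    rw [a.integral_normed, b.integral_normed, one_mul] at this
    exact this
  · intro z hz
    rw [Prod.norm_def, le_max_iff] at hz
    rcases hz with hz | hz
    · simp [hfz z.1 (by linarith)]
    · simp [hkz z.2 (by linarith)]
  · intro j z
    have h1 := mul_le_mul_of_nonneg_left (hvel j z.2) (hf0 z.1)
    have h2 := mul_le_mul_of_nonneg_right hτκ (mul_nonneg (hf0 z.1) (hk0 z.2))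
    rw [abs_mul, abs_of_nonneg (mul_nonneg (hf0 z.1) (hk0 z.2))]
    linarith
  · intro j
    have hi : Integrable fun z : Phase d => |force f j z.1| * k z.2 :=
      (hfd j).mul_prod b.integrable_normed
    calc ∫ z : Phase d, |z.2 j * dpos j (fun z : Phase d => f z.1 * k z.2) z|
        ≤ ∫ z : Phase d, τ * (|force f j z.1| * k z.2) := by
          refine integral_mono_of_nonneg (ae_of_all _ fun z => abs_nonneg _) (hi.const_mul τ)
            (ae_of_all _ fun z => ?_)
          have h1 := mul_le_mul_of_nonneg_left (hvel j z.2) (abs_nonneg (force f j z.1))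
          simp only [hdpos, abs_mul, abs_of_nonneg (hk0 z.2)]
          linarith
      _ = τ * ((∫ θ, |force f j θ|) * ∫ r, k r) := by
          rw [integral_const_mul]
          congr 1
          exact integral_prod_mul (μ := (volume : Measure (Param d))) (ν := volume)
            (fun θ => |force f j θ|) k
      _ ≤ κ := by
          rw [b.integral_normed, mul_one, mul_comm]
          exact (mul_le_mul_of_nonneg_right (hC j) hτ.le).trans hτC

end Kernel

/-! ### Existence of regularizations -/

section Existence

variable {d : ℕ} {V : Param d → ℝ} {L γ σ : ℝ} {ρ : Phase d → ℝ}

theorem abs_mollify_le {k f η : Phase d → ℝ} {c : ℝ} (hη : Continuous η)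
    (hc : HasCompactSupport η) (hρ : Integrable ρ) (x : Phase d)
    (h : ∀ᵐ y, |k (x - y) * f y| ≤ c * (η (x - y) * ρ y)) :
    |mollify k f x| ≤ c * mollify η ρ x := by
  refine abs_integral_le_integral_abs.trans ?_
  rw [mollify, ← integral_const_mul]
  exact integral_mono_of_nonneg (ae_of_all _ fun y => abs_nonneg _)
    ((integrable_mollify_integrand hη hc hρ.locallyIntegrable x).const_mul c) h

/-- Stationary densities of the kinetic equation admit arbitrarily good regularizations. -/
theorem exists_isRegularization (hL : ∀ θ, ‖fderiv ℝ V θ‖ ≤ L) (hγ : 0 ≤ γ) (hρ : Integrable ρ)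
    (hρ0 : ∀ᵐ x, 0 ≤ ρ x)
    (hw : ∀ φ : Phase d → ℝ, ContDiff ℝ ∞ φ → HasCompactSupport φ →
      ∫ x, kineticGenerator V γ σ φ x * ρ x = 0) {κ : ℝ} (hκ : 0 < κ) :
    ∃ u Q A, IsRegularization V γ σ (2 * L + γ) κ ρ u Q A := by
  have hL0 : 0 ≤ L := (norm_nonneg _).trans (hL 0)
  set M := ∫ x, |ρ x| with hM
  have hM0 : 0 ≤ M := integral_nonneg fun x => abs_nonneg _
  -- The flux error splits into three parts: mollifying `force V j * ρ`, replacing `ρ` by `u` under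
  -- the bounded force, and the friction commutator. They cost `κ₁`, `L * κ₁` and `γ * κ₁`.
  obtain ⟨κ₁, hκ₁, hκ₁le, hκ₁L⟩ : ∃ κ₁ > 0, κ₁ ≤ κ ∧ κ₁ + L * κ₁ + γ * κ₁ ≤ κ := by
    refine ⟨κ / (1 + L + γ), by positivity, div_le_self hκ.le (by linarith), le_of_eq ?_⟩
    field_simp
  obtain ⟨κ₂, hκ₂, hκ₂1, hκ₂M, hκ₂d⟩ : ∃ κ₂ > 0, κ₂ ≤ 1 ∧ κ₂ * M ≤ κ₁ ∧ d * (κ₂ * M) ≤ κ₁ := by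
    have hq : min 1 (κ₁ / ((M + 1) * (d + 1))) * ((M + 1) * (d + 1)) ≤ κ₁ :=
      (mul_le_mul_of_nonneg_right (min_le_right _ _) (by positivity)).trans
        (le_of_eq (by field_simp))
    have hp : 0 < min 1 (κ₁ / ((M + 1) * (d + 1))) := by positivity
    have hd : (0 : ℝ) ≤ d := d.cast_nonneg
    refine ⟨min 1 (κ₁ / ((M + 1) * (d + 1))), hp, min_le_left _ _, ?_, ?_⟩
    · refine le_trans ?_ hq
      gcongr
      nlinarith
    · refine le_trans (le_of_eq (mul_left_comm _ _ _)) (le_trans ?_ hq)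
      refine mul_le_mul_of_nonneg_left ?_ hp.le
      nlinarith
  have hVρ := fun j => integrable_force_mul hL j hρ
  obtain ⟨δ₀, hδ₀, happ₀⟩ := exists_integral_abs_mollify_sub_le hρ hκ₁
  -- The force need not be continuous; it suffices that the product of the bounded force with `ρ`
  -- lies in `L¹`, where mollification converges.
  choose δ' hδ' happ using fun j => exists_integral_abs_mollify_sub_le (hVρ j) hκ₁
  obtain ⟨δ, ⟨hδ, hδδ₀⟩, hδj⟩ : ∃ δ, (0 < δ ∧ δ ≤ δ₀) ∧ ∀ j, δ ≤ δ' j := by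
    have h1 : ∀ᶠ δ in 𝓝[>] (0 : ℝ), 0 < δ ∧ δ ≤ δ₀ := Ioc_mem_nhdsGT hδ₀
    have h2 : ∀ᶠ δ in 𝓝[>] (0 : ℝ), ∀ j, δ ≤ δ' j := eventually_all.2 fun j =>
      mem_of_superset (Ioc_mem_nhdsGT (hδ' j)) fun _ h => h.2
    exact (h1.and h2).exists
  obtain ⟨η, hη, hc, hη0, hη1, hηδ, hηv, hηp⟩ := exists_anisotropic_kernel d hδ hκ₂
  have hloc := hρ.locallyIntegrable
  have hηi : Integrable η := hη.continuous.integrable_of_hasCompactSupport hc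
  have hwη : ∀ j, ContDiff ℝ ∞ (fun z : Phase d => z.2 j * η z) := fun j => (contDiff_vel j).mul hη
  have hwc : ∀ j, HasCompactSupport (fun z : Phase d => z.2 j * η z) := fun j => hc.mul_left
  have hwi : ∀ j, Integrable (fun z : Phase d => z.2 j * η z) := fun j =>
    (hwη j).continuous.integrable_of_hasCompactSupport (hwc j)
  have hpη : ∀ j, ContDiff ℝ ∞ (fun z : Phase d => z.2 j * dpos j η z) := fun j =>
    (contDiff_vel j).mul (contDiff_dpos hη j)
  have hpc : ∀ j, HasCompactSupport (fun z : Phase d => z.2 j * dpos j η z) := fun j =>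
    (hasCompactSupport_dpos hc j).mul_left
  have hpi : ∀ j, Integrable (fun z : Phase d => z.2 j * dpos j η z) := fun j =>
    (hpη j).continuous.integrable_of_hasCompactSupport (hpc j)
  have hui := integrable_mollify hηi hρ
  have hu0 : ∀ x, 0 ≤ mollify η ρ x := fun x =>
    integral_nonneg_of_ae (hρ0.mono fun y hy => mul_nonneg (hη0 _) hy)
  have hsub : ∫ x, |mollify η ρ x - ρ x| ≤ κ₁ :=
    happ₀ η hη.continuous hc hη0 hη1 fun z hz => hηδ z (hδδ₀.trans hz)
  have hPi := fun j => integrable_mollify hηi (hVρ j)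
  have hSi := fun j => integrable_mollify (hwi j) hρ
  have hfu := fun j => integrable_force_mul hL j hui
  refine ⟨mollify η ρ, fun j y => mollify η (fun y => force V j y.1 * ρ y) y
    - γ * mollify (fun z => z.2 j * η z) ρ y,
    fun x => -∑ j, mollify (fun z => z.2 j * dpos j η z) ρ x, ?_⟩
  refine ⟨contDiff_mollify hη hc hloc, hu0, hui, fun j => ?_, ?_, ?_,
    mollified_equation hL hρ hw hη hc, fun j x => ?_, fun j => ?_, hsub.trans hκ₁le,
    fun j => ?_, ?_⟩
  · exact (contDiff_mollify hη hc (hVρ j).locallyIntegrable).sub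
      (contDiff_const.mul (contDiff_mollify (hwη j) (hwc j) hloc))
  · exact (continuous_finsetSum _ fun j _ =>
      (contDiff_mollify (hpη j) (hpc j) hloc).continuous).neg
  · exact (integrable_finsetSum _ fun j _ => integrable_mollify (hpi j) hρ).neg
  -- The mollified force term, the friction commutator and `force V j * u` contribute `L`, `γ` and
  -- `L`, whence the constant `2 * L + γ`, whatever `κ` is.
  · have h1 : |mollify η (fun y => force V j y.1 * ρ y) x| ≤ L * mollify η ρ x := by
      refine abs_mollify_le hη.continuous hc hρ x (hρ0.mono fun y hy => ?_)
      rw [abs_mul, abs_mul, abs_of_nonneg (hη0 _), abs_of_nonneg hy]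
      have := mul_le_mul_of_nonneg_right (abs_force_le hL j y.1) (mul_nonneg (hη0 (x - y)) hy)
      linarith
    have h2 : |mollify (fun z => z.2 j * η z) ρ x| ≤ 1 * mollify η ρ x := by
      refine abs_mollify_le hη.continuous hc hρ x (hρ0.mono fun y hy => ?_)
      rw [abs_mul, abs_of_nonneg hy, ← mul_assoc]
      refine mul_le_mul_of_nonneg_right ((hηv j _).trans ?_) hy
      exact mul_le_mul_of_nonneg_right hκ₂1 (hη0 _)
    have h3 : |force V j x.1 * mollify η ρ x| ≤ L * mollify η ρ x := by
      rw [abs_mul, abs_of_nonneg (hu0 x)]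
      exact mul_le_mul_of_nonneg_right (abs_force_le hL j x.1) (hu0 x)
    have h4 : |γ * mollify (fun z => z.2 j * η z) ρ x| ≤ γ * mollify η ρ x := by
      rw [abs_mul, abs_of_nonneg hγ]
      exact mul_le_mul_of_nonneg_left (by linarith) hγ
    rw [abs_le] at *
    constructor <;> linarith [h1.1, h1.2, h3.1, h3.2, h4.1, h4.2]
  · exact ((hPi j).sub ((hSi j).const_mul γ)).sub (hfu j)
  · have hP := happ j η hη.continuous hc hη0 hη1 fun z hz => hηδ z ((hδj j).trans hz)
    have hS : ∫ x, |mollify (fun z => z.2 j * η z) ρ x| ≤ κ₁ := by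
      refine (integral_abs_mollify_le (hwi j) hρ).trans (le_trans ?_ hκ₂M)
      refine mul_le_mul_of_nonneg_right ?_ hM0
      calc ∫ z : Phase d, |z.2 j * η z| ≤ ∫ z, κ₂ * η z :=
            integral_mono (hwi j).abs (hηi.const_mul _) fun z => hηv j z
        _ = κ₂ := by rw [integral_const_mul, hη1, mul_one]
    have i1 : Integrable fun x =>
        |mollify η (fun y => force V j y.1 * ρ y) x - force V j x.1 * ρ x| :=
      ((hPi j).sub (hVρ j)).abs
    have i2 : Integrable fun x => |mollify η ρ x - ρ x| := (hui.sub hρ).abs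
    have i3 := (hSi j).abs
    calc _ ≤ ∫ x, (|mollify η (fun y => force V j y.1 * ρ y) x - force V j x.1 * ρ x|
          + L * |mollify η ρ x - ρ x| + γ * |mollify (fun z => z.2 j * η z) ρ x|) := by
          refine integral_mono (((hPi j).sub ((hSi j).const_mul γ)).sub (hfu j)).abs
            ((i1.add (i2.const_mul L)).add ((hSi j).abs.const_mul γ)) fun x => ?_
          have e : mollify η (fun y => force V j y.1 * ρ y) x
              - γ * mollify (fun z => z.2 j * η z) ρ x - force V j x.1 * mollify η ρ x
              = (mollify η (fun y => force V j y.1 * ρ y) x - force V j x.1 * ρ x)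
              + (-(force V j x.1 * (mollify η ρ x - ρ x)))
              + (-(γ * mollify (fun z => z.2 j * η z) ρ x)) := by ring
          dsimp only
          rw [e]
          refine (abs_add_three _ _ _).trans ?_
          rw [abs_neg, abs_neg, abs_mul, abs_mul, abs_of_nonneg hγ]
          gcongr
          exact abs_force_le hL j x.1
      _ ≤ κ₁ + L * κ₁ + γ * κ₁ := by
          simp (disch := fun_prop) only [integral_add, integral_const_mul]
          gcongr
      _ ≤ κ := hκ₁L
  · calc _ ≤ ∫ x, ∑ j, |mollify (fun z => z.2 j * dpos j η z) ρ x| := by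
          refine integral_mono (integrable_finsetSum _ fun j _ =>
            integrable_mollify (hpi j) hρ).neg.abs
            (integrable_finsetSum _ fun j _ => (integrable_mollify (hpi j) hρ).abs) fun x => ?_
          dsimp only
          rw [abs_neg]
          exact Finset.abs_sum_le_sum_abs _ _
      _ ≤ ∑ j : Fin d, κ₂ * M := by
          rw [integral_finsetSum _ fun j _ => (integrable_mollify (hpi j) hρ).abs]
          refine Finset.sum_le_sum fun j _ => ?_
          exact (integral_abs_mollify_le (hpi j) hρ).trans
            (mul_le_mul_of_nonneg_right (hηp j) hM0)
      _ ≤ κ := by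
          rw [Finset.sum_const, Finset.card_univ, Fintype.card_fin, nsmul_eq_mul]
          exact hκ₂d.trans hκ₁le

end Existence

/-! ### The inverse Gibbs weight and vanishing integrals of derivatives -/

section Weight

variable {d : ℕ} {V : Param d → ℝ}

/-- The exponential of `β` times the Hamiltonian `V(θ) + |r|² / 2`. -/
def expEnergy (β : ℝ) (V : Param d → ℝ) (x : Phase d) : ℝ :=
  Real.exp (β * (V x.1 + ‖x.2‖ ^ 2 / 2))

theorem expEnergy_pos (β : ℝ) (V : Param d → ℝ) (x : Phase d) : 0 < expEnergy β V x :=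
  Real.exp_pos _

theorem expEnergy_neg_mul (β : ℝ) (V : Param d → ℝ) (x : Phase d) :
    expEnergy (-β) V x * expEnergy β V x = 1 := by
  rw [expEnergy, expEnergy, ← Real.exp_add]
  simp

theorem differentiable_expEnergy (hV : Differentiable ℝ V) (β : ℝ) :
    Differentiable ℝ (expEnergy β V) := by
  unfold expEnergy
  have : Differentiable ℝ fun x : Phase d => ‖x.2‖ ^ 2 := differentiable_snd.norm_sq ℝ
  fun_prop

theorem fderiv_expEnergy (hV : Differentiable ℝ V) (β : ℝ) (x v : Phase d) :
    fderiv ℝ (expEnergy β V) x v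
      = β * (fderiv ℝ V x.1 v.1 + inner ℝ x.2 v.2) * expEnergy β V x := by
  have h1 : HasFDerivAt (fun x : Phase d => V x.1)
      ((fderiv ℝ V x.1).comp (ContinuousLinearMap.fst ℝ (Param d) (Param d))) x :=
    (hV x.1).hasFDerivAt.comp x hasFDerivAt_fst
  have h2 := (hasFDerivAt_snd (𝕜 := ℝ) (p := x) (E := Param d) (F := Param d)).norm_sq
  have h3 := ((h1.fun_add (h2.mul_const (1 / 2))).const_mul β).exp
  have h4 := h3.fderiv
  have e : (fun y : Phase d => Real.exp (β * (V y.1 + ‖y.2‖ ^ 2 * (1 / 2)))) = expEnergy β V := by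
    funext y
    simp [expEnergy, div_eq_mul_inv]
  rw [e] at h4
  rw [h4]
  simp [expEnergy, div_eq_mul_inv]
  ring

theorem dpos_expEnergy (hV : Differentiable ℝ V) (β : ℝ) (j : Fin d) (x : Phase d) :
    dpos j (expEnergy β V) x = β * force V j x.1 * expEnergy β V x := by
  rw [dpos, fderiv_expEnergy hV]
  simp [posDir, force]

theorem dvel_expEnergy (hV : Differentiable ℝ V) (β : ℝ) (j : Fin d) (x : Phase d) :
    dvel j (expEnergy β V) x = β * x.2 j * expEnergy β V x := by
  rw [dvel, fderiv_expEnergy hV]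
  simp [velDir, EuclideanSpace.inner_single_right]

theorem continuous_expEnergy (hV : Differentiable ℝ V) (β : ℝ) : Continuous (expEnergy β V) :=
  (differentiable_expEnergy hV β).continuous

theorem dvel_add {f g : Phase d → ℝ} {x : Phase d} (hf : DifferentiableAt ℝ f x)
    (hg : DifferentiableAt ℝ g x) (j : Fin d) :
    dvel j (fun y => f y + g y) x = dvel j f x + dvel j g x := by
  simp only [dvel]
  rw [fderiv_fun_add hf hg]
  simp

theorem dvel_const_mul {f : Phase d → ℝ} {x : Phase d} (hf : DifferentiableAt ℝ f x) (c : ℝ)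
    (j : Fin d) : dvel j (fun y => c * f y) x = c * dvel j f x := by
  simp only [dvel]
  rw [fderiv_const_mul hf]
  simp

theorem integral_dpos_eq_zero {f : Phase d → ℝ} (hf : Differentiable ℝ f)
    (hc : HasCompactSupport f) (j : Fin d) (hi : Integrable (dpos j f)) :
    ∫ x, dpos j f x = 0 :=
  integral_lineDeriv_eq_zero (hf.continuous.integrable_of_hasCompactSupport hc) hi
    fun x => (hf x).hasFDerivAt.hasLineDerivAt _

theorem integral_dvel_eq_zero {f : Phase d → ℝ} (hf : Differentiable ℝ f)
    (hc : HasCompactSupport f) (j : Fin d) (hi : Integrable (dvel j f)) :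
    ∫ x, dvel j f x = 0 :=
  integral_lineDeriv_eq_zero (hf.continuous.integrable_of_hasCompactSupport hc) hi
    fun x => (hf x).hasFDerivAt.hasLineDerivAt _

/-- Along a velocity direction the factor `b` is constant, so the product has a line derivative even
when `b` has no regularity. This lets the force, and later the velocity-independent density, pass
through velocity derivatives. -/
theorem integral_comp_fst_mul_dvel_eq_zero {b : Param d → ℝ} {f : Phase d → ℝ}
    (hf : Differentiable ℝ f) (j : Fin d) (hi : Integrable fun x => b x.1 * f x)
    (hi' : Integrable fun x => b x.1 * dvel j f x) :
    ∫ x, b x.1 * dvel j f x = 0 := by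
  refine integral_lineDeriv_eq_zero hi hi' (v := velDir j) fun x => ?_
  have h : HasDerivAt (fun t : ℝ => f (x + t • velDir j)) (dvel j f x) 0 :=
    (hf x).hasFDerivAt.hasLineDerivAt (velDir j)
  simpa [HasLineDerivAt, velDir] using h.const_mul (b x.1)

end Weight

/-! ### Testing the regularized equation -/

section Dissipation

variable {d : ℕ} {V : Param d → ℝ} {L β γ σ K κ : ℝ} {ρ u A : Phase d → ℝ}
  {Q : Fin d → Phase d → ℝ}

/-- Only velocity derivatives are moved onto the test function. Hence test functions containing
`expEnergy β V` are allowed: they are differentiable, but their position derivatives need not be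
continuous. -/
theorem IsRegularization.integral_test_eq_zero (hr : IsRegularization V γ σ K κ ρ u Q A)
    {ψ : Phase d → ℝ} (hψ : Differentiable ℝ ψ) (hc : HasCompactSupport ψ)
    (hψc : ∀ j, Continuous (dvel j ψ)) :
    ∫ x, (∑ j, (ψ x * x.2 j * dpos j u x
      + dvel j ψ x * (Q j x + γ * x.2 j * u x + σ * dvel j u x)) + ψ x * A x) = 0 := by
  have hu := hr.contDiff
  set J : Fin d → Phase d → ℝ := fun j x => Q j x + γ * x.2 j * u x + σ * dvel j u x with hJ
  have hJs : ∀ j, ContDiff ℝ ∞ (J j) := fun j =>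
    ((hr.contDiff_flux j).add ((contDiff_const.mul (contDiff_vel j)).mul hu)).add
      (contDiff_const.mul (contDiff_dvel hu j))
  have hJd : ∀ j, Differentiable ℝ (J j) := fun j => (hJs j).differentiable (by simp)
  have hJv : ∀ j x, dvel j (J j) x = dvel j (Q j) x + γ * (u x + x.2 j * dvel j u x)
      + σ * dvel j (dvel j u) x := by
    intro j x
    have d1 := (hr.contDiff_flux j).differentiable (by simp) x
    have d2 := hu.differentiable (by simp) x
    have d3 := (contDiff_vel j).differentiable (by simp) x
    have d4 := (contDiff_dvel hu j).differentiable (by simp) x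
    have e1 : J j = fun x => (Q j x + γ * (x.2 j * u x)) + σ * dvel j u x := by
      funext y; simp only [hJ]; ring
    rw [e1, dvel_add (d1.fun_add ((d3.fun_mul d2).const_mul _)) (d4.const_mul _),
      dvel_add d1 ((d3.fun_mul d2).const_mul _), dvel_const_mul (d3.fun_mul d2),
      dvel_const_mul d4, dvel_mul d3 d2, dvel_vel, if_pos rfl]
    ring
  have hmul : ∀ j x, dvel j (fun y => ψ y * J j y) x = ψ x * dvel j (J j) x + dvel j ψ x * J j x :=
    fun j x => dvel_mul (hψ x) (hJd j x) j
  have hpt : ∀ x, ∑ j, (ψ x * x.2 j * dpos j u x + dvel j ψ x * J j x) + ψ x * A x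
      = ∑ j, dvel j (fun y => ψ y * J j y) x := by
    intro x
    have h0 := congrArg (fun t => ψ x * t) (hr.equation x)
    simp only [mul_add, mul_zero, Finset.mul_sum] at h0
    rw [← sub_eq_zero, add_sub_right_comm, ← Finset.sum_sub_distrib, ← h0]
    congr 1
    refine Finset.sum_congr rfl fun j _ => ?_
    rw [hmul, hJv]
    ring
  have hi : ∀ j, Integrable (dvel j (fun y => ψ y * J j y)) := by
    intro j
    have e : dvel j (fun y => ψ y * J j y)
        = fun x => ψ x * dvel j (J j) x + dvel j ψ x * J j x := funext (hmul j)
    refine Continuous.integrable_of_hasCompactSupport ?_ (HasCompactSupport.fderiv_apply ℝ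
      hc.mul_right _)
    rw [e]
    have := (contDiff_dvel (hJs j) j).continuous
    have := (hJs j).continuous
    have := hψ.continuous
    have := hψc j
    fun_prop
  rw [integral_congr_ae (ae_of_all _ hpt), integral_finsetSum _ fun j _ => hi j]
  exact Finset.sum_eq_zero fun j _ =>
    integral_dvel_eq_zero (hψ.mul (hJd j)) hc.mul_right j (hi j)

end Dissipation

/-! ### Calculus of `log (1 + h)` -/

section LogDensity

variable {d : ℕ} {V : Param d → ℝ} {β : ℝ}

theorem dpos_scomp {f : ℝ → ℝ} {f' : ℝ} {h : Phase d → ℝ} {x : Phase d}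
    (hf : HasDerivAt f f' (h x)) (hh : DifferentiableAt ℝ h x) (j : Fin d) :
    dpos j (fun y => f (h y)) x = f' * dpos j h x := by
  have := (hf.comp_hasFDerivAt x hh.hasFDerivAt).fderiv
  simp only [Function.comp_def] at this
  rw [dpos, this]
  rfl

theorem dvel_scomp {f : ℝ → ℝ} {f' : ℝ} {h : Phase d → ℝ} {x : Phase d}
    (hf : HasDerivAt f f' (h x)) (hh : DifferentiableAt ℝ h x) (j : Fin d) :
    dvel j (fun y => f (h y)) x = f' * dvel j h x := by
  have := (hf.comp_hasFDerivAt x hh.hasFDerivAt).fderiv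
  simp only [Function.comp_def] at this
  rw [dvel, this]
  rfl

/-- `log (1 + h)` for the density `h` of `u` with respect to the Gibbs weight. -/
def logDensity (β : ℝ) (V : Param d → ℝ) (u : Phase d → ℝ) (x : Phase d) : ℝ :=
  Real.log (1 + u x * expEnergy β V x)

variable {u : Phase d → ℝ}

theorem one_add_density_pos (hu : ∀ x, 0 ≤ u x) (x : Phase d) :
    0 < 1 + u x * expEnergy β V x := by
  have := mul_nonneg (hu x) (expEnergy_pos β V x).le
  linarith

theorem differentiable_logDensity (hV : Differentiable ℝ V) (hud : Differentiable ℝ u)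
    (hu : ∀ x, 0 ≤ u x) : Differentiable ℝ (logDensity β V u) := by
  have := differentiable_expEnergy hV β
  exact Differentiable.log (by fun_prop) fun x => (one_add_density_pos hu x).ne'

theorem dpos_logDensity (hV : Differentiable ℝ V) (hud : Differentiable ℝ u)
    (hu : ∀ x, 0 ≤ u x) (j : Fin d) (x : Phase d) :
    dpos j (logDensity β V u) x = (1 + u x * expEnergy β V x)⁻¹ *
      ((dpos j u x + β * force V j x.1 * u x) * expEnergy β V x) := by
  have h1 := differentiable_expEnergy hV β
  have h := dpos_scomp (f := fun t => Real.log (1 + t)) (h := fun y => u y * expEnergy β V y)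
    (((hasDerivAt_id _).const_add 1).log (one_add_density_pos hu x).ne')
    (hud.mul h1 x) j
  rw [dpos_mul (hud x) (h1 x), dpos_expEnergy hV] at h
  refine h.trans ?_
  ring

theorem dvel_logDensity (hV : Differentiable ℝ V) (hud : Differentiable ℝ u)
    (hu : ∀ x, 0 ≤ u x) (j : Fin d) (x : Phase d) :
    dvel j (logDensity β V u) x = (1 + u x * expEnergy β V x)⁻¹ *
      ((dvel j u x + β * x.2 j * u x) * expEnergy β V x) := by
  have h1 := differentiable_expEnergy hV β
  have h := dvel_scomp (f := fun t => Real.log (1 + t)) (h := fun y => u y * expEnergy β V y)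
    (((hasDerivAt_id _).const_add 1).log (one_add_density_pos hu x).ne')
    (hud.mul h1 x) j
  rw [dvel_mul (hud x) (h1 x), dvel_expEnergy hV] at h
  refine h.trans ?_
  simp only
  ring

/-- With `l = log (1 + h)` the function differentiated is `exp (-l)`. -/
theorem dvel_inv_one_add_density (hV : Differentiable ℝ V) (hud : Differentiable ℝ u)
    (hu : ∀ x, 0 ≤ u x) (j : Fin d) (x : Phase d) :
    dvel j (fun y => (1 + u y * expEnergy β V y)⁻¹) x =
      -((1 + u x * expEnergy β V x)⁻¹ * dvel j (logDensity β V u) x) := by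
  have h1 := differentiable_expEnergy hV β
  have h := dvel_scomp (f := fun t => (1 + t)⁻¹) (h := fun y => u y * expEnergy β V y)
    (((hasDerivAt_id _).const_add 1).inv (one_add_density_pos hu x).ne')
    (hud.mul h1 x) j
  rw [dvel_mul (hud x) (h1 x), dvel_expEnergy hV] at h
  rw [dvel_logDensity hV hud hu]
  refine h.trans ?_
  have := (one_add_density_pos (β := β) (V := V) hu x).ne'
  simp only
  field_simp
  ring

theorem logDensity_nonneg (hu : ∀ x, 0 ≤ u x) (x : Phase d) : 0 ≤ logDensity β V u x :=
  Real.log_nonneg (by have := mul_nonneg (hu x) (expEnergy_pos β V x).le; linarith)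

/-- Divided by `expEnergy β V`, this bounds the weighted logarithm by `u` itself, which is
integrable; that is why `log (1 + h)` replaces the usual entropy. -/
theorem logDensity_le (hu : ∀ x, 0 ≤ u x) (x : Phase d) :
    logDensity β V u x ≤ u x * expEnergy β V x := by
  have := Real.log_le_sub_one_of_pos (one_add_density_pos (β := β) (V := V) hu x)
  rw [logDensity]
  linarith

/-- A velocity derivative leaves `V` undifferentiated, so no continuity of `∇V` is needed. -/
theorem continuous_dvel_logDensity (hV : Differentiable ℝ V) (hu : ContDiff ℝ ∞ u)
    (hu0 : ∀ x, 0 ≤ u x) (j : Fin d) : Continuous (dvel j (logDensity β V u)) := by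
  rw [funext (dvel_logDensity (β := β) hV (hu.differentiable (by simp)) hu0 j)]
  have h1 := continuous_expEnergy hV β
  have h2 := hu.continuous
  have h3 := (contDiff_dvel hu j).continuous
  exact (Continuous.inv₀ (by fun_prop) fun x => (one_add_density_pos hu0 x).ne').mul
    (by fun_prop)

end LogDensity

/-! ### The localized dissipation estimate -/

section Dissipation

variable {d : ℕ} {V : Param d → ℝ} {L β γ σ K κ : ℝ} {ρ u A : Phase d → ℝ}
  {Q : Fin d → Phase d → ℝ}

/-- Here `c` is the cutoff with derivative `cr`, `h` the density relative to the Gibbs weight `m`,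
`p = 1 / (1 + h)`, `dl` the derivative of `log (1 + h)`, and `E` the drift error. Young's inequality
absorbs half of the dissipation and leaves `p² E² / (2σm)`. Since `|E| ≤ K * m * h` and `p² * h ≤
1`, this is linear in `|E|`, so `L¹` smallness of `E` is enough. -/
theorem drift_error_le {c p h m u E dl cr : ℝ} (hσ : 0 < σ) (hK : 0 ≤ K) {C : ℝ} (hc0 : 0 ≤ c)
    (hc1 : c ≤ 1) (hp : 0 < p) (hph : p * (1 + h) = 1) (hh : 0 ≤ h) (hm : 0 < m) (hu : m * h = u)
    (hE : |E| ≤ K * u) (hC : |cr| ≤ C) :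
    (c * -(p * dl) + cr * p) * E ≤ (C + K / (2 * σ)) * |E| + σ / 2 * (c * m * dl ^ 2) := by
  have hp1 : p ≤ 1 := by nlinarith
  have h1 : cr * p * E ≤ C * |E| := by
    calc cr * p * E ≤ |cr * p * E| := le_abs_self _
      _ = |cr| * p * |E| := by rw [abs_mul, abs_mul, abs_of_pos hp]
      _ ≤ C * 1 * |E| := by
        have := abs_nonneg cr
        gcongr
        linarith
      _ = C * |E| := by ring
  have h2 : -(p * dl * E) ≤ σ / 2 * (m * dl ^ 2) + p ^ 2 * E ^ 2 / (2 * σ * m) := by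
    have : σ / 2 * (m * dl ^ 2) + p ^ 2 * E ^ 2 / (2 * σ * m) + p * dl * E
        = (σ * m * dl + p * E) ^ 2 / (2 * σ * m) := by field_simp; ring
    have h0 : 0 ≤ (σ * m * dl + p * E) ^ 2 / (2 * σ * m) := by positivity
    linarith
  have h3 : p ^ 2 * E ^ 2 / (2 * σ * m) ≤ K / (2 * σ) * |E| := by
    have hp2 : p ^ 2 * h ≤ 1 := by nlinarith
    have : p ^ 2 * E ^ 2 ≤ K * m * |E| := by
      calc p ^ 2 * E ^ 2 = p ^ 2 * |E| * |E| := by rw [← sq_abs E]; ring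
        _ ≤ p ^ 2 * (K * u) * |E| := by gcongr
        _ = (p ^ 2 * h) * (K * m * |E|) := by rw [← hu]; ring
        _ ≤ 1 * (K * m * |E|) := by gcongr
        _ = _ := one_mul _
    rw [div_le_iff₀ (by positivity)]
    calc _ ≤ K * m * |E| := this
      _ = _ := by field_simp
  have h4 : 0 ≤ K / (2 * σ) * |E| := by positivity
  calc (c * -(p * dl) + cr * p) * E = cr * p * E + c * -(p * dl * E) := by ring
    _ ≤ C * |E| + c * (σ / 2 * (m * dl ^ 2) + K / (2 * σ) * |E|) := by
      gcongr; linarith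
    _ ≤ _ := by nlinarith

theorem measurable_kineticGenerator {χ : Phase d → ℝ} (hχ : ContDiff ℝ ∞ χ) :
    Measurable (kineticGenerator V γ σ χ) := by
  refine Finset.measurable_fun_sum _ fun j _ => ?_
  have h1 := (contDiff_dpos hχ j).continuous.measurable
  have h2 := (contDiff_dvel hχ j).continuous.measurable
  have h3 := (contDiff_dvel (contDiff_dvel hχ j) j).continuous.measurable
  have h4 : Measurable fun x : Phase d => force V j x.1 := (measurable_force j).comp measurable_fst
  have h5 : Measurable fun x : Phase d => x.2 j := (contDiff_vel j).continuous.measurable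
  fun_prop

/-- The test function `χ / (1 + h)` is bounded, and its velocity derivative produces the square of
the derivative of `log (1 + h)`. The relation `γ = σ * β` makes friction plus diffusion equal to `σ`
times the Gibbs weight times `∇_r h`. Half of the dissipation pays for the drift error, which
explains the factor `σ / 2`. -/
theorem IsRegularization.dissipation_le (hV : Differentiable ℝ V)
    (hL : ∀ θ, ‖fderiv ℝ V θ‖ ≤ L) (hr : IsRegularization V γ σ K κ ρ u Q A) (hσ : 0 < σ)
    (hγ : γ = σ * β) (hK : 0 ≤ K) (hρ : Integrable ρ)
    {χ : Phase d → ℝ} (hχ : ContDiff ℝ ∞ χ) (hχc : HasCompactSupport χ) (hχ0 : ∀ x, 0 ≤ χ x)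
    (hχ1 : ∀ x, χ x ≤ 1) {B C : ℝ} (hC : ∀ j x, |dvel j χ x| ≤ C)
    (hB : ∀ x, |kineticGenerator V γ σ χ x| ≤ B) :
    ∫ x, ∑ j, σ / 2 * (χ x * expEnergy (-β) V x * dvel j (logDensity β V u) x ^ 2) ≤
      (∫ x, |kineticGenerator V γ σ χ x| * |ρ x|) + (B + d * (C + K / (2 * σ)) + 1) * κ := by
  have hu := hr.contDiff
  have hu0 := hr.nonneg
  have hud : Differentiable ℝ u := hu.differentiable (by simp)
  have hχd : Differentiable ℝ χ := hχ.differentiable (by simp)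
  set w := expEnergy β V with hw
  set m := expEnergy (-β) V with hm
  set l := logDensity β V u with hl
  set p : Phase d → ℝ := fun x => (1 + u x * w x)⁻¹ with hp
  have hwd : Differentiable ℝ w := differentiable_expEnergy hV β
  have hmd : Differentiable ℝ m := differentiable_expEnergy hV (-β)
  have hld : Differentiable ℝ l := differentiable_logDensity hV hud hu0
  have hpd : Differentiable ℝ p :=
    Differentiable.inv (by fun_prop) fun x => (one_add_density_pos hu0 x).ne'
  have hmw : ∀ x, m x * w x = 1 := expEnergy_neg_mul β V
  have hdpm : ∀ j x, dpos j m x = -β * force V j x.1 * m x := dpos_expEnergy hV (-β)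
  have hdvm : ∀ j x, dvel j m x = -β * x.2 j * m x := dvel_expEnergy hV (-β)
  have hdpl : ∀ j x, dpos j l x = p x * ((dpos j u x + β * force V j x.1 * u x) * w x) :=
    dpos_logDensity hV hud hu0
  have hdvl : ∀ j x, dvel j l x = p x * ((dvel j u x + β * x.2 j * u x) * w x) :=
    dvel_logDensity hV hud hu0
  have hdvp : ∀ j x, dvel j p x = -(p x * dvel j l x) := dvel_inv_one_add_density hV hud hu0
  have cu := hud.continuous
  have cw := hwd.continuous
  have cm := hmd.continuous
  have cl := hld.continuous
  have cp := hpd.continuous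
  have cχ := hχd.continuous
  have cdu : ∀ j, Continuous (dpos j u) := fun j => (contDiff_dpos hu j).continuous
  have cvu : ∀ j, Continuous (dvel j u) := fun j => (contDiff_dvel hu j).continuous
  have cvl : ∀ j, Continuous (dvel j l) := continuous_dvel_logDensity hV hu hu0
  have cdχ : ∀ j, Continuous (dpos j χ) := fun j => (contDiff_dpos hχ j).continuous
  have cvχ : ∀ j, Continuous (dvel j χ) := fun j => (contDiff_dvel hχ j).continuous
  have cvvχ : ∀ j, Continuous (dvel j (dvel j χ)) := fun j =>
    (contDiff_dvel (contDiff_dvel hχ j) j).continuous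
  have cQ : ∀ j, Continuous (Q j) := fun j => (hr.contDiff_flux j).continuous
  have cA := hr.continuous_err
  have z0 : ∀ x ∉ tsupport χ, χ x = 0 := fun x hx => image_eq_zero_of_notMem_tsupport hx
  have zf : ∀ x ∉ tsupport χ, ∀ v, fderiv ℝ χ x v = 0 := fun x hx v => by
    have : fderiv ℝ χ x = 0 := by
      by_contra h
      exact hx (support_fderiv_subset ℝ h)
    simp [this]
  have zp : ∀ x ∉ tsupport χ, ∀ j, dpos j χ x = 0 := fun x hx j => zf x hx _
  have zv : ∀ x ∉ tsupport χ, ∀ j, dvel j χ x = 0 := fun x hx j => zf x hx _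
  have zvv : ∀ x ∉ tsupport χ, ∀ j, dvel j (dvel j χ) x = 0 := fun x hx j => by
    have : x ∉ tsupport (dvel j χ) := fun h => hx (tsupport_fderiv_apply_subset ℝ _ h)
    have h2 : fderiv ℝ (dvel j χ) x = 0 := by
      by_contra h
      exact this (support_fderiv_subset ℝ h)
    simp [dvel, h2]
  have int : ∀ f : Phase d → ℝ, Continuous f → (∀ x ∉ tsupport χ, f x = 0) → Integrable f :=
    fun f hf hz => hf.integrable_of_hasCompactSupport (HasCompactSupport.intro hχc hz)
  set ψ : Phase d → ℝ := fun x => χ x * p x with hψ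
  have hψd : Differentiable ℝ ψ := hχd.mul hpd
  have hψc : HasCompactSupport ψ := hχc.mul_right
  have hdψ : ∀ j x, dvel j ψ x = χ x * -(p x * dvel j l x) + dvel j χ x * p x := fun j x => by
    rw [← hdvp]; exact dvel_mul (hχd x) (hpd x) j
  have cvψ : ∀ j, Continuous (dvel j ψ) := fun j => by
    rw [funext (hdψ j)]; fun_prop
  have htest := hr.integral_test_eq_zero hψd hψc cvψ
  set E : Fin d → Phase d → ℝ := fun j x => Q j x - force V j x.1 * u x with hE
  set T : Fin d → Phase d → ℝ := fun j x => x.2 j * dpos j χ x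
    - (force V j x.1 + γ * x.2 j) * dvel j χ x + σ * dvel j (dvel j χ) x with hT
  set D : Fin d → Phase d → ℝ := fun j x => χ x * m x * dvel j l x ^ 2 with hD
  set n : Phase d → ℝ := fun x => m x * l x with hn
  have hnd : Differentiable ℝ n := hmd.mul hld
  set G : Fin d → Phase d → ℝ := fun j x => x.2 j * (χ x * n x) with hG
  set N₁ : Phase d → ℝ := fun x => ψ x * u x + -1 * (χ x * n x) with hN₁
  set N₂ : Fin d → Phase d → ℝ := fun j x => n x * dvel j χ x with hN₂
  have hvd : ∀ j, Differentiable ℝ fun x : Phase d => x.2 j := fun j => by fun_prop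
  have hvχd : ∀ j, Differentiable ℝ (dvel j χ) := fun j =>
    (contDiff_dvel hχ j).differentiable (by simp)
  have hGd : ∀ j, Differentiable ℝ (G j) := fun j => (hvd j).mul (hχd.mul hnd)
  have hN₁d : Differentiable ℝ N₁ := (hψd.mul hud).add ((hχd.mul hnd).const_mul _)
  have hN₂d : ∀ j, Differentiable ℝ (N₂ j) := fun j => hnd.mul (hvχd j)
  have hdG : ∀ j x, dpos j (G j) x = x.2 j * (χ x * (m x * (p x * (dpos j u x * w x)))
      + dpos j χ x * n x) + force V j x.1 * (x.2 j * (χ x *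
        (m x * (p x * (β * u x * w x)) - β * n x))) := by
    intro j x
    have e1 : dpos j n x = m x * dpos j l x + dpos j m x * l x := dpos_mul (hmd x) (hld x) j
    have e2 : dpos j (fun y => χ y * n y) x = χ x * dpos j n x + dpos j χ x * n x :=
      dpos_mul (hχd x) (hnd x) j
    have e3 := dpos_mul (hvd j x) (hχd.mul hnd x) j
    rw [dpos_vel, zero_mul, add_zero] at e3
    refine e3.trans ?_
    change x.2 j * dpos j (fun y => χ y * n y) x = _
    rw [e2, e1, hdpm, hdpl]
    simp only [hn]
    ring
  have hdvn : ∀ j x, dvel j n x = m x * dvel j l x + -β * x.2 j * n x := by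
    intro j x
    have e1 : dvel j n x = m x * dvel j l x + dvel j m x * l x := dvel_mul (hmd x) (hld x) j
    rw [e1, hdvm]
    simp only [hn]
    ring
  have hdN₁ : ∀ j x, dvel j N₁ x = ψ x * dvel j u x + dvel j ψ x * u x
      + -1 * (χ x * (m x * dvel j l x + -β * x.2 j * n x) + dvel j χ x * n x) := by
    intro j x
    have e1 : dvel j (fun y => χ y * n y) x = χ x * dvel j n x + dvel j χ x * n x :=
      dvel_mul (hχd x) (hnd x) j
    have e2 : dvel j (fun y => ψ y * u y) x = ψ x * dvel j u x + dvel j ψ x * u x :=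
      dvel_mul (hψd x) (hud x) j
    have e3 := dvel_add (hψd.mul hud x) ((hχd.mul hnd).const_mul (-1) x) j
    refine e3.trans ?_
    have e4 := dvel_const_mul (hχd.mul hnd x) (-1) j
    rw [← hdvn, ← e1, ← e2]
    exact congrArg _ e4
  have hdN₂ : ∀ j x, dvel j (N₂ j) x = n x * dvel j (dvel j χ) x
      + (m x * dvel j l x + -β * x.2 j * n x) * dvel j χ x := by
    intro j x
    rw [← hdvn]
    exact dvel_mul (hnd x) (hvχd j x) j
  -- Each summand is minus the dissipation, minus `n` times a term of the generator of `χ`, plus the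
  -- drift error, plus total derivatives of `G`, `N₁` and `N₂`. The force in front of the derivative
  -- of `N₁` is harmless because it does not depend on the velocity.
  have hpt : ∀ j x, ψ x * x.2 j * dpos j u x
      + dvel j ψ x * (Q j x + γ * x.2 j * u x + σ * dvel j u x)
      = (-(σ * D j x) - n x * T j x + dvel j ψ x * E j x)
        + (dpos j (G j) x + force V j x.1 * dvel j N₁ x + σ * dvel j (N₂ j) x) := by
    intro j x
    rw [hdG, hdN₁, hdN₂]
    have e1 : m x * dvel j l x = p x * (dvel j u x + β * x.2 j * u x) := by
      rw [hdvl]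
      linear_combination (p x * (dvel j u x + β * x.2 j * u x)) * hmw x
    have e2 : m x * (p x * (dpos j u x * w x)) = p x * dpos j u x := by
      linear_combination (p x * dpos j u x) * hmw x
    have e3 : m x * (p x * (β * u x * w x)) = p x * (β * u x) := by
      linear_combination (p x * (β * u x)) * hmw x
    have e4 : σ * (m x * dvel j l x ^ 2) = dvel j l x * (σ * (p x * (dvel j u x + β * x.2 j * u x)))
      := by rw [← e1]; ring
    simp only [hD, hT, hE]
    rw [e2, e3, e1]
    simp only [hψ]
    rw [hdψ, hγ]
    linear_combination (χ x) * e4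
  have iG : ∀ j, Integrable (dpos j (G j)) := fun j => by
    rw [funext (hdG j)]
    refine (int _ ?_ ?_).add (integrable_force_mul hL j (int _ ?_ ?_))
    · fun_prop
    · intro x hx; simp [z0 x hx, zp x hx]
    · fun_prop
    · intro x hx; simp [z0 x hx]
  have iN₁ : ∀ j, Integrable (fun x => force V j x.1 * dvel j N₁ x) := fun j => by
    refine integrable_force_mul hL j ?_
    rw [funext (hdN₁ j)]
    refine int _ (by fun_prop) ?_
    intro x hx
    simp [hdψ, z0 x hx, zv x hx, show ψ x = 0 by simp [hψ, z0 x hx]]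
  have iN₂ : ∀ j, Integrable (dvel j (N₂ j)) := fun j => by
    rw [funext (hdN₂ j)]
    refine int _ (by fun_prop) ?_
    intro x hx
    simp [zv x hx, zvv x hx]
  have iD : ∀ j, Integrable (D j) := fun j =>
    int _ (by fun_prop) fun x hx => by simp [hD, z0 x hx]
  have inT : ∀ j, Integrable (fun x => n x * T j x) := fun j => by
    have e : (fun x => n x * T j x) = fun x => n x * (x.2 j * dpos j χ x - γ * x.2 j * dvel j χ x
        + σ * dvel j (dvel j χ) x) + force V j x.1 * (-(n x * dvel j χ x)) := by
      funext x; simp only [hT]; ring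
    rw [e]
    refine (int _ (by fun_prop) ?_).add (integrable_force_mul hL j (int _ (by fun_prop) ?_))
    · intro x hx; simp [zp x hx, zv x hx, zvv x hx]
    · intro x hx; simp [zv x hx]
  have idE : ∀ j, Integrable (fun x => dvel j ψ x * E j x) := fun j => by
    have e : (fun x => dvel j ψ x * E j x) = fun x => dvel j ψ x * Q j x
        + force V j x.1 * (-(dvel j ψ x * u x)) := by
      funext x; simp only [hE]; ring
    rw [e]
    refine (int _ (by fun_prop) ?_).add (integrable_force_mul hL j (int _ (by fun_prop) ?_))
    · intro x hx; simp [hdψ, z0 x hx, zv x hx]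
    · intro x hx; simp [hdψ, z0 x hx, zv x hx]
  have iψA : Integrable fun x => ψ x * A x :=
    int _ (by fun_prop) fun x hx => by simp [hψ, z0 x hx]
  have iR : ∀ j, Integrable fun x => -(σ * D j x) - n x * T j x + dvel j ψ x * E j x := fun j =>
    (((iD j).const_mul σ).neg.sub (inT j)).add (idE j)
  have iS : ∀ j, Integrable fun x =>
      dpos j (G j) x + force V j x.1 * dvel j N₁ x + σ * dvel j (N₂ j) x := fun j =>
    ((iG j).add (iN₁ j)).add ((iN₂ j).const_mul σ)
  have hS : ∀ j, ∫ x, (dpos j (G j) x + force V j x.1 * dvel j N₁ x + σ * dvel j (N₂ j) x) = 0 := by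
    intro j
    have h1 : Integrable fun x => dpos j (G j) x := iG j
    have h2 := iN₁ j
    have h3 : Integrable fun x => dvel j (N₂ j) x := iN₂ j
    simp (disch := fun_prop) only [integral_add, integral_const_mul]
    have hGc : HasCompactSupport (G j) :=
      HasCompactSupport.intro hχc fun x hx => by simp [hG, z0 x hx]
    have hN₂c : HasCompactSupport (N₂ j) :=
      HasCompactSupport.intro hχc fun x hx => by simp [hN₂, zv x hx]
    rw [integral_dpos_eq_zero (hGd j) hGc j (iG j), integral_dvel_eq_zero (hN₂d j) hN₂c j (iN₂ j),
      integral_comp_fst_mul_dvel_eq_zero hN₁d j (integrable_force_mul hL j (int N₁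
        hN₁d.continuous fun x hx => by simp [hN₁, hψ, z0 x hx])) (iN₁ j)]
    simp
  have hRA : Integrable fun x => ∑ j, (-(σ * D j x) - n x * T j x + dvel j ψ x * E j x)
      + ψ x * A x := (integrable_finsetSum _ fun j _ => iR j).add iψA
  have hzero : ∫ x, (∑ j, (-(σ * D j x) - n x * T j x + dvel j ψ x * E j x) + ψ x * A x) = 0 := by
    rw [← htest]
    have e : ∀ x, ∑ j, (ψ x * x.2 j * dpos j u x
        + dvel j ψ x * (Q j x + γ * x.2 j * u x + σ * dvel j u x)) + ψ x * A x
        = (∑ j, (-(σ * D j x) - n x * T j x + dvel j ψ x * E j x) + ψ x * A x)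
          + ∑ j, (dpos j (G j) x + force V j x.1 * dvel j N₁ x + σ * dvel j (N₂ j) x) := by
      intro x
      simp_rw [hpt, Finset.sum_add_distrib]
      ring
    rw [integral_congr_ae (ae_of_all _ e), integral_add hRA
      (integrable_finsetSum _ fun j _ => iS j), integral_finsetSum _ fun j _ => iS j,
      Finset.sum_eq_zero fun j _ => hS j, add_zero]
  have hbound : ∀ x, ∑ j, (-(σ * D j x) - n x * T j x + dvel j ψ x * E j x) + ψ x * A x
      ≤ -∑ j, σ / 2 * D j x + |kineticGenerator V γ σ χ x| * u x
        + ∑ j, (C + K / (2 * σ)) * |E j x| + |A x| := by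
    intro x
    have hn0 : 0 ≤ n x := mul_nonneg (expEnergy_pos _ _ _).le (logDensity_nonneg hu0 x)
    have hnu : n x ≤ u x := by
      calc n x ≤ m x * (u x * w x) :=
            mul_le_mul_of_nonneg_left (logDensity_le hu0 x) (expEnergy_pos _ _ _).le
        _ = u x := by linear_combination (u x) * hmw x
    have hp0 : 0 < p x := inv_pos.2 (one_add_density_pos hu0 x)
    have hph : p x * (1 + u x * w x) = 1 := inv_mul_cancel₀ (one_add_density_pos hu0 x).ne'
    have huw : 0 ≤ u x * w x := mul_nonneg (hu0 x) (expEnergy_pos _ _ _).le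
    have h1 : -(n x * kineticGenerator V γ σ χ x) ≤ |kineticGenerator V γ σ χ x| * u x := by
      calc -(n x * kineticGenerator V γ σ χ x) ≤ n x * |kineticGenerator V γ σ χ x| := by
            rw [← mul_neg]
            exact mul_le_mul_of_nonneg_left (neg_le_abs _) hn0
        _ ≤ u x * |kineticGenerator V γ σ χ x| := by gcongr
        _ = _ := mul_comm _ _
    have h2 : ∀ j, dvel j ψ x * E j x ≤ (C + K / (2 * σ)) * |E j x| + σ / 2 * D j x := by
      intro j
      rw [hdψ]
      exact drift_error_le hσ hK (hχ0 x) (hχ1 x) hp0 hph huw (expEnergy_pos (-β) V x)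
        (by linear_combination (u x) * hmw x) (hr.abs_flux_le j x) (hC j x)
    have h3 : ψ x * A x ≤ |A x| := by
      have hp1 : p x ≤ 1 := by nlinarith
      have hψ0 : 0 ≤ ψ x := mul_nonneg (hχ0 x) hp0.le
      have hψ1 : ψ x ≤ 1 := mul_le_one₀ (hχ1 x) hp0.le hp1
      calc ψ x * A x ≤ ψ x * |A x| := mul_le_mul_of_nonneg_left (le_abs_self _) hψ0
        _ ≤ 1 * |A x| := by gcongr
        _ = |A x| := one_mul _
    have h4 : ∑ j, (-(σ * D j x) - n x * T j x + dvel j ψ x * E j x)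
        ≤ ∑ j, (-(σ / 2 * D j x) - n x * T j x + (C + K / (2 * σ)) * |E j x|) :=
      Finset.sum_le_sum fun j _ => by have := h2 j; linarith
    have h5 : ∑ j, n x * T j x = n x * kineticGenerator V γ σ χ x := by
      rw [← Finset.mul_sum]; rfl
    simp only [Finset.sum_add_distrib, Finset.sum_sub_distrib, h5, Finset.sum_neg_distrib] at h4 ⊢
    linarith
  have hB0 : 0 ≤ B := (abs_nonneg _).trans (hB 0)
  have ikin : ∀ f : Phase d → ℝ, Integrable f →
      Integrable fun x => |kineticGenerator V γ σ χ x| * f x := fun f hf =>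
    hf.bdd_mul (measurable_kineticGenerator hχ).abs.aestronglyMeasurable (c := B)
      (ae_of_all _ fun x => by simpa using hB x)
  have iku := ikin u hr.integrable
  have ikρ := ikin _ hρ.abs
  have iabs : Integrable fun x => |u x - ρ x| := (hr.integrable.sub hρ).abs
  have iE : ∀ j, Integrable fun x => (C + K / (2 * σ)) * |E j x| := fun j =>
    (hr.integrable_flux j).abs.const_mul _
  have iEs : Integrable fun x => ∑ j, (C + K / (2 * σ)) * |E j x| :=
    integrable_finsetSum _ fun j _ => iE j
  have iDs : Integrable fun x => ∑ j, σ / 2 * D j x :=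
    integrable_finsetSum _ fun j _ => (iD j).const_mul _
  have iA := hr.integrable_err.abs
  have hfin := integral_mono hRA (((iDs.neg.add iku).add iEs).add iA) hbound
  have hκ : 0 ≤ κ := (integral_nonneg fun x => abs_nonneg _).trans hr.integral_err_le
  have hC0 : ∀ j : Fin d, 0 ≤ C := fun j => (abs_nonneg _).trans (hC j 0)
  -- The cutoff will be chosen in terms of `ρ`, before `u` is known, so `u` is traded for `ρ` here
  -- at the price `B * κ`.
  have k1 : ∫ x, |kineticGenerator V γ σ χ x| * u x
      ≤ (∫ x, |kineticGenerator V γ σ χ x| * |ρ x|) + B * κ := by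
    calc _ ≤ ∫ x, (|kineticGenerator V γ σ χ x| * |ρ x| + B * |u x - ρ x|) := by
          refine integral_mono iku (ikρ.add (iabs.const_mul B)) fun x => ?_
          have h1 : u x ≤ |ρ x| + |u x - ρ x| := by
            have := le_abs_self (u x - ρ x)
            have := le_abs_self (ρ x)
            linarith
          have h2 := mul_le_mul_of_nonneg_left h1 (abs_nonneg (kineticGenerator V γ σ χ x))
          have h3 := mul_le_mul_of_nonneg_right (hB x) (abs_nonneg (u x - ρ x))
          dsimp only
          linarith
      _ ≤ _ := by
          rw [integral_add ikρ (iabs.const_mul B), integral_const_mul]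
          have := mul_le_mul_of_nonneg_left hr.integral_sub_le hB0
          linarith
  have k2 : ∫ x, ∑ j, (C + K / (2 * σ)) * |E j x| ≤ d * (C + K / (2 * σ)) * κ := by
    rw [integral_finsetSum _ fun j _ => iE j]
    calc _ ≤ ∑ j : Fin d, (C + K / (2 * σ)) * κ := by
          refine Finset.sum_le_sum fun j _ => ?_
          rw [integral_const_mul]
          have := hC0 j
          exact mul_le_mul_of_nonneg_left (hr.integral_flux_le j) (by positivity)
      _ = _ := by simp [mul_assoc]
  have k3 := hr.integral_err_le
  rw [hzero, integral_add' ((iDs.neg.add iku).add iEs) iA, integral_add' (iDs.neg.add iku) iEs,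
    integral_add' iDs.neg iku, integral_neg'] at hfin
  change ∫ x, ∑ j, σ / 2 * D j x ≤ _
  linarith

end Dissipation

/-! ### Slowly varying cutoffs -/

section Cutoff

variable {d : ℕ} {V : Param d → ℝ} {L β γ σ K : ℝ} {ρ : Phase d → ℝ}

/-- The bounds are summed over `j`, which also covers `d = 0`. -/
theorem exists_abs_le_of_hasCompactSupport {f : Fin d → Phase d → ℝ} (hf : ∀ j, Continuous (f j))
    (hc : ∀ j, HasCompactSupport (f j)) : ∃ C, 0 ≤ C ∧ ∀ j x, |f j x| ≤ C := by
  choose c hcb using fun j => (hc j).exists_bound_of_continuous (hf j)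
  have h0 : ∀ j, 0 ≤ c j := fun j => (norm_nonneg _).trans (hcb j 0)
  exact ⟨∑ j, c j, Finset.sum_nonneg fun j _ => h0 j, fun j x => (hcb j x).trans
    (Finset.single_le_sum (fun j _ => h0 j) (Finset.mem_univ j))⟩

theorem fderiv_comp_smul {ϖ : Phase d → ℝ} (hϖ : Differentiable ℝ ϖ) (s : ℝ) (x v : Phase d) :
    fderiv ℝ (fun y => ϖ (s • y)) x v = s * fderiv ℝ ϖ (s • x) v := by
  have := ((hϖ (s • x)).hasFDerivAt.comp x ((hasFDerivAt_id x).const_smul s)).fderiv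
  simp only [Function.comp_def] at this
  erw [this]
  simp

/-- Slowly varying cutoff functions on which the generator is small on average. -/
theorem exists_cutoff (hL : ∀ θ, ‖fderiv ℝ V θ‖ ≤ L) (hρ : Integrable ρ) {S : Set (Phase d)}
    (hS : IsCompact S) (γ σ : ℝ) {κ : ℝ} (hκ : 0 < κ) :
    ∃ χ : Phase d → ℝ, ContDiff ℝ ∞ χ ∧ HasCompactSupport χ ∧ (∀ x, 0 ≤ χ x) ∧ (∀ x, χ x ≤ 1) ∧
      (∀ x ∈ S, χ x = 1) ∧ (∃ B, ∀ x, |kineticGenerator V γ σ χ x| ≤ B) ∧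
      (∃ C, ∀ j x, |dvel j χ x| ≤ C) ∧ ∫ x, |kineticGenerator V γ σ χ x| * |ρ x| ≤ κ := by
  have hL0 : 0 ≤ L := (norm_nonneg _).trans (hL 0)
  let ϖ : ContDiffBump (0 : Phase d) := ⟨1, 2, one_pos, one_lt_two⟩
  have hϖ : ContDiff ℝ ∞ ϖ := ϖ.contDiff
  have hϖd : Differentiable ℝ ϖ := hϖ.differentiable (by simp)
  have hϖc : HasCompactSupport ϖ := ϖ.hasCompactSupport
  have hc1 := fun j => hasCompactSupport_dpos hϖc j
  have hc2 := fun j => hasCompactSupport_dvel hϖc j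
  have hs1 := fun j => (contDiff_dpos hϖ j).continuous
  have hs2 := fun j => (contDiff_dvel hϖ j).continuous
  obtain ⟨b₁, hb₁0, hb₁⟩ := exists_abs_le_of_hasCompactSupport
    (f := fun j z => z.2 j * dpos j ϖ z - γ * z.2 j * dvel j ϖ z)
    (fun j => by have := hs1 j; have := hs2 j; fun_prop)
    (fun j => (hc1 j).mul_left.sub (hc2 j).mul_left)
  obtain ⟨b₂, hb₂0, hb₂⟩ := exists_abs_le_of_hasCompactSupport hs2 hc2
  obtain ⟨b₃, hb₃0, hb₃⟩ := exists_abs_le_of_hasCompactSupport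
    (f := fun j => dvel j (dvel j ϖ))
    (fun j => (contDiff_dvel (contDiff_dvel hϖ j) j).continuous)
    (fun j => hasCompactSupport_dvel (hc2 j) j)
  set s : ℕ → ℝ := fun n => 1 / ((n : ℝ) + 1) with hs
  have hs0 : ∀ n, 0 < s n := fun n => by positivity
  have hs1' : ∀ n, s n ≤ 1 := fun n => by
    rw [hs]; dsimp only; rw [div_le_one (by positivity)]; linarith [n.cast_nonneg (α := ℝ)]
  have hst : Tendsto s atTop (𝓝 0) := tendsto_one_div_add_atTop_nhds_zero_nat
  set χ : ℕ → Phase d → ℝ := fun n x => ϖ (s n • x) with hχ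
  have hχs : ∀ n, ContDiff ℝ ∞ (χ n) := fun n => hϖ.comp (contDiff_const_smul _)
  have hχc : ∀ n, HasCompactSupport (χ n) := fun n => hϖc.comp_smul (hs0 n).ne'
  have hdp : ∀ n j x, dpos j (χ n) x = s n * dpos j ϖ (s n • x) := fun n j x =>
    fderiv_comp_smul hϖd _ _ _
  have hdv : ∀ n j x, dvel j (χ n) x = s n * dvel j ϖ (s n • x) := fun n j x =>
    fderiv_comp_smul hϖd _ _ _
  have hdvv : ∀ n j x, dvel j (dvel j (χ n)) x = s n * (s n * dvel j (dvel j ϖ) (s n • x)) := by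
    intro n j x
    have hd : Differentiable ℝ (dvel j ϖ) := (contDiff_dvel hϖ j).differentiable (by simp)
    rw [funext (hdv n j), dvel_const_mul (by fun_prop)]
    congr 1
    exact fderiv_comp_smul hd _ _ _
  -- The terms with coefficient `x.2 j` are invariant under the rescaling, so the generator of the
  -- cutoffs is bounded uniformly in `n`, though not uniformly small.
  set B : ℝ := ∑ j : Fin d, (b₁ + L * b₂ + |σ| * b₃) with hB
  have hbound : ∀ n x, |kineticGenerator V γ σ (χ n) x| ≤ B := by
    intro n x
    refine (Finset.abs_sum_le_sum_abs _ _).trans (Finset.sum_le_sum fun j _ => ?_)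
    have e : x.2 j * dpos j (χ n) x - (force V j x.1 + γ * x.2 j) * dvel j (χ n) x
        + σ * dvel j (dvel j (χ n)) x
        = ((s n • x).2 j * dpos j ϖ (s n • x) - γ * (s n • x).2 j * dvel j ϖ (s n • x))
          + -(s n * (force V j x.1 * dvel j ϖ (s n • x)))
          + s n * (s n * (σ * dvel j (dvel j ϖ) (s n • x))) := by
      rw [hdp, hdvv, hdv]
      simp only [Prod.smul_snd, PiLp.smul_apply, smul_eq_mul]
      ring
    rw [e]
    refine (abs_add_three _ _ _).trans ?_
    gcongr
    · exact hb₁ j _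
    · rw [abs_neg, abs_mul, abs_mul, abs_of_pos (hs0 n)]
      calc s n * (|force V j x.1| * |dvel j ϖ (s n • x)|) ≤ 1 * (L * b₂) := by
            gcongr
            · exact hs1' n
            · exact abs_force_le hL j _
            · exact hb₂ j _
        _ = _ := one_mul _
    · rw [abs_mul, abs_mul, abs_mul, abs_of_pos (hs0 n)]
      calc s n * (s n * (|σ| * |dvel j (dvel j ϖ) (s n • x)|)) ≤ 1 * (1 * (|σ| * b₃)) := by
            have := hs0 n
            have := hs1' n
            gcongr
            exact hb₃ j _
        _ = _ := by ring
  have hnear : ∀ x : Phase d, ∀ᶠ n in atTop, ‖s n • x‖ < 1 := by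
    intro x
    have : Tendsto (fun n => ‖s n • x‖) atTop (𝓝 0) := by
      simpa using (hst.smul_const x).norm
    exact this.eventually_lt_const one_pos
  have hzero : ∀ x, ∀ᶠ n in atTop, kineticGenerator V γ σ (χ n) x = 0 := by
    intro x
    filter_upwards [hnear x] with n hn
    have hev : χ n =ᶠ[𝓝 x] fun _ => 1 := by
      have hopen : ∀ᶠ y in 𝓝 x, ‖s n • y‖ < 1 :=
        (continuous_const_smul (s n)).norm.continuousAt.eventually_lt continuousAt_const hn
      filter_upwards [hopen] with y hy
      exact ϖ.one_of_mem_closedBall (by simpa [ϖ] using hy.le)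
    have h1 : fderiv ℝ (χ n) =ᶠ[𝓝 x] fun _ => 0 :=
      (hev.fderiv (𝕜 := ℝ)).trans (Eventually.of_forall fun y => by simp)
    have h2 : ∀ j, dvel j (χ n) =ᶠ[𝓝 x] fun _ => 0 := fun j => by
      filter_upwards [h1] with y hy
      simp [dvel, hy]
    refine Finset.sum_eq_zero fun j _ => ?_
    have h3 : dvel j (dvel j (χ n)) x = 0 := by
      have := (h2 j).fderiv_eq (𝕜 := ℝ)
      rw [dvel, this]
      simp
    rw [h3, (h2 j).eq_of_nhds, dpos, h1.eq_of_nhds]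
    simp
  -- Smallness comes from dominated convergence: near any fixed point the cutoff is eventually 1.
  -- Integrability of `ρ` suffices, without moments.
  have hlim : Tendsto (fun n => ∫ x, |kineticGenerator V γ σ (χ n) x| * |ρ x|) atTop (𝓝 0) := by
    have := tendsto_integral_of_dominated_convergence (μ := (volume : Measure (Phase d)))
      (F := fun n x => |kineticGenerator V γ σ (χ n) x| * |ρ x|) (f := fun _ => 0)
      (fun x => B * |ρ x|)
      (fun n => (measurable_kineticGenerator (hχs n)).abs.aestronglyMeasurable.mul
        hρ.abs.aestronglyMeasurable) (hρ.abs.const_mul B)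
      (fun n => ae_of_all _ fun x => by
        rw [Real.norm_eq_abs, abs_mul, abs_abs, abs_abs]
        exact mul_le_mul_of_nonneg_right (hbound n x) (abs_nonneg _))
      (ae_of_all _ fun x => tendsto_const_nhds.congr' (by
        filter_upwards [hzero x] with n hn
        simp [hn]))
    simpa using this
  have hSn : ∀ᶠ n in atTop, ∀ x ∈ S, ‖s n • x‖ ≤ 1 := by
    obtain ⟨r, hr⟩ := hS.isBounded.exists_norm_le
    have : Tendsto (fun n => s n * r) atTop (𝓝 0) := by simpa using hst.mul_const r
    filter_upwards [this.eventually_le_const one_pos] with n hn x hx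
    rw [norm_smul, Real.norm_eq_abs, abs_of_pos (hs0 n)]
    exact (mul_le_mul_of_nonneg_left (hr x hx) (hs0 n).le).trans hn
  obtain ⟨n, hn1, hn2⟩ := (hSn.and (hlim.eventually_le_const hκ)).exists
  obtain ⟨C, -, hC⟩ := exists_abs_le_of_hasCompactSupport
    (fun j => (contDiff_dvel (hχs n) j).continuous)
    (fun j => hasCompactSupport_dvel (hχc n) j)
  exact ⟨χ n, hχs n, hχc n, fun x => ϖ.nonneg, fun x => ϖ.le_one,
    fun x hx => ϖ.one_of_mem_closedBall (by simpa [ϖ] using hn1 x hx), ⟨B, hbound n⟩, ⟨C, hC⟩, hn2⟩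

end Cutoff

/-! ### The relative density does not depend on the velocity -/

section VelocityIndependence

variable {d : ℕ} {V : Param d → ℝ} {L β γ σ K : ℝ} {ρ : Phase d → ℝ}

theorem locallyIntegrable_mul_expEnergy (hV : Differentiable ℝ V) (hρ : Integrable ρ) (β : ℝ) :
    LocallyIntegrable fun x => ρ x * expEnergy β V x := by
  rw [← locallyIntegrableOn_univ]
  exact (hρ.locallyIntegrable.locallyIntegrableOn _).mul_continuousOn
    (continuous_expEnergy hV β).continuousOn isOpen_univ.isLocallyClosed

theorem aestronglyMeasurable_logDensity (hV : Differentiable ℝ V) (hρ : Integrable ρ) (β : ℝ) :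
    AEStronglyMeasurable (logDensity β V ρ) := by
  have h1 := hρ.aestronglyMeasurable.aemeasurable
  have h2 := (continuous_expEnergy hV β).measurable
  have h3 : AEMeasurable fun x => 1 + ρ x * expEnergy β V x := by fun_prop
  exact (Real.measurable_log.comp_aemeasurable h3).aestronglyMeasurable

/-- The bound carries `L¹` convergence of the regularizations over to `logDensity` on compact sets.
-/
theorem abs_log_one_add_sub_log_one_add_le {a b : ℝ} (ha : 0 ≤ a) (hb : 0 ≤ b) :
    |Real.log (1 + a) - Real.log (1 + b)| ≤ |a - b| := by
  wlog h : b ≤ a generalizing a b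
  · rw [abs_sub_comm, abs_sub_comm a b]
    exact this hb ha (not_le.1 h).le
  have h1 : Real.log (1 + b) ≤ Real.log (1 + a) := Real.log_le_log (by linarith) (by linarith)
  rw [abs_of_nonneg (by linarith), abs_of_nonneg (by linarith),
    ← Real.log_div (by linarith) (by linarith)]
  have h2 := Real.log_le_sub_one_of_pos (x := (1 + a) / (1 + b)) (by positivity)
  have h3 : (1 + a) / (1 + b) - 1 ≤ a - b := by
    rw [div_sub_one (by linarith), div_le_iff₀ (by linarith)]
    nlinarith
  linarith

theorem locallyIntegrable_logDensity (hV : Differentiable ℝ V) (hρ : Integrable ρ)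
    (hρ0 : ∀ᵐ x, 0 ≤ ρ x) (β : ℝ) : LocallyIntegrable (logDensity β V ρ) := by
  refine (locallyIntegrable_mul_expEnergy hV hρ β).mono
    (aestronglyMeasurable_logDensity hV hρ β) (hρ0.mono fun x hx => ?_)
  have h := mul_nonneg hx (expEnergy_pos β V x).le
  simpa [logDensity] using abs_log_one_add_sub_log_one_add_le h le_rfl

/-- Integrate by parts, then apply Young's inequality with parameter `t`, splitting the weights as
`expEnergy β V` on `ζ²` and its inverse on the squared derivative. As `χ = 1` on the support of `ζ`,
the latter is controlled by the dissipation. -/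
theorem IsRegularization.abs_integral_logDensity_le (hV : Differentiable ℝ V)
    (hL : ∀ θ, ‖fderiv ℝ V θ‖ ≤ L) {u A : Phase d → ℝ} {Q : Fin d → Phase d → ℝ} {κ : ℝ}
    (hr : IsRegularization V γ σ K κ ρ u Q A) (hσ : 0 < σ)
    (hγ : γ = σ * β) (hK : 0 ≤ K) (hρ : Integrable ρ)
    {χ : Phase d → ℝ} (hχ : ContDiff ℝ ∞ χ) (hχc : HasCompactSupport χ) (hχ0 : ∀ x, 0 ≤ χ x)
    (hχ1 : ∀ x, χ x ≤ 1) {B C : ℝ} (hC : ∀ j x, |dvel j χ x| ≤ C)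
    (hB : ∀ x, |kineticGenerator V γ σ χ x| ≤ B) {ζ : Phase d → ℝ} (hζ : ContDiff ℝ ∞ ζ)
    (hζc : HasCompactSupport ζ) (hχζ : ∀ x ∈ tsupport ζ, χ x = 1) (j : Fin d) {t : ℝ}
    (ht : 0 < t) :
    |∫ x, logDensity β V u x * dvel j ζ x| ≤ t / 2 * (∫ x, ζ x ^ 2 * expEnergy β V x) +
      1 / (t * σ) * ((∫ x, |kineticGenerator V γ σ χ x| * |ρ x|)
        + (B + d * (C + K / (2 * σ)) + 1) * κ) := by
  have hu := hr.contDiff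
  have hu0 := hr.nonneg
  have hud : Differentiable ℝ u := hu.differentiable (by simp)
  have hld := differentiable_logDensity (β := β) hV hud hu0
  have hζd : Differentiable ℝ ζ := hζ.differentiable (by simp)
  have cl := hld.continuous
  have cvl := continuous_dvel_logDensity (β := β) hV hu hu0
  have cζ := hζ.continuous
  have cvζ := (contDiff_dvel hζ j).continuous
  have cw := continuous_expEnergy hV β
  have cm := continuous_expEnergy hV (-β)
  have cχ := hχ.continuous
  have i1 : Integrable fun x => logDensity β V u x * dvel j ζ x :=
    (cl.mul cvζ).integrable_of_hasCompactSupport (hasCompactSupport_dvel hζc j).mul_left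
  have i2 : Integrable fun x => dvel j (logDensity β V u) x * ζ x :=
    ((cvl j).mul cζ).integrable_of_hasCompactSupport hζc.mul_left
  have i3 : Integrable fun x => ζ x ^ 2 * expEnergy β V x :=
    Continuous.integrable_of_hasCompactSupport (by fun_prop)
      (HasCompactSupport.intro hζc fun x hx => by simp [image_eq_zero_of_notMem_tsupport hx])
  have iD : ∀ j, Integrable fun x =>
      σ / 2 * (χ x * expEnergy (-β) V x * dvel j (logDensity β V u) x ^ 2) := fun j =>
    Continuous.integrable_of_hasCompactSupport (by have := cvl j; fun_prop)
      (HasCompactSupport.intro hχc fun x hx => by simp [image_eq_zero_of_notMem_tsupport hx])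
  have hparts : ∫ x, logDensity β V u x * dvel j ζ x
      = -∫ x, dvel j (logDensity β V u) x * ζ x := by
    rw [eq_neg_iff_add_eq_zero, ← integral_add i1 i2]
    have e : ∀ x, logDensity β V u x * dvel j ζ x + dvel j (logDensity β V u) x * ζ x
        = dvel j (fun y => logDensity β V u y * ζ y) x := fun x =>
      (dvel_mul (hld x) (hζd x) j).symm
    rw [integral_congr_ae (ae_of_all _ e)]
    refine integral_dvel_eq_zero (hld.fun_mul hζd) hζc.mul_left j ?_
    rw [← funext e]
    exact i1.add i2
  rw [hparts, abs_neg]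
  have hdiss := hr.dissipation_le hV hL hσ hγ hK hρ hχ hχc hχ0 hχ1 hC hB
  have iDs : Integrable fun x => ∑ j,
      σ / 2 * (χ x * expEnergy (-β) V x * dvel j (logDensity β V u) x ^ 2) :=
    integrable_finsetSum _ fun j _ => iD j
  calc |∫ x, dvel j (logDensity β V u) x * ζ x|
      ≤ ∫ x, |dvel j (logDensity β V u) x * ζ x| := abs_integral_le_integral_abs
    _ ≤ ∫ x, (t / 2 * (ζ x ^ 2 * expEnergy β V x) + 1 / (t * σ) * ∑ j,
          σ / 2 * (χ x * expEnergy (-β) V x * dvel j (logDensity β V u) x ^ 2)) := by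
        refine integral_mono i2.abs ((i3.const_mul _).add (iDs.const_mul _)) fun x => ?_
        have hw := expEnergy_pos β V x
        have hm := expEnergy_pos (-β) V x
        have hmw := expEnergy_neg_mul β V x
        have hpos : ∀ j, 0 ≤ σ / 2 * (χ x * expEnergy (-β) V x *
            dvel j (logDensity β V u) x ^ 2) := fun j => by have := hχ0 x; positivity
        have hsum := Finset.single_le_sum (f := fun j => σ / 2 * (χ x * expEnergy (-β) V x *
            dvel j (logDensity β V u) x ^ 2)) (fun j _ => hpos j) (Finset.mem_univ j)
        have hsum' := mul_le_mul_of_nonneg_left hsum (a := 1 / (t * σ)) (by positivity)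
        refine le_trans ?_ (add_le_add_right hsum' _)
        by_cases hx : x ∈ tsupport ζ
        · set l := dvel j (logDensity β V u) x
          set w := expEnergy β V x
          set m := expEnergy (-β) V x
          have e : 1 / (t * σ) * (σ / 2 * (χ x * m * l ^ 2)) = m * l ^ 2 / (2 * t) := by
            rw [hχζ x hx]; field_simp
          dsimp only
          rw [e, abs_mul]
          have e2 : t / 2 * (ζ x ^ 2 * w) + m * l ^ 2 / (2 * t) - |l| * |ζ x|
              = w * (t * |ζ x| - m * |l|) ^ 2 / (2 * t) := by
            rw [← sq_abs (ζ x), ← sq_abs l]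
            field_simp
            linear_combination (2 * t * |ζ x| * |l| - m * |l| ^ 2) * hmw
          have : 0 ≤ w * (t * |ζ x| - m * |l|) ^ 2 / (2 * t) := by positivity
          linarith
        · have := hpos j
          simp only [image_eq_zero_of_notMem_tsupport hx]
          have : 0 ≤ 1 / (t * σ) * (σ / 2 * (χ x * expEnergy (-β) V x *
            dvel j (logDensity β V u) x ^ 2)) := by positivity
          simpa using this
    _ ≤ _ := by
        rw [integral_add (i3.const_mul _) (iDs.const_mul _), integral_const_mul,
          integral_const_mul]
        gcongr

/-- With `t = ε` and a dissipation bound of order `ε²`, both terms of the preceding estimate are of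
order `ε`. -/
theorem integral_logDensity_mul_dvel_eq_zero (hV : Differentiable ℝ V)
    (hL : ∀ θ, ‖fderiv ℝ V θ‖ ≤ L) (hσ : 0 < σ) (hγ : γ = σ * β) (hK : 0 ≤ K)
    (hρ : Integrable ρ) (hρ0 : ∀ᵐ x, 0 ≤ ρ x)
    (hreg : ∀ κ : ℝ, 0 < κ → ∃ u Q A, IsRegularization V γ σ K κ ρ u Q A)
    {ζ : Phase d → ℝ} (hζ : ContDiff ℝ ∞ ζ) (hζc : HasCompactSupport ζ) (j : Fin d) :
    ∫ x, logDensity β V ρ x * dvel j ζ x = 0 := by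
  have cvζ := (contDiff_dvel hζ j).continuous
  have hvζc := hasCompactSupport_dvel hζc j
  obtain ⟨c, hc0, hc⟩ := exists_abs_le_of_hasCompactSupport (d := d)
    (f := fun j x => expEnergy β V x * dvel j ζ x)
    (fun j => (continuous_expEnergy hV β).mul (contDiff_dvel hζ j).continuous)
    (fun j => (hasCompactSupport_dvel hζc j).mul_left)
  set Z := ∫ x, ζ x ^ 2 * expEnergy β V x with hZ
  have hZ0 : 0 ≤ Z := integral_nonneg fun x => mul_nonneg (sq_nonneg _) (expEnergy_pos _ _ _).le
  have key : ∀ ε : ℝ, 0 < ε → |∫ x, logDensity β V ρ x * dvel j ζ x|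
      ≤ ε * (Z / 2 + 2 / σ + c) := by
    intro ε hε
    -- The order of choices matters: the cutoff fixes `B` and `C`, and only then is the
    -- regularization taken fine enough to beat them.
    obtain ⟨χ, hχ, hχc, hχ0, hχ1, hχζ, ⟨B, hB⟩, ⟨C, hC⟩, hsmall⟩ :=
      exists_cutoff hL hρ hζc γ σ (pow_pos hε 2)
    have hB0 : 0 ≤ B := (abs_nonneg _).trans (hB 0)
    have hC0 : 0 ≤ C := (abs_nonneg _).trans (hC j 0)
    set N := B + d * (C + K / (2 * σ)) + 1 with hN
    have hN0 : 0 < N := by positivity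
    obtain ⟨κ, hκ, hκε, hκN⟩ : ∃ κ > 0, κ ≤ ε ∧ N * κ ≤ ε ^ 2 := by
      refine ⟨min ε (ε ^ 2 / N), by positivity, min_le_left _ _, ?_⟩
      calc N * min ε (ε ^ 2 / N) ≤ N * (ε ^ 2 / N) := by gcongr; exact min_le_right _ _
        _ = ε ^ 2 := by field_simp
    obtain ⟨u, Q, A, hr⟩ := hreg κ hκ
    have h1 := hr.abs_integral_logDensity_le hV hL hσ hγ hK hρ hχ hχc hχ0 hχ1 hC hB hζ hζc hχζ j hε
    have h2 : 1 / (ε * σ) * ((∫ x, |kineticGenerator V γ σ χ x| * |ρ x|) + N * κ)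
        ≤ 2 / σ * ε := by
      calc _ ≤ 1 / (ε * σ) * (ε ^ 2 + ε ^ 2) := by gcongr
        _ = _ := by field_simp; ring
    have i1 : Integrable fun x => logDensity β V ρ x * dvel j ζ x :=
      (locallyIntegrable_logDensity hV hρ hρ0 β).integrable_smul_right_of_hasCompactSupport cvζ hvζc
    have i2 : Integrable fun x => logDensity β V u x * dvel j ζ x :=
      (locallyIntegrable_logDensity hV hr.integrable (ae_of_all _ hr.nonneg)
        β).integrable_smul_right_of_hasCompactSupport cvζ hvζc
    have h3 : |(∫ x, logDensity β V ρ x * dvel j ζ x) - ∫ x, logDensity β V u x * dvel j ζ x|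
        ≤ c * κ := by
      rw [← integral_sub i1 i2]
      refine abs_integral_le_integral_abs.trans ?_
      have i3 : Integrable fun x => |u x - ρ x| := (hr.integrable.sub hρ).abs
      calc _ ≤ ∫ x, c * |u x - ρ x| := by
            refine integral_mono_ae (i1.sub i2).abs (i3.const_mul c) (hρ0.mono fun x hx => ?_)
            have hw := expEnergy_pos β V x
            have h4 := abs_log_one_add_sub_log_one_add_le (mul_nonneg hx hw.le)
              (mul_nonneg (hr.nonneg x) hw.le)
            have e : |ρ x * expEnergy β V x - u x * expEnergy β V x|
                = expEnergy β V x * |u x - ρ x| := by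
              rw [← sub_mul, abs_mul, abs_of_pos hw, abs_sub_comm, mul_comm]
            rw [e] at h4
            have h5 := hc j x
            rw [abs_mul, abs_of_pos hw] at h5
            dsimp only
            rw [← sub_mul, abs_mul]
            calc _ ≤ expEnergy β V x * |u x - ρ x| * |dvel j ζ x| := by
                  gcongr
                  exact h4
              _ = (expEnergy β V x * |dvel j ζ x|) * |u x - ρ x| := by ring
              _ ≤ _ := by gcongr
        _ ≤ c * κ := by
            rw [integral_const_mul]
            exact mul_le_mul_of_nonneg_left hr.integral_sub_le hc0
    have h6 := abs_sub_abs_le_abs_sub (∫ x, logDensity β V ρ x * dvel j ζ x)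
      (∫ x, logDensity β V u x * dvel j ζ x)
    have h7 : c * κ ≤ c * ε := by gcongr
    linarith
  have hlim : Tendsto (fun ε : ℝ => ε * (Z / 2 + 2 / σ + c)) (𝓝[>] 0) (𝓝 0) := by
    have : Tendsto (fun ε : ℝ => ε * (Z / 2 + 2 / σ + c)) (𝓝 0) (𝓝 (0 * (Z / 2 + 2 / σ + c))) :=
      tendsto_id.mul_const _
    rw [zero_mul] at this
    exact this.mono_left nhdsWithin_le_nhds
  have := ge_of_tendsto hlim (eventually_nhdsWithin_of_forall fun ε hε => key ε hε)
  exact abs_eq_zero.1 (le_antisymm this (abs_nonneg _))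

theorem fderiv_vel_eq_sum (ζ : Phase d → ℝ) (x : Phase d) (r : Param d) :
    fderiv ℝ ζ x (0, r) = ∑ j, r j * dvel j ζ x := by
  have h : ((0, r) : Phase d) = ∑ j, r j • velDir j := by
    have hr : r = ∑ j, r j • EuclideanSpace.single j (1 : ℝ) := by
      conv_lhs => rw [← (EuclideanSpace.basisFun (Fin d) ℝ).sum_repr r]
      simp
    refine Prod.ext ?_ ?_
    · simp [Prod.fst_sum, velDir]
    · rw [Prod.snd_sum]
      exact hr
  rw [h, map_sum]
  simp [dvel]

theorem fderiv_pos_eq_sum (ζ : Phase d → ℝ) (x : Phase d) (θ : Param d) :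
    fderiv ℝ ζ x (θ, 0) = ∑ j, θ j * dpos j ζ x := by
  have h : ((θ, 0) : Phase d) = ∑ j, θ j • posDir j := by
    have hr : θ = ∑ j, θ j • EuclideanSpace.single j (1 : ℝ) := by
      conv_lhs => rw [← (EuclideanSpace.basisFun (Fin d) ℝ).sum_repr θ]
      simp
    refine Prod.ext ?_ ?_
    · rw [Prod.fst_sum]
      exact hr
    · simp [Prod.snd_sum, posDir]
  rw [h, map_sum]
  simp [dpos]

/-- The density of a stationary solution with respect to the Gibbs weight does not depend on the
velocity. -/
theorem exists_ae_eq_comp_fst (hV : Differentiable ℝ V)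
    (hL : ∀ θ, ‖fderiv ℝ V θ‖ ≤ L) (hσ : 0 < σ) (hγ : γ = σ * β) (hK : 0 ≤ K)
    (hρ : Integrable ρ) (hρ0 : ∀ᵐ x, 0 ≤ ρ x)
    (hreg : ∀ κ : ℝ, 0 < κ → ∃ u Q A, IsRegularization V γ σ K κ ρ u Q A) :
    ∃ F : Param d → ℝ, ∀ᵐ x : Phase d, ρ x * expEnergy β V x = F x.1 := by
  have hloc := locallyIntegrable_logDensity hV hρ hρ0 β
  obtain ⟨F, hF, hlim⟩ := exists_tendsto_invariant_of_weak_deriv_eq_zero hloc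
    (LinearMap.ker (LinearMap.fst ℝ (Param d) (Param d))) (by
      intro v hv φ hφ hc
      obtain ⟨v₁, v₂⟩ := v
      obtain rfl : v₁ = 0 := hv
      have i : ∀ j, Integrable fun x => logDensity β V ρ x * dvel j φ x := fun j =>
        hloc.integrable_smul_right_of_hasCompactSupport (contDiff_dvel hφ j).continuous
          (hasCompactSupport_dvel hc j)
      have e : ∀ x, logDensity β V ρ x * fderiv ℝ φ x (0, v₂)
          = ∑ j, v₂ j * (logDensity β V ρ x * dvel j φ x) := by
        intro x
        rw [fderiv_vel_eq_sum, Finset.mul_sum]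
        exact Finset.sum_congr rfl fun j _ => mul_left_comm _ _ _
      rw [integral_congr_ae (ae_of_all _ e), integral_finsetSum _ fun j _ => (i j).const_mul _]
      refine Finset.sum_eq_zero fun j _ => ?_
      rw [integral_const_mul,
        integral_logDensity_mul_dvel_eq_zero hV hL hσ hγ hK hρ hρ0 hreg hφ hc j, mul_zero])
  -- The approximants are invariant in the velocity, so their limit can be read off at `(θ, 0)`;
  -- `exp · - 1` undoes `log (1 + ·)`.
  refine ⟨fun θ => Real.exp (limUnder atTop fun n => F n (θ, 0)) - 1, ?_⟩
  filter_upwards [hlim, hρ0] with x hx hx0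
  have e : ∀ n, F n (x.1, 0) = F n x := by
    intro n
    have := hF n (x.1, 0) (0, x.2) rfl
    simpa using this.symm
  simp_rw [e]
  rw [hx.limUnder_eq, logDensity, Real.exp_log]
  · ring
  · have := mul_nonneg hx0 (expEnergy_pos β V x).le
    linarith

end VelocityIndependence

/-! ### The relative density is constant -/

section Gibbs

variable {d : ℕ} {V : Param d → ℝ} {L β γ σ K : ℝ} {ρ : Phase d → ℝ}

/-- The formal adjoint, with respect to Lebesgue measure, of the operator that governs the density
of a stationary solution with respect to the Gibbs weight. -/
def densityGenerator (V : Param d → ℝ) (β σ : ℝ) (ξ : Phase d → ℝ) (x : Phase d) : ℝ :=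
  ∑ j, (x.2 j * dpos j ξ x - force V j x.1 * dvel j ξ x
    + σ * dvel j (fun y => dvel j ξ y + β * y.2 j * ξ y) x)

theorem contDiff_twisted {ξ : Phase d → ℝ} (hξ : ContDiff ℝ ∞ ξ) (β : ℝ) (j : Fin d) :
    ContDiff ℝ ∞ fun y : Phase d => dvel j ξ y + β * y.2 j * ξ y :=
  (contDiff_dvel hξ j).add ((contDiff_const.mul (contDiff_vel j)).mul hξ)

theorem hasCompactSupport_twisted {ξ : Phase d → ℝ} (hξ : HasCompactSupport ξ) (β : ℝ)
    (j : Fin d) : HasCompactSupport fun y : Phase d => dvel j ξ y + β * y.2 j * ξ y :=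
  (hasCompactSupport_dvel hξ j).add hξ.mul_left

/-- The test function is `ξ * expEnergy β V`; with `γ = σ * β` the derivatives of the weight cancel
the potential and friction terms, leaving an equation for `u * expEnergy β V`. Both errors enter
linearly. -/
theorem IsRegularization.integral_density_eq (hV : Differentiable ℝ V)
    (hL : ∀ θ, ‖fderiv ℝ V θ‖ ≤ L) {u A : Phase d → ℝ} {Q : Fin d → Phase d → ℝ} {κ : ℝ}
    (hr : IsRegularization V γ σ K κ ρ u Q A) (hγ : γ = σ * β) {ξ : Phase d → ℝ}
    (hξ : ContDiff ℝ ∞ ξ) (hc : HasCompactSupport ξ) :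
    ∫ x, u x * expEnergy β V x * densityGenerator V β σ ξ x
      = (∫ x, expEnergy β V x * ξ x * A x) + ∑ j, ∫ x,
        expEnergy β V x * (dvel j ξ x + β * x.2 j * ξ x) * (Q j x - force V j x.1 * u x) := by
  have hu := hr.contDiff
  have hud : Differentiable ℝ u := hu.differentiable (by simp)
  have hξd : Differentiable ℝ ξ := hξ.differentiable (by simp)
  set w := expEnergy β V with hw
  have hwd : Differentiable ℝ w := differentiable_expEnergy hV β
  have hdpw : ∀ j x, dpos j w x = β * force V j x.1 * w x := dpos_expEnergy hV β
  have hdvw : ∀ j x, dvel j w x = β * x.2 j * w x := dvel_expEnergy hV β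
  set q : Fin d → Phase d → ℝ := fun j y => dvel j ξ y + β * y.2 j * ξ y with hq
  have hqs : ∀ j, ContDiff ℝ ∞ (q j) := contDiff_twisted hξ β
  have hqc : ∀ j, HasCompactSupport (q j) := hasCompactSupport_twisted hc β
  have hqd : ∀ j, Differentiable ℝ (q j) := fun j => (hqs j).differentiable (by simp)
  set h : Phase d → ℝ := fun x => u x * w x with hh
  have hhd : Differentiable ℝ h := hud.mul hwd
  have hdph : ∀ j x, dpos j h x = (dpos j u x + β * force V j x.1 * u x) * w x := fun j x => by
    rw [hh, dpos_mul (hud x) (hwd x), hdpw]; ring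
  have hdvh : ∀ j x, dvel j h x = (dvel j u x + β * x.2 j * u x) * w x := fun j x => by
    rw [hh, dvel_mul (hud x) (hwd x), hdvw]; ring
  set ψ : Phase d → ℝ := fun x => ξ x * w x with hψ
  have hψd : Differentiable ℝ ψ := hξd.mul hwd
  have hψc : HasCompactSupport ψ := hc.mul_right
  have hdψ : ∀ j x, dvel j ψ x = w x * q j x := fun j x => by
    rw [hψ, dvel_mul (hξd x) (hwd x), hdvw]; simp only [hq]; ring
  have cu := hud.continuous
  have cw := hwd.continuous
  have cξ := hξd.continuous
  have ch := hhd.continuous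
  have cq : ∀ j, Continuous (q j) := fun j => (hqs j).continuous
  have cvq : ∀ j, Continuous (dvel j (q j)) := fun j => (contDiff_dvel (hqs j) j).continuous
  have cdu : ∀ j, Continuous (dpos j u) := fun j => (contDiff_dpos hu j).continuous
  have cvu : ∀ j, Continuous (dvel j u) := fun j => (contDiff_dvel hu j).continuous
  have cdξ : ∀ j, Continuous (dpos j ξ) := fun j => (contDiff_dpos hξ j).continuous
  have cvξ : ∀ j, Continuous (dvel j ξ) := fun j => (contDiff_dvel hξ j).continuous
  have cQ : ∀ j, Continuous (Q j) := fun j => (hr.contDiff_flux j).continuous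
  have cA := hr.continuous_err
  have htest := hr.integral_test_eq_zero hψd hψc fun j => by
    rw [funext (hdψ j)]; have := cq j; fun_prop
  have zf : ∀ x ∉ tsupport ξ, ∀ v, fderiv ℝ ξ x v = 0 := fun x hx v => by
    have : fderiv ℝ ξ x = 0 := by
      by_contra h
      exact hx (support_fderiv_subset ℝ h)
    simp [this]
  have z0 : ∀ x ∉ tsupport ξ, ξ x = 0 := fun x hx => image_eq_zero_of_notMem_tsupport hx
  have zp : ∀ x ∉ tsupport ξ, ∀ j, dpos j ξ x = 0 := fun x hx j => zf x hx _
  have zv : ∀ x ∉ tsupport ξ, ∀ j, dvel j ξ x = 0 := fun x hx j => zf x hx _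
  have zq : ∀ x ∉ tsupport ξ, ∀ j, q j x = 0 := fun x hx j => by
    simp only [hq]; rw [z0 x hx, zv x hx]; ring
  have int : ∀ f : Phase d → ℝ, Continuous f → (∀ x ∉ tsupport ξ, f x = 0) → Integrable f :=
    fun f hf hz => hf.integrable_of_hasCompactSupport (HasCompactSupport.intro hc hz)
  set G : Fin d → Phase d → ℝ := fun j x => x.2 j * (ξ x * h x) with hG
  set N : Fin d → Phase d → ℝ := fun j x => h x * q j x with hN
  have hvd : ∀ j, Differentiable ℝ fun x : Phase d => x.2 j := fun j => by fun_prop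
  have hGd : ∀ j, Differentiable ℝ (G j) := fun j => (hvd j).mul (hξd.mul hhd)
  have hNd : ∀ j, Differentiable ℝ (N j) := fun j => hhd.mul (hqd j)
  have hdG : ∀ j x, dpos j (G j) x = x.2 j * (ξ x * (dpos j u x * w x) + dpos j ξ x * h x)
      + force V j x.1 * (x.2 j * (ξ x * (β * h x))) := by
    intro j x
    have e2 : dpos j (fun y => ξ y * h y) x = ξ x * dpos j h x + dpos j ξ x * h x :=
      dpos_mul (hξd x) (hhd x) j
    have e3 := dpos_mul (hvd j x) (hξd.mul hhd x) j
    rw [dpos_vel, zero_mul, add_zero] at e3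
    refine e3.trans ?_
    change x.2 j * dpos j (fun y => ξ y * h y) x = _
    rw [e2, hdph]
    simp only [hh]
    ring
  have hdN : ∀ j x, dvel j (N j) x = h x * dvel j (q j) x + dvel j h x * q j x := fun j x =>
    dvel_mul (hhd x) (hqd j x) j
  have hpt : ∀ j x, u x * w x * (x.2 j * dpos j ξ x - force V j x.1 * dvel j ξ x
      + σ * dvel j (q j) x)
      = -(ψ x * x.2 j * dpos j u x + dvel j ψ x * (Q j x + γ * x.2 j * u x + σ * dvel j u x))
        + w x * q j x * (Q j x - force V j x.1 * u x)
        + (dpos j (G j) x + σ * dvel j (N j) x) := by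
    intro j x
    rw [hdG, hdN, hdvh, hdψ, hγ]
    simp only [hh, hψ, hq]
    ring
  have iG : ∀ j, Integrable (dpos j (G j)) := fun j => by
    rw [funext (hdG j)]
    refine (int _ (by have := cdu j; have := cdξ j; fun_prop) ?_).add
      (integrable_force_mul hL j (int _ (by fun_prop) ?_))
    · intro x hx; simp [z0 x hx, zp x hx]
    · intro x hx; simp [z0 x hx]
  have iN : ∀ j, Integrable (dvel j (N j)) := fun j => by
    have hvqc := hasCompactSupport_dvel (hqc j) j
    have c1 : Continuous (dvel j h) := by
      rw [funext (hdvh j)]; have := cvu j; fun_prop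
    rw [funext (hdN j)]
    exact ((ch.mul (cvq j)).integrable_of_hasCompactSupport hvqc.mul_left).add
      ((c1.mul (cq j)).integrable_of_hasCompactSupport (hqc j).mul_left)
  have iT : ∀ j, Integrable fun x => ψ x * x.2 j * dpos j u x
      + dvel j ψ x * (Q j x + γ * x.2 j * u x + σ * dvel j u x) := fun j => by
    refine int _ ?_ ?_
    · simp only [hdψ]
      have := cdu j; have := cvu j; have := cQ j; have := cq j
      fun_prop
    · intro x hx
      rw [hdψ, zq x hx]
      simp [hψ, z0 x hx]
  have iE : ∀ j, Integrable fun x => w x * q j x * (Q j x - force V j x.1 * u x) := fun j => by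
    have e : (fun x => w x * q j x * (Q j x - force V j x.1 * u x)) = fun x =>
        w x * q j x * Q j x + force V j x.1 * (-(w x * q j x * u x)) := by
      funext x; ring
    rw [e]
    have := cq j; have := cQ j
    refine (int _ (by fun_prop) ?_).add (integrable_force_mul hL j (int _ (by fun_prop) ?_))
    · intro x hx; simp [zq x hx]
    · intro x hx; simp [zq x hx]
  have iA : Integrable fun x => w x * ξ x * A x :=
    int _ (by fun_prop) fun x hx => by simp [z0 x hx]
  have hS : ∀ j, ∫ x, (dpos j (G j) x + σ * dvel j (N j) x) = 0 := by
    intro j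
    have hGc : HasCompactSupport (G j) :=
      HasCompactSupport.intro hc fun x hx => by simp [hG, z0 x hx]
    have hNc : HasCompactSupport (N j) := (hqc j).mul_left
    rw [integral_add (iG j) ((iN j).const_mul σ), integral_const_mul,
      integral_dpos_eq_zero (hGd j) hGc j (iG j), integral_dvel_eq_zero (hNd j) hNc j (iN j)]
    simp
  have iS : ∀ j, Integrable fun x => dpos j (G j) x + σ * dvel j (N j) x := fun j =>
    (iG j).add ((iN j).const_mul σ)
  have hall : ∀ x, u x * w x * densityGenerator V β σ ξ x
      = -(∑ j, (ψ x * x.2 j * dpos j u x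
          + dvel j ψ x * (Q j x + γ * x.2 j * u x + σ * dvel j u x)) + ψ x * A x)
        + (w x * ξ x * A x + ∑ j, w x * q j x * (Q j x - force V j x.1 * u x))
        + ∑ j, (dpos j (G j) x + σ * dvel j (N j) x) := by
    intro x
    rw [densityGenerator, Finset.mul_sum]
    change ∑ j, u x * w x * (x.2 j * dpos j ξ x - force V j x.1 * dvel j ξ x
      + σ * dvel j (q j) x) = _
    simp_rw [hpt, Finset.sum_add_distrib, Finset.sum_neg_distrib, Finset.sum_add_distrib]
    simp only [hψ]
    ring
  have j1 : Integrable fun x => -(∑ j, (ψ x * x.2 j * dpos j u x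
      + dvel j ψ x * (Q j x + γ * x.2 j * u x + σ * dvel j u x)) + ψ x * A x) :=
    ((integrable_finsetSum _ fun j _ => iT j).add
      (int _ (by fun_prop) fun x hx => by simp [hψ, z0 x hx])).neg
  have j2 : Integrable fun x => ∑ j, w x * q j x * (Q j x - force V j x.1 * u x) :=
    integrable_finsetSum _ fun j _ => iE j
  have j3 : Integrable fun x => ∑ j, (dpos j (G j) x + σ * dvel j (N j) x) :=
    integrable_finsetSum _ fun j _ => iS j
  have j4 : Integrable fun x =>
      w x * ξ x * A x + ∑ j, w x * q j x * (Q j x - force V j x.1 * u x) := iA.add j2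
  have j5 : Integrable fun x => -(∑ j, (ψ x * x.2 j * dpos j u x
      + dvel j ψ x * (Q j x + γ * x.2 j * u x + σ * dvel j u x)) + ψ x * A x)
      + (w x * ξ x * A x + ∑ j, w x * q j x * (Q j x - force V j x.1 * u x)) := j1.add j4
  rw [integral_congr_ae (ae_of_all _ hall), integral_add j5 j3, integral_add j1 j4,
    integral_add iA j2, integral_neg, htest, integral_finsetSum _ fun j _ => iS j,
    Finset.sum_eq_zero fun j _ => hS j, integral_finsetSum _ fun j _ => iE j]
  ring

/-- All factors multiplying `u - ρ` and the two errors are bounded, because `ξ` has compact support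
and the force is bounded; so the limit `κ → 0` can be taken. -/
theorem integral_density_mul_densityGenerator_eq_zero (hV : Differentiable ℝ V)
    (hL : ∀ θ, ‖fderiv ℝ V θ‖ ≤ L) (hγ : γ = σ * β) (hρ : Integrable ρ)
    (hreg : ∀ κ : ℝ, 0 < κ → ∃ u Q A, IsRegularization V γ σ K κ ρ u Q A)
    {ξ : Phase d → ℝ} (hξ : ContDiff ℝ ∞ ξ) (hc : HasCompactSupport ξ) :
    ∫ x, ρ x * expEnergy β V x * densityGenerator V β σ ξ x = 0 := by
  have hL0 : 0 ≤ L := (norm_nonneg _).trans (hL 0)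
  have cw := continuous_expEnergy hV β
  obtain ⟨c₁, hc₁0, hc₁⟩ := exists_abs_le_of_hasCompactSupport (d := d)
    (f := fun j x => expEnergy β V x * (x.2 j * dpos j ξ x
      + σ * dvel j (fun y => dvel j ξ y + β * y.2 j * ξ y) x))
    (fun j => by
      have := (contDiff_dpos hξ j).continuous
      have := (contDiff_dvel (contDiff_twisted hξ β j) j).continuous
      fun_prop)
    (fun j => HasCompactSupport.mul_left ((hasCompactSupport_dpos hc j).mul_left.add
      (hasCompactSupport_dvel (hasCompactSupport_twisted hc β j) j).mul_left))
  obtain ⟨c₂, hc₂0, hc₂⟩ := exists_abs_le_of_hasCompactSupport (d := d)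
    (f := fun j x => expEnergy β V x * dvel j ξ x)
    (fun j => cw.mul (contDiff_dvel hξ j).continuous)
    (fun j => (hasCompactSupport_dvel hc j).mul_left)
  obtain ⟨c₃, hc₃0, hc₃⟩ := exists_abs_le_of_hasCompactSupport (d := d)
    (f := fun j x => expEnergy β V x * (dvel j ξ x + β * x.2 j * ξ x))
    (fun j => cw.mul (contDiff_twisted hξ β j).continuous)
    (fun j => (hasCompactSupport_twisted hc β j).mul_left)
  obtain ⟨c₄, hc₄⟩ := (hc.mul_left (f := expEnergy β V)).exists_bound_of_continuous
    (cw.mul hξ.continuous)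
  have hc₄' : ∀ x, |expEnergy β V x * ξ x| ≤ c₄ := hc₄
  have hc₄0 : 0 ≤ c₄ := (abs_nonneg _).trans (hc₄' 0)
  set c := ∑ j : Fin d, (c₁ + L * c₂) with hcd
  have hc0 : 0 ≤ c := Finset.sum_nonneg fun j _ => by positivity
  have hgen : ∀ x, |expEnergy β V x * densityGenerator V β σ ξ x| ≤ c := by
    intro x
    rw [densityGenerator, Finset.mul_sum]
    refine (Finset.abs_sum_le_sum_abs _ _).trans (Finset.sum_le_sum fun j _ => ?_)
    have e : expEnergy β V x * (x.2 j * dpos j ξ x - force V j x.1 * dvel j ξ x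
        + σ * dvel j (fun y => dvel j ξ y + β * y.2 j * ξ y) x)
        = expEnergy β V x * (x.2 j * dpos j ξ x
          + σ * dvel j (fun y => dvel j ξ y + β * y.2 j * ξ y) x)
          + -(force V j x.1 * (expEnergy β V x * dvel j ξ x)) := by ring
    rw [e]
    refine (abs_add_le _ _).trans (add_le_add (hc₁ j x) ?_)
    rw [abs_neg, abs_mul]
    exact mul_le_mul (abs_force_le hL j _) (hc₂ j x) (abs_nonneg _) hL0
  have hmeas : Measurable fun x => expEnergy β V x * densityGenerator V β σ ξ x := by
    refine cw.measurable.mul (Finset.measurable_fun_sum _ fun j _ => ?_)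
    have h1 := (contDiff_dpos hξ j).continuous.measurable
    have h2 := (contDiff_dvel hξ j).continuous.measurable
    have h3 := (contDiff_dvel (contDiff_twisted hξ β j) j).continuous.measurable
    have h4 : Measurable fun x : Phase d => force V j x.1 :=
      (measurable_force j).comp measurable_fst
    have h5 : Measurable fun x : Phase d => x.2 j := (contDiff_vel j).continuous.measurable
    fun_prop
  have igen : ∀ f : Phase d → ℝ, Integrable f →
      Integrable fun x => f x * expEnergy β V x * densityGenerator V β σ ξ x := fun f hf => by
    have := hf.mul_bdd hmeas.aestronglyMeasurable (c := c) (ae_of_all _ hgen)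
    simpa only [mul_assoc] using this
  have key : ∀ κ : ℝ, 0 < κ → |∫ x, ρ x * expEnergy β V x * densityGenerator V β σ ξ x|
      ≤ (c + c₄ + d * c₃) * κ := by
    intro κ hκ
    obtain ⟨u, Q, A, hr⟩ := hreg κ hκ
    have hid := hr.integral_density_eq hV hL hγ hξ hc
    have hbd : ∀ (f g : Phase d → ℝ) (b : ℝ), 0 ≤ b → (∀ x, |f x| ≤ b) → Integrable g →
        ∫ x, |g x| ≤ κ → |∫ x, f x * g x| ≤ b * κ := by
      intro f g b hb hf hg hgκ
      refine abs_integral_le_integral_abs.trans ?_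
      calc ∫ x, |f x * g x| ≤ ∫ x, b * |g x| := by
            refine integral_mono_of_nonneg (ae_of_all _ fun x => abs_nonneg _)
              (hg.abs.const_mul b) (ae_of_all _ fun x => ?_)
            simp only [abs_mul]
            exact mul_le_mul_of_nonneg_right (hf x) (abs_nonneg _)
        _ ≤ b * κ := by
            rw [integral_const_mul]
            exact mul_le_mul_of_nonneg_left hgκ hb
    have h1 : |(∫ x, u x * expEnergy β V x * densityGenerator V β σ ξ x)
        - ∫ x, ρ x * expEnergy β V x * densityGenerator V β σ ξ x| ≤ c * κ := by
      rw [← integral_sub (igen u hr.integrable) (igen ρ hρ)]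
      have := hbd _ (fun x => u x - ρ x) c hc0 hgen (hr.integrable.sub hρ) hr.integral_sub_le
      refine le_trans (le_of_eq ?_) this
      congr 2
      funext x
      ring
    have h2 : |∫ x, expEnergy β V x * ξ x * A x| ≤ c₄ * κ :=
      hbd _ A c₄ hc₄0 hc₄' hr.integrable_err hr.integral_err_le
    have h3 : |∑ j, ∫ x, expEnergy β V x * (dvel j ξ x + β * x.2 j * ξ x)
        * (Q j x - force V j x.1 * u x)| ≤ d * c₃ * κ := by
      calc _ ≤ ∑ j : Fin d, c₃ * κ := (Finset.abs_sum_le_sum_abs _ _).trans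
            (Finset.sum_le_sum fun j _ =>
              hbd _ _ c₃ hc₃0 (hc₃ j) (hr.integrable_flux j) (hr.integral_flux_le j))
        _ = _ := by simp [mul_assoc]
    rw [hid] at h1
    rw [abs_le] at *
    constructor <;> linarith [h1.1, h1.2, h2.1, h2.2, h3.1, h3.2]
  have hlim : Tendsto (fun κ : ℝ => (c + c₄ + d * c₃) * κ) (𝓝[>] 0) (𝓝 0) := by
    have : Tendsto (fun κ : ℝ => (c + c₄ + d * c₃) * κ) (𝓝 0) (𝓝 ((c + c₄ + d * c₃) * 0)) :=
      tendsto_id.const_mul _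
    rw [mul_zero] at this
    exact this.mono_left nhdsWithin_le_nhds
  have := ge_of_tendsto hlim (eventually_nhdsWithin_of_forall fun κ hκ => key κ hκ)
  exact abs_eq_zero.1 (le_antisymm this (abs_nonneg _))

/-- A stationary density is proportional to the Gibbs density. -/
theorem exists_ae_density_eq_const (hV : Differentiable ℝ V)
    (hL : ∀ θ, ‖fderiv ℝ V θ‖ ≤ L) (hσ : 0 < σ) (hγ : γ = σ * β) (hK : 0 ≤ K)
    (hρ : Integrable ρ) (hρ0 : ∀ᵐ x, 0 ≤ ρ x)
    (hreg : ∀ κ : ℝ, 0 < κ → ∃ u Q A, IsRegularization V γ σ K κ ρ u Q A) :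
    ∃ c : ℝ, ∀ᵐ x : Phase d, ρ x * expEnergy β V x = c := by
  obtain ⟨F, hF⟩ := exists_ae_eq_comp_fst hV hL hσ hγ hK hρ hρ0 hreg
  have hloc := locallyIntegrable_mul_expEnergy hV hρ β
  set f : Phase d → ℝ := fun x => ρ x * expEnergy β V x with hf
  replace hF : ∀ᵐ x : Phase d, f x = F x.1 := hF
  have hint : ∀ g : Phase d → ℝ, Continuous g → HasCompactSupport g →
      Integrable fun x => f x * g x := fun g hg hc =>
    hloc.integrable_smul_right_of_hasCompactSupport hg hc
  have hforce : ∀ j, ∀ g : Phase d → ℝ, Continuous g → HasCompactSupport g →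
      Integrable fun x => f x * (force V j x.1 * g x) := fun j g hg hc => by
    simpa only [mul_left_comm] using integrable_force_mul hL j (hint g hg hc)
  have hvel : ∀ j, ∀ g : Phase d → ℝ, ContDiff ℝ ∞ g → HasCompactSupport g →
      ∫ x, f x * dvel j g x = 0 := by
    intro j g hg hc
    have e : ∀ g : Phase d → ℝ, (fun x => f x * g x) =ᵐ[volume] fun x => F x.1 * g x :=
      fun g => hF.mono fun x hx => by simp only [hx]
    rw [integral_congr_ae (e _)]
    exact integral_comp_fst_mul_dvel_eq_zero (hg.differentiable (by simp)) j
      ((hint g hg.continuous hc).congr (e _))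
      ((hint _ (contDiff_dvel hg j).continuous (hasCompactSupport_dvel hc j)).congr (e _))
  -- Multiplying by the force keeps the density a function of the position alone.
  have hvelforce : ∀ j, ∀ g : Phase d → ℝ, ContDiff ℝ ∞ g → HasCompactSupport g →
      ∫ x, f x * (force V j x.1 * dvel j g x) = 0 := by
    intro j g hg hc
    have e : ∀ g : Phase d → ℝ, (fun x => f x * (force V j x.1 * g x))
        =ᵐ[volume] fun x => (F x.1 * force V j x.1) * g x :=
      fun g => hF.mono fun x hx => by simp only [hx, mul_assoc]
    rw [integral_congr_ae (e _)]
    exact integral_comp_fst_mul_dvel_eq_zero (b := fun θ => F θ * force V j θ)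
      (hg.differentiable (by simp)) j
      ((hforce j g hg.continuous hc).congr (e _))
      ((hforce j _ (contDiff_dvel hg j).continuous (hasCompactSupport_dvel hc j)).congr (e _))
  have hpos : ∀ i, ∀ g : Phase d → ℝ, ContDiff ℝ ∞ g → HasCompactSupport g →
      ∫ x, f x * dpos i g x = 0 := by
    intro i g hg hc
    -- Testing with the velocity derivative `dvel i g` makes every term of the equation a velocity
    -- derivative, which integrates to zero, except the commutator found in `e1`: it is minus the
    -- `i`-th position derivative of `g`.
    have hξ := contDiff_dvel hg i
    have hξc := hasCompactSupport_dvel hc i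
    have h0 := integral_density_mul_densityGenerator_eq_zero hV hL hγ hρ hreg hξ hξc
    change ∫ x, f x * densityGenerator V β σ (dvel i g) x = 0 at h0
    have hps : ∀ j, ContDiff ℝ ∞ fun y : Phase d => y.2 j * dpos j g y := fun j =>
      (contDiff_vel j).mul (contDiff_dpos hg j)
    have hpc : ∀ j, HasCompactSupport fun y : Phase d => y.2 j * dpos j g y := fun j =>
      (hasCompactSupport_dpos hc j).mul_left
    have e1 : ∀ j x, x.2 j * dpos j (dvel i g) x = dvel i (fun y => y.2 j * dpos j g y) x
        - (if j = i then 1 else 0) * dpos j g x := by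
      intro j x
      rw [dvel_mul ((contDiff_vel j).differentiable (by simp) x)
        ((contDiff_dpos hg j).differentiable (by simp) x), dvel_vel, dpos_comm_dvel hg]
      ring
    have i1 : ∀ j, Integrable fun x => f x * dvel i (fun y => y.2 j * dpos j g y) x := fun j =>
      hint _ (contDiff_dvel (hps j) i).continuous (hasCompactSupport_dvel (hpc j) i)
    have i2 : ∀ j, Integrable fun x => f x * dpos j g x := fun j =>
      hint _ (contDiff_dpos hg j).continuous (hasCompactSupport_dpos hc j)
    have i3 : ∀ j, Integrable fun x => f x * (force V j x.1 * dvel j (dvel i g) x) := fun j =>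
      hforce j _ (contDiff_dvel hξ j).continuous (hasCompactSupport_dvel hξc j)
    have i4 : ∀ j, Integrable fun x =>
        f x * dvel j (fun y => dvel j (dvel i g) y + β * y.2 j * dvel i g y) x := fun j =>
      hint _ (contDiff_dvel (contDiff_twisted hξ β j) j).continuous
        (hasCompactSupport_dvel (hasCompactSupport_twisted hξc β j) j)
    have e2 : ∀ x, f x * densityGenerator V β σ (dvel i g) x
        = ∑ j, (f x * dvel i (fun y => y.2 j * dpos j g y) x
          - (if j = i then 1 else 0) * (f x * dpos j g x)
          - f x * (force V j x.1 * dvel j (dvel i g) x)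
          + σ * (f x * dvel j (fun y => dvel j (dvel i g) y + β * y.2 j * dvel i g y) x)) := by
      intro x
      rw [densityGenerator, Finset.mul_sum]
      refine Finset.sum_congr rfl fun j _ => ?_
      rw [e1]
      ring
    have e3 : ∀ j, ∫ x, (f x * dvel i (fun y => y.2 j * dpos j g y) x
          - (if j = i then 1 else 0) * (f x * dpos j g x)
          - f x * (force V j x.1 * dvel j (dvel i g) x)
          + σ * (f x * dvel j (fun y => dvel j (dvel i g) y + β * y.2 j * dvel i g y) x))
        = -((if j = i then 1 else 0) * ∫ x, f x * dpos j g x) := by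
      intro j
      have := i1 j
      have := i2 j
      have := i3 j
      have := i4 j
      simp (disch := fun_prop) only [integral_add, integral_sub, integral_const_mul]
      rw [hvel i _ (hps j) (hpc j), hvelforce j _ hξ hξc,
        hvel j _ (contDiff_twisted hξ β j) (hasCompactSupport_twisted hξc β j)]
      ring
    have i5 : ∀ j, Integrable fun x => (f x * dvel i (fun y => y.2 j * dpos j g y) x
          - (if j = i then 1 else 0) * (f x * dpos j g x)
          - f x * (force V j x.1 * dvel j (dvel i g) x)
          + σ * (f x * dvel j (fun y => dvel j (dvel i g) y + β * y.2 j * dvel i g y) x)) :=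
      fun j => (((i1 j).sub ((i2 j).const_mul _)).sub (i3 j)).add ((i4 j).const_mul _)
    rw [integral_congr_ae (ae_of_all _ e2), integral_finsetSum _ fun j _ => i5 j,
      Finset.sum_congr rfl fun j _ => e3 j] at h0
    simpa using h0
  obtain ⟨Φ, hΦ, hlim⟩ := exists_tendsto_invariant_of_weak_deriv_eq_zero hloc ⊤ (by
    intro v _ φ hφ hc
    have ip : ∀ j, Integrable fun x => f x * dpos j φ x := fun j =>
      hint _ (contDiff_dpos hφ j).continuous (hasCompactSupport_dpos hc j)
    have iv : ∀ j, Integrable fun x => f x * dvel j φ x := fun j =>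
      hint _ (contDiff_dvel hφ j).continuous (hasCompactSupport_dvel hc j)
    have e : ∀ x, f x * fderiv ℝ φ x v
        = ∑ j, v.1 j * (f x * dpos j φ x) + ∑ j, v.2 j * (f x * dvel j φ x) := by
      intro x
      have hv : v = (v.1, 0) + (0, v.2) := by simp
      rw [hv, map_add, fderiv_vel_eq_sum, fderiv_pos_eq_sum, mul_add, Finset.mul_sum,
        Finset.mul_sum]
      simp [mul_left_comm]
    change ∫ x, f x * fderiv ℝ φ x v = 0
    rw [integral_congr_ae (ae_of_all _ e), integral_add
      (integrable_finsetSum _ fun j _ => (ip j).const_mul _)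
      (integrable_finsetSum _ fun j _ => (iv j).const_mul _),
      integral_finsetSum _ fun j _ => (ip j).const_mul _,
      integral_finsetSum _ fun j _ => (iv j).const_mul _]
    simp [integral_const_mul, hpos _ φ hφ hc, hvel _ φ hφ hc])
  -- Invariance under all of phase space means that each approximant is constant, hence so is the
  -- almost everywhere limit.
  have hconst : ∀ n x y, Φ n x = Φ n y := fun n x y => by
    have := hΦ n y (x - y) trivial
    simpa using this
  obtain ⟨x₀, hx₀⟩ := hlim.exists
  refine ⟨f x₀, hlim.mono fun x hx => ?_⟩
  exact tendsto_nhds_unique hx (hx₀.congr fun n => hconst n x₀ x)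

end Gibbs

/-! ### Position marginals of stationary solutions -/

section Marginal

variable {d : ℕ} {H : Type*} [NormedAddCommGroup H] [InnerProductSpace ℝ H]
  {R : H → ℝ} {Ψ : Param d → H} {g : Param d → ℝ}

theorem IsDensity.marginal {ρ : Phase d → ℝ} (h : IsDensity ρ) : IsDensity (marginal ρ) := by
  have hi : Integrable ρ (volume.prod volume) := h.integrable
  refine ⟨hi.integral_prod_left, ?_, ?_⟩
  · have h0 : ∀ᵐ x ∂((volume : Measure (Param d)).prod (volume : Measure (Param d))), 0 ≤ ρ x :=
      h.nonneg
    filter_upwards [Measure.ae_ae_of_ae_prod h0] with θ hθ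
    exact integral_nonneg_of_ae hθ
  · rw [← h.integral_eq_one]
    exact (integral_prod ρ hi).symm

theorem IsDensity.integral_abs {α : Type*} [MeasureSpace α] {ρ : α → ℝ} (h : IsDensity ρ) :
    ∫ x, |ρ x| = 1 := by
  rw [← h.integral_eq_one]
  exact integral_congr_ae (h.nonneg.mono fun x hx => abs_of_nonneg hx)

theorem Assumptions.differentiable_dRisk (hA : Assumptions R Ψ g) (ρ : Param d → ℝ) :
    Differentiable ℝ (dRisk R Ψ ρ) :=
  (fderiv ℝ R (output Ψ ρ)).differentiable.comp hA.feature_differentiable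

theorem Assumptions.differentiable_dObjective (hA : Assumptions R Ψ g) (ρ : Param d → ℝ) :
    Differentiable ℝ (dObjective R Ψ g ρ) :=
  (hA.differentiable_dRisk ρ).add hA.reg_differentiable

theorem Assumptions.exists_norm_fderiv_le (hA : Assumptions R Ψ g) :
    ∃ L : ℝ, 0 ≤ L ∧ ∀ ρ : Param d → ℝ, IsDensity ρ →
      ∀ θ, ‖fderiv ℝ (dObjective R Ψ g ρ) θ‖ ≤ L := by
  obtain ⟨L, hL⟩ := hA.gradient_bounded
  refine ⟨max L 0, le_max_right _ _, fun ρ hρ θ =>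
    (norm_fderiv_le_of_ae_norm_fderiv_le (hA.differentiable_dObjective ρ)
      ((hL ρ hρ).mono fun θ hθ => ?_) θ).trans (le_max_left _ _)⟩
  rwa [← norm_gradient_eq_norm_fderiv]

/-- The position marginal of a stationary solution is a Gibbs density. -/
theorem IsStationary.exists_marginal_eq (hA : Assumptions R Ψ g) {β γ : ℝ} (hβ : 0 < β)
    (hγ : 0 < γ) {ρ : Phase d → ℝ} (h : IsStationary R Ψ g β γ ρ) :
    ∃ c : ℝ, ∀ᵐ θ, marginal ρ θ = c * Real.exp (-(β * dObjective R Ψ g (marginal ρ) θ)) := by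
  have hd : IsDensity ρ := h.density 0 le_rfl
  obtain ⟨L, hL0, hL⟩ := hA.exists_norm_fderiv_le
  have hLm := hL _ hd.marginal
  -- Stationarity freezes the nonlinearity: with the marginal fixed, the equation for `ρ` is linear
  -- with potential `V`.
  set V := dObjective R Ψ g (HeavyBall.marginal ρ) with hV
  have hVd : Differentiable ℝ V := hA.differentiable_dObjective _
  obtain ⟨c, hc⟩ := exists_ae_density_eq_const (σ := γ * β⁻¹) (γ := γ) (β := β)
    (K := 2 * L + γ) hVd hLm (by positivity) (by field_simp) (by positivity) hd.integrable hd.nonneg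
    fun κ hκ => exists_isRegularization hLm hγ.le hd.integrable hd.nonneg
      (fun φ hφ hφc => h.integral_kineticGenerator_eq_zero hφ hφc) hκ
  -- The velocity enters the Gibbs density through a separate Gaussian factor. The value of its
  -- integral is never used, since normalization determines the constant.
  refine ⟨c * ∫ r : Param d, Real.exp (-(β * (‖r‖ ^ 2 / 2))), ?_⟩
  have hc' : ∀ᵐ x ∂((volume : Measure (Param d)).prod (volume : Measure (Param d))),
    ρ x * expEnergy β V x = c := hc
  filter_upwards [Measure.ae_ae_of_ae_prod hc'] with θ hθ
  have e : ∀ᵐ r, ρ (θ, r) = c * Real.exp (-(β * V θ)) * Real.exp (-(β * (‖r‖ ^ 2 / 2))) := by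
    filter_upwards [hθ] with r hr
    rw [← hr, expEnergy, mul_assoc, mul_assoc, ← Real.exp_add, ← Real.exp_add]
    have : β * (V θ + ‖r‖ ^ 2 / 2) + (-(β * V θ) + -(β * (‖r‖ ^ 2 / 2))) = 0 := by ring
    dsimp only
    rw [this, Real.exp_zero, mul_one]
  rw [HeavyBall.marginal, integral_congr_ae e, integral_const_mul]
  ring

end Marginal

/-! ### Comparison of a Gibbs density with arbitrary competitors -/

section Optimality

variable {d : ℕ} {H : Type*} [NormedAddCommGroup H] [InnerProductSpace ℝ H]
  {R : H → ℝ} {Ψ : Param d → H} {g : Param d → ℝ}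

/-- On the segment from `a` to `b` this is the one-variable fact that the derivative at the left end
is at most the secant slope. -/
theorem ConvexOn.add_fderiv_sub_le {R : H → ℝ} (hR : ConvexOn ℝ Set.univ R)
    (hd : Differentiable ℝ R) (a b : H) : R a + fderiv ℝ R a (b - a) ≤ R b := by
  have hc : ConvexOn ℝ Set.univ fun t : ℝ => R (a + t • (b - a)) := by
    have := hR.comp_affineMap (AffineMap.lineMap a b : ℝ →ᵃ[ℝ] H)
    refine this.congr fun t _ => ?_
    simp [AffineMap.lineMap_apply, add_comm]
  have h' : HasDerivAt (fun t : ℝ => R (a + t • (b - a))) (fderiv ℝ R a (b - a)) 0 := by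
    have hg : HasDerivAt (fun t : ℝ => a + t • (b - a)) (b - a) 0 := by
      simpa using ((hasDerivAt_id (0 : ℝ)).smul_const (b - a)).const_add a
    have h1 : HasFDerivAt R (fderiv ℝ R a) (a + (0 : ℝ) • (b - a)) := by
      simpa using (hd a).hasFDerivAt
    exact h1.comp_hasDerivAt 0 hg
  have := hc.le_slope_of_hasDerivAt (Set.mem_univ 0) (Set.mem_univ 1) zero_lt_one h'
  simp [slope_def_field] at this
  simp
  linarith

/-- The integral of a Gibbs weight with Lipschitz potential is bounded below in terms of the
minimum of the potential. -/
theorem neg_log_integral_exp_le {V : Param d → ℝ} (hV : Differentiable ℝ V) {L β : ℝ}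
    (hL : ∀ θ, ‖fderiv ℝ V θ‖ ≤ L) (hβ : 0 < β)
    (hi : Integrable fun θ => Real.exp (-(β * V θ))) (θ₀ : Param d) :
    -Real.log (∫ θ, Real.exp (-(β * V θ))) ≤
      β * V θ₀ + L + d * Real.log β - Real.log (volume.real (Metric.ball (0 : Param d) 1)) := by
  have hv : 0 < volume.real (Metric.ball (0 : Param d) 1) :=
    ENNReal.toReal_pos (Metric.measure_ball_pos _ _ one_pos).ne' measure_ball_lt_top.ne
  have hball : volume.real (Metric.ball θ₀ β⁻¹)
      = (β⁻¹) ^ d * volume.real (Metric.ball (0 : Param d) 1) := by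
    rw [measureReal_def, Measure.addHaar_ball_of_pos _ _ (inv_pos.2 hβ), ENNReal.toReal_mul,
      ENNReal.toReal_ofReal (by positivity), finrank_euclideanSpace_fin, measureReal_def]
  -- On the ball of radius `β⁻¹` the exponent `β * V` exceeds its value at the center by at most
  -- `L`, and the volume of that ball is the source of `d * log β`.
  have hle : Real.exp (-(β * V θ₀) - L) * ((β⁻¹) ^ d * volume.real (Metric.ball (0 : Param d) 1))
      ≤ ∫ θ, Real.exp (-(β * V θ)) := by
    calc _ = ∫ θ in Metric.ball θ₀ β⁻¹, Real.exp (-(β * V θ₀) - L) := by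
          rw [setIntegral_const, hball, smul_eq_mul, mul_comm]
      _ ≤ ∫ θ in Metric.ball θ₀ β⁻¹, Real.exp (-(β * V θ)) := by
          refine setIntegral_mono_on (integrableOn_const measure_ball_lt_top.ne) hi.integrableOn
            measurableSet_ball fun θ hθ => ?_
          refine Real.exp_le_exp.2 ?_
          have h1 : ‖V θ - V θ₀‖ ≤ L * ‖θ - θ₀‖ :=
            Convex.norm_image_sub_le_of_norm_fderiv_le (fun x _ => hV x) (fun x _ => hL x)
              convex_univ (Set.mem_univ θ₀) (Set.mem_univ θ)
          have h2 : ‖θ - θ₀‖ ≤ β⁻¹ := by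
            rw [← dist_eq_norm]; exact (Metric.mem_ball.1 hθ).le
          have hL0 : 0 ≤ L := (norm_nonneg _).trans (hL 0)
          have h3 : V θ - V θ₀ ≤ L * β⁻¹ :=
            (le_abs_self _).trans (h1.trans (mul_le_mul_of_nonneg_left h2 hL0))
          have h4 : β * (V θ - V θ₀) ≤ L := by
            calc _ ≤ β * (L * β⁻¹) := by gcongr
              _ = L := by field_simp
          linarith
      _ ≤ _ := setIntegral_le_integral hi (ae_of_all _ fun θ => (Real.exp_pos _).le)
  have hlog := Real.log_le_log (by positivity) hle
  rw [Real.log_mul (Real.exp_pos _).ne' (by positivity), Real.log_exp,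
    Real.log_mul (by positivity) hv.ne', Real.log_pow, Real.log_inv] at hlog
  linarith

/-- Half of the exponential absorbs the linear factor, so `g * exp (-(β * g))` is integrable as soon
as `exp (-(β / 2 * g))` is. -/
theorem mul_exp_neg_le {β x : ℝ} (hβ : 0 < β) :
    x * Real.exp (-(β * x)) ≤ 2 / β * Real.exp (-(β / 2 * x)) := by
  have h1 : β / 2 * x ≤ Real.exp (β / 2 * x) := by
    linarith [Real.add_one_le_exp (β / 2 * x)]
  have h2 : Real.exp (-(β * x)) = Real.exp (-(β / 2 * x)) * Real.exp (-(β / 2 * x)) := by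
    rw [← Real.exp_add]; congr 1; ring
  have h3 : Real.exp (β / 2 * x) * Real.exp (-(β / 2 * x)) = 1 := by
    rw [← Real.exp_add]; simp
  have h4 : x ≤ 2 / β * Real.exp (β / 2 * x) := by
    rw [div_mul_eq_mul_div, le_div_iff₀ hβ]; linarith
  calc _ ≤ (2 / β * Real.exp (β / 2 * x)) * Real.exp (-(β * x)) := by gcongr
    _ = 2 / β * ((Real.exp (β / 2 * x) * Real.exp (-(β / 2 * x))) * Real.exp (-(β / 2 * x))) := by
        rw [h2]; ring
    _ = _ := by rw [h3, one_mul]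

theorem Assumptions.integrable_reg_mul_exp (hA : Assumptions R Ψ g) {β : ℝ} (hβ : 0 < β) :
    Integrable fun θ => g θ * Real.exp (-(β * g θ)) := by
  have hg := hA.reg_differentiable.continuous
  refine ((hA.reg_integrable (β / 2) (by positivity)).const_mul (2 / β)).mono'
    (by fun_prop) (ae_of_all _ fun θ => ?_)
  rw [Real.norm_eq_abs, abs_of_nonneg (mul_nonneg (hA.reg_nonneg θ) (Real.exp_pos _).le)]
  exact mul_exp_neg_le hβ

theorem Assumptions.integrable_dRisk_mul (hA : Assumptions R Ψ g) (m : Param d → ℝ)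
    {η : Param d → ℝ} (hη : Integrable η) : Integrable fun θ => dRisk R Ψ m θ * η θ := by
  have := (fderiv ℝ R (output Ψ m)).integrable_comp (hA.feature_integrable η hη)
  refine this.congr (ae_of_all _ fun θ => ?_)
  simp [dRisk, mul_comm]

theorem Assumptions.fderiv_output [CompleteSpace H] (hA : Assumptions R Ψ g) (m : Param d → ℝ)
    {η : Param d → ℝ} (hη : Integrable η) :
    fderiv ℝ R (output Ψ m) (output Ψ η) = ∫ θ, dRisk R Ψ m θ * η θ := by
  rw [output, output, ← ContinuousLinearMap.integral_comp_comm _ (hA.feature_integrable η hη)]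
  refine integral_congr_ae (ae_of_all _ fun θ => ?_)
  simp [dRisk, output, mul_comm]

/-- The comparison of a Gibbs density for its own potential with an arbitrary density. -/
theorem Assumptions.objective_gibbs_le [CompleteSpace H] (hA : Assumptions R Ψ g) {L β c : ℝ}
    (hβ : 0 < β) {m η : Param d → ℝ} (hm : IsDensity m) (hη : IsDensity η)
    (hgη : Integrable fun θ => g θ * η θ) (hL : ∀ θ, ‖fderiv ℝ (dObjective R Ψ g m) θ‖ ≤ L)
    (hmc : ∀ᵐ θ, m θ = c * Real.exp (-(β * dObjective R Ψ g m θ))) :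
    (Integrable fun θ => g θ * m θ) ∧
    R (output Ψ m) + (1 - 1 / β) * (∫ θ, g θ * m θ) ≤ R (output Ψ η) + (∫ θ, g θ * η θ) +
      (Real.log (∫ θ, Real.exp (-(1 * g θ))) + L
        - Real.log (volume.real (Metric.ball (0 : Param d) 1)) + d * Real.log β) / β := by
  set V := dObjective R Ψ g m with hV
  have hVd : Differentiable ℝ V := hA.differentiable_dObjective m
  have hVc := hVd.continuous
  have hgc := hA.reg_differentiable.continuous
  obtain ⟨M, hM⟩ := hA.dRisk_bounded
  have hMm : ∀ θ, |dRisk R Ψ m θ| ≤ M := hM m hm.integrable hm.integral_abs.le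
  have hVg : ∀ θ, g θ - M ≤ V θ := fun θ => by
    have := (abs_le.1 (hMm θ)).1
    simp only [hV, dObjective]; linarith
  have hexp : ∀ θ, Real.exp (-(β * V θ)) ≤ Real.exp (β * M) * Real.exp (-(β * g θ)) := fun θ => by
    rw [← Real.exp_add, Real.exp_le_exp]
    have := mul_le_mul_of_nonneg_left (hVg θ) hβ.le
    linarith
  have hiZ : Integrable fun θ => Real.exp (-(β * V θ)) :=
    ((hA.reg_integrable β hβ).const_mul (Real.exp (β * M))).mono' (by fun_prop)
      (ae_of_all _ fun θ => by rw [Real.norm_eq_abs, Real.abs_exp]; exact hexp θ)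
  set Z := ∫ θ, Real.exp (-(β * V θ)) with hZ
  have hcZ : c * Z = 1 := by
    rw [← hm.integral_eq_one, integral_congr_ae hmc, integral_const_mul]
  have hZ0 : 0 < Z := by
    refine lt_of_le_of_ne (integral_nonneg fun θ => (Real.exp_pos _).le) fun h => ?_
    rw [← h] at hcZ
    simp at hcZ
  have hc0 : 0 < c := pos_of_mul_pos_left (by rw [hcZ]; exact one_pos) hZ0.le
  have hlogc : Real.log c = -Real.log Z := by
    have := congrArg Real.log hcZ
    rw [Real.log_mul hc0.ne' hZ0.ne', Real.log_one] at this
    linarith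
  have igm : Integrable fun θ => g θ * m θ := by
    have h1 : Integrable fun θ => g θ * Real.exp (-(β * V θ)) := by
      refine ((hA.integrable_reg_mul_exp hβ).const_mul (Real.exp (β * M))).mono' (by fun_prop)
        (ae_of_all _ fun θ => ?_)
      rw [Real.norm_eq_abs, abs_mul, abs_of_nonneg (hA.reg_nonneg θ), Real.abs_exp]
      have := mul_le_mul_of_nonneg_left (hexp θ) (hA.reg_nonneg θ)
      linarith
    refine (h1.const_mul c).congr (hmc.mono fun θ hθ => ?_)
    simp only [hθ]
    ring
  refine ⟨igm, ?_⟩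
  have ifm := hA.integrable_dRisk_mul m hm.integrable
  have ifη := hA.integrable_dRisk_mul m hη.integrable
  have iVm : Integrable fun θ => V θ * m θ :=
    (ifm.add igm).congr (ae_of_all _ fun θ => by simp [hV, dObjective, add_mul])
  have iVη : Integrable fun θ => V θ * η θ :=
    (ifη.add hgη).congr (ae_of_all _ fun θ => by simp [hV, dObjective, add_mul])
  have sVm : ∫ θ, V θ * m θ = (∫ θ, dRisk R Ψ m θ * m θ) + ∫ θ, g θ * m θ := by
    rw [← integral_add ifm igm]
    exact integral_congr_ae (ae_of_all _ fun θ => by simp [hV, dObjective, add_mul])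
  have sVη : ∫ θ, V θ * η θ = (∫ θ, dRisk R Ψ m θ * η θ) + ∫ θ, g θ * η θ := by
    rw [← integral_add ifη hgη]
    exact integral_congr_ae (ae_of_all _ fun θ => by simp [hV, dObjective, add_mul])
  -- Convexity reduces the comparison of the risks to the difference of two linear functionals of
  -- the potential at `m`.
  have hconv := ConvexOn.add_fderiv_sub_le hA.risk_convex hA.risk_differentiable
    (output Ψ m) (output Ψ η)
  rw [map_sub, hA.fderiv_output m hη.integrable, hA.fderiv_output m hm.integrable] at hconv
  -- the potential attains its minimum
  have hVt : Tendsto V (cocompact (Param d)) atTop := by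
    refine tendsto_atTop_mono hVg ?_
    exact tendsto_atTop_add_const_right _ (-M) hA.reg_tendsto
  obtain ⟨θ₀, hθ₀⟩ := hVc.exists_forall_le hVt
  have hmin : V θ₀ ≤ ∫ θ, V θ * η θ := by
    calc V θ₀ = ∫ θ, V θ₀ * η θ := by rw [integral_const_mul, hη.integral_eq_one, mul_one]
      _ ≤ _ := integral_mono_ae (hη.integrable.const_mul _) iVη
        (hη.nonneg.mono fun θ hθ => mul_le_mul_of_nonneg_right (hθ₀ θ) hθ)
  have hZle := neg_log_integral_exp_le hVd hL hβ hiZ θ₀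
  -- the entropy of `m` relative to `exp (-g)`
  have hiG := hA.reg_integrable 1 one_pos
  set G := ∫ θ, Real.exp (-(1 * g θ)) with hG
  have hG0 : 0 < G := by
    rw [hG, integral_pos_iff_support_of_nonneg (fun θ => (Real.exp_pos _).le) hiG]
    have : (Function.support fun θ => Real.exp (-(1 * g θ))) = Set.univ := by
      ext θ; simp [(Real.exp_pos _).ne']
    rw [this]
    exact isOpen_univ.measure_pos _ Set.univ_nonempty
  have hent : β * (∫ θ, V θ * m θ) + Real.log Z - (∫ θ, g θ * m θ) - Real.log G ≤ 0 := by
    -- This is `log y ≤ y - 1` at `y = G⁻¹ exp (-g) / m`, multiplied by `m`. Since `log m` is affine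
    -- in `V`, integrability of the entropy comes for free.
    have hpt : ∀ᵐ θ, β * (V θ * m θ) + Real.log Z * m θ - g θ * m θ - Real.log G * m θ
        ≤ G⁻¹ * Real.exp (-(1 * g θ)) - m θ := by
      filter_upwards [hmc] with θ hθ
      have hm0 : 0 < m θ := by rw [hθ]; positivity
      have hlogm : Real.log (m θ) = -Real.log Z - β * V θ := by
        rw [hθ, Real.log_mul hc0.ne' (Real.exp_pos _).ne', Real.log_exp, hlogc]; ring
      have hx : 0 < G⁻¹ * Real.exp (-(1 * g θ)) / m θ := by positivity
      have h1 := Real.log_le_sub_one_of_pos hx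
      rw [Real.log_div (by positivity) hm0.ne', Real.log_mul (by positivity) (Real.exp_pos _).ne',
        Real.log_inv, Real.log_exp, hlogm] at h1
      have h2 := mul_le_mul_of_nonneg_right h1 hm0.le
      have e : (G⁻¹ * Real.exp (-(1 * g θ)) / m θ - 1) * m θ
          = G⁻¹ * Real.exp (-(1 * g θ)) - m θ := by
        rw [sub_mul, div_mul_cancel₀ (G⁻¹ * Real.exp (-(1 * g θ))) hm0.ne', one_mul (m θ)]
      rw [e] at h2
      linarith
    have j1 := iVm.const_mul β
    have j2 := hm.integrable.const_mul (Real.log Z)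
    have j3 := hm.integrable.const_mul (Real.log G)
    have j4 := hiG.const_mul G⁻¹
    have j5 := hm.integrable
    have h := integral_mono_ae (((j1.add j2).sub igm).sub j3) (j4.sub j5) hpt
    simp only [Pi.add_apply, Pi.sub_apply] at h
    simp (disch := fun_prop) only [integral_add, integral_sub, integral_const_mul] at h
    rw [hm.integral_eq_one, ← hG, inv_mul_cancel₀ hG0.ne'] at h
    linarith
  have hfinal : ∫ θ, V θ * m θ ≤ (∫ θ, g θ * m θ) / β + V θ₀ + (Real.log G + L
      - Real.log (volume.real (Metric.ball (0 : Param d) 1)) + d * Real.log β) / β := by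
    rw [← mul_le_mul_iff_right₀ hβ]
    field_simp
    linarith
  -- The entropy bound costs exactly `(∫ g m) / β`; subtracting it on the left lowers the weight of
  -- the regularizer to `1 - 1 / β`.
  have e : (1 - 1 / β) * (∫ θ, g θ * m θ) = (∫ θ, g θ * m θ) - (∫ θ, g θ * m θ) / β := by ring
  rw [e]
  linarith

end Optimality

/-! ### Objectives with values in `[0, ∞]` and the limit of large `β` -/

variable {d : ℕ} {H : Type*} [NormedAddCommGroup H] [InnerProductSpace ℝ H]
  {R : H → ℝ} {Ψ : Param d → H} {g : Param d → ℝ}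

theorem Assumptions.ae_reg_mul_nonneg (hA : Assumptions R Ψ g) {η : Param d → ℝ}
    (hη : IsDensity η) : 0 ≤ᵐ[volume] fun θ => g θ * η θ :=
  hη.nonneg.mono fun θ hθ => mul_nonneg (hA.reg_nonneg θ) hθ

theorem Assumptions.objective_eq_ofReal (hA : Assumptions R Ψ g) {lam : ℝ} (hlam : 0 ≤ lam)
    {η : Param d → ℝ} (hη : IsDensity η) (hi : Integrable fun θ => g θ * η θ) :
    objective R Ψ g lam η = ENNReal.ofReal (R (output Ψ η) + lam * ∫ θ, g θ * η θ) := by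
  have h0 := hA.ae_reg_mul_nonneg hη
  rw [objective, ← ofReal_integral_eq_lintegral_ofReal hi h0, ← ENNReal.ofReal_mul hlam,
    ← ENNReal.ofReal_add (hA.risk_nonneg _) (mul_nonneg hlam (integral_nonneg_of_ae h0))]

theorem Assumptions.integrable_reg_mul_of_objective_ne_top (hA : Assumptions R Ψ g)
    {η : Param d → ℝ} (hη : IsDensity η) (h : objective R Ψ g 1 η ≠ ⊤) :
    Integrable fun θ => g θ * η θ := by
  refine ⟨hA.reg_differentiable.continuous.aestronglyMeasurable.mul
    hη.integrable.aestronglyMeasurable, ?_⟩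
  rw [hasFiniteIntegral_iff_ofReal (hA.ae_reg_mul_nonneg hη), lt_top_iff_ne_top]
  intro ht
  apply h
  simp [objective, ht]

/-- The normalized `exp (-g)` is a competitor of finite objective, so the infimum can be handled as
a real number. -/
theorem Assumptions.iInf_objective_ne_top (hA : Assumptions R Ψ g) :
    (⨅ η : {η : Param d → ℝ // IsDensity η}, objective R Ψ g 1 η.1) ≠ ⊤ := by
  have hiG := hA.reg_integrable 1 one_pos
  have hG0 : 0 < ∫ θ, Real.exp (-(1 * g θ)) := integral_exp_pos hiG
  set G := ∫ θ, Real.exp (-(1 * g θ)) with hG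
  have hη : IsDensity fun θ => G⁻¹ * Real.exp (-(1 * g θ)) :=
    ⟨hiG.const_mul _, ae_of_all _ fun θ => by positivity, by
      rw [integral_const_mul, ← hG, inv_mul_cancel₀ hG0.ne']⟩
  have hi : Integrable fun θ => g θ * (G⁻¹ * Real.exp (-(1 * g θ))) :=
    ((hA.integrable_reg_mul_exp one_pos).const_mul G⁻¹).congr
      (ae_of_all _ fun θ => by simp only []; ring)
  have h := iInf_le (fun η : {η : Param d → ℝ // IsDensity η} => objective R Ψ g 1 η.1) ⟨_, hη⟩
  refine ne_top_of_le_ne_top ?_ h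
  simp only []
  rw [hA.objective_eq_ofReal zero_le_one hη hi]
  exact ENNReal.ofReal_ne_top

/-- The suboptimality of stationary solutions for the partially regularized objective. -/
theorem Assumptions.exists_objective_marginal_le [CompleteSpace H] (hA : Assumptions R Ψ g) :
    ∃ C : ℝ, 0 ≤ C ∧ ∀ β : ℝ, 1 ≤ β → ∀ γ : ℝ, 0 < γ → ∀ ρ : Phase d → ℝ,
      IsStationary R Ψ g β γ ρ → objective R Ψ g (1 - 1 / β) (HeavyBall.marginal ρ)
        ≤ (⨅ η : {η : Param d → ℝ // IsDensity η}, objective R Ψ g 1 η.1)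
          + ENNReal.ofReal ((C + d * Real.log β) / β) := by
  obtain ⟨L, hL0, hL⟩ := hA.exists_norm_fderiv_le
  -- None of these three quantities involves `β`, `γ` or `ρ`; the gradient bound `L` is uniform over
  -- densities.
  set C := Real.log (∫ θ, Real.exp (-(1 * g θ))) + L
    - Real.log (volume.real (Metric.ball (0 : Param d) 1)) with hC
  refine ⟨max C 0, le_max_right _ _, fun β hβ γ hγ ρ hst => ?_⟩
  have hβ0 : 0 < β := one_pos.trans_le hβ
  have hm := (hst.density 0 le_rfl).marginal
  obtain ⟨c, hc⟩ := hst.exists_marginal_eq hA hβ0 hγ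
  have hlam : 0 ≤ 1 - 1 / β := by
    rw [sub_nonneg, div_le_one hβ0]
    exact hβ
  have hlog := Real.log_nonneg hβ
  rw [ENNReal.iInf_add]
  refine le_iInf fun η => ?_
  by_cases ht : objective R Ψ g 1 η.1 = ⊤
  · simp [ht]
  have hgη := hA.integrable_reg_mul_of_objective_ne_top η.2 ht
  obtain ⟨him, hle⟩ := hA.objective_gibbs_le hβ0 hm η.2 hgη (hL _ hm) hc
  have h0 := integral_nonneg_of_ae (hA.ae_reg_mul_nonneg η.2)
  have hr := hA.risk_nonneg (output Ψ η.1)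
  have hmax : 0 ≤ max C 0 := le_max_right _ _
  rw [hA.objective_eq_ofReal hlam hm him, hA.objective_eq_ofReal zero_le_one η.2 hgη,
    ← ENNReal.ofReal_add (by linarith) (by positivity)]
  refine ENNReal.ofReal_le_ofReal (hle.trans ?_)
  rw [one_mul]
  gcongr
  exact le_max_left _ _

theorem ofReal_mul_objective_le {lam : ℝ} (hlam1 : lam ≤ 1)
    (ρ : Param d → ℝ) : ENNReal.ofReal lam * objective R Ψ g 1 ρ ≤ objective R Ψ g lam ρ := by
  rw [objective, objective, mul_add, ENNReal.ofReal_one, one_mul]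
  gcongr
  calc _ ≤ 1 * ENNReal.ofReal (R (output Ψ ρ)) := by
        gcongr
        exact ENNReal.ofReal_le_one.2 hlam1
    _ = _ := one_mul _

theorem tendsto_inv_mul_add_log_div (i C D : ℝ) :
    Tendsto (fun β : ℝ => (1 - 1 / β)⁻¹ * (i + (C + D * Real.log β) / β)) atTop (𝓝 i) := by
  have h1 : Tendsto (fun β : ℝ => 1 / β) atTop (𝓝 0) := by
    simpa using tendsto_inv_atTop_zero (𝕜 := ℝ)
  have h2 : Tendsto (fun β : ℝ => Real.log β / β) atTop (𝓝 0) :=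
    Real.isLittleO_log_id_atTop.tendsto_div_nhds_zero
  have h3 := ((h1.const_sub 1).inv₀ (by norm_num)).mul
    (((h1.const_mul C).add (h2.const_mul D)).const_add i)
  refine (h3.congr fun β => by ring).trans ?_
  simp

end HeavyBall

end

theorem theorem4 {d : ℕ} {H : Type*} [NormedAddCommGroup H] [InnerProductSpace ℝ H]
    [CompleteSpace H] (R : H → ℝ) (Ψ : HeavyBall.Param d → H) (g : HeavyBall.Param d → ℝ)
    (hA : HeavyBall.Assumptions R Ψ g) :
    (∃ C : ℝ, 0 ≤ C ∧ ∀ β : ℝ, 1 ≤ β → ∀ γ : ℝ, 0 < γ → ∀ ρ : HeavyBall.Phase d → ℝ,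
      HeavyBall.IsStationary R Ψ g β γ ρ →
        HeavyBall.objective R Ψ g (1 - 1 / β) (HeavyBall.marginal ρ)
          ≤ (⨅ η : {η : HeavyBall.Param d → ℝ // HeavyBall.IsDensity η},
              HeavyBall.objective R Ψ g 1 η.1)
            + ENNReal.ofReal ((C + d * Real.log β) / β)) ∧
    (∀ ε : ℝ, 0 < ε → ∃ β₀ : ℝ, 1 ≤ β₀ ∧ ∀ β : ℝ, β₀ ≤ β → ∀ γ : ℝ, 0 < γ →
      ∀ ρ : HeavyBall.Phase d → ℝ, HeavyBall.IsStationary R Ψ g β γ ρ →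
        HeavyBall.objective R Ψ g 1 (HeavyBall.marginal ρ)
          ≤ (⨅ η : {η : HeavyBall.Param d → ℝ // HeavyBall.IsDensity η},
              HeavyBall.objective R Ψ g 1 η.1)
            + ENNReal.ofReal ε) := by
  have key := hA.exists_objective_marginal_le
  refine ⟨key, fun ε hε => ?_⟩
  obtain ⟨C, hC, hle⟩ := key
  have htop := hA.iInf_objective_ne_top
  set I := ⨅ η : {η : HeavyBall.Param d → ℝ // HeavyBall.IsDensity η},
    HeavyBall.objective R Ψ g 1 η.1
  have hI : I = ENNReal.ofReal I.toReal := (ENNReal.ofReal_toReal htop).symm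
  have hI0 : 0 ≤ I.toReal := ENNReal.toReal_nonneg
  obtain ⟨b, hb⟩ := eventually_atTop.1
    ((HeavyBall.tendsto_inv_mul_add_log_div I.toReal C d).eventually
    (eventually_le_nhds (lt_add_of_pos_right I.toReal hε)))
  -- At `β = 1` the regularizer drops out of the left side; `β ≥ 2` keeps `1 - 1 / β` positive, so
  -- that it can be divided out.
  refine ⟨max b 2, one_le_two.trans (le_max_right _ _), fun β hβ γ hγ ρ hst => ?_⟩
  have hβ2 : 2 ≤ β := (le_max_right _ _).trans hβ
  have hlam : 0 < 1 - 1 / β := by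
    rw [sub_pos, div_lt_one (by linarith)]
    linarith
  have hlam1 : 1 - 1 / β ≤ 1 := by
    have : 0 ≤ 1 / β := by positivity
    linarith
  have hlog := Real.log_nonneg (one_le_two.trans hβ2)
  have h := (HeavyBall.ofReal_mul_objective_le hlam1 _).trans
    (hle β (one_le_two.trans hβ2) γ hγ ρ hst)
  rw [hI, ← ENNReal.ofReal_add hI0 (by positivity), mul_comm,
    ← ENNReal.le_div_iff_mul_le (Or.inl (by simpa using hlam)) (Or.inl ENNReal.ofReal_ne_top),
    ← ENNReal.ofReal_div_of_pos hlam, div_eq_inv_mul] at h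
  rw [hI, ← ENNReal.ofReal_add hI0 hε.le]
  exact h.trans (ENNReal.ofReal_le_ofReal (hb β ((le_max_left _ _).trans hβ)))
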